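/- Let $n\in\{2,3\}$ and let $\Omega\subset\mathbb{R}^n$ be a bounded, simply connected open set with Lipschitz boundary. Let $M\ge 2$ and let $E_1,\dots,E_M\subset\partial\Omega$ (the electrodes) be nonempty, connected, relatively open subsets of $\partial\Omega$ with pairwise disjoint closures. Let $\sigma:\Omega\to\mathbb{R}^{n\times n}$ be measurable and symmetric with $\sigma_-|\xi|^2\le \xi^{\mathrm T}\sigma\xi\le\sigma_+|\xi|^2$ for all $\xi\in\mathbb{R}^n$, almost everywhere in $\Omega$, for some constants $\sigma_\pm>0$. Put $\mathbb{R}^M_\diamond=\{V\in\mathbb{R}^M:\sum_m V_m=0\}$ and let $\mathbb{H}^1=H^1(\Omega)\oplus\mathbb{R}^M_\diamond$ with the inner product $\int_\Omega(\nabla v\cdot\nabla w+vw)\,dx+V\cdot W$. For $z=(z_1,\dots,z_M)\in(0,\infty)^M$ (the contact impedances) and $\mathcal V=(v,V),\ \mathcal W=(w,W)\in\mathbb{H}^1$ let $$B_z(\mathcal V,\mathcal W)=\int_\Omega\sigma\nabla v\cdot\nabla w\,dx+\sum_{m=1}^M\frac1{z_m}\int_{E_m}(v-V_m)(w-W_m)\,dS,$$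 with boundary values in the sense of traces, and let $\mathbb{H}^1_0=\{(w,W)\in\mathbb{H}^1: w|_{E_m}=W_m,\ m=1,\dots,M\}$. Let $\mathbb V\subset\mathbb{H}^1$ be a closed subspace, $\mathbb V_0=\mathbb V\cap\mathbb{H}^1_0$ and $\phi\in\mathbb V'$. Then for each $z\in(0,\infty)^M$ there is exactly one $\mathcal U_{\mathbb V}(z)\in\mathbb V$ with $B_z(\mathcal U_{\mathbb V}(z),\mathcal W)=\phi(\mathcal W)$ for all $\mathcal W\in\mathbb V$; there is exactly one $\mathcal U_{\mathbb V_0}\in\mathbb V_0$ with $B_z(\mathcal U_{\mathbb V_0},\mathcal W)=\phi(\mathcal W)$ for all $\mathcal W\in\mathbb V_0$, and it does not depend on $z$; and $$\lim_{z\to0,\ z\in(0,\infty)^M}\mathcal U_{\mathbb V}(z)=\mathcal U_{\mathbb V_0}\quad\text{in the norm of }\mathbb{H}^1 .$$ In particular, for every $I\in\mathbb{R}^M_\diamond$ and $\phi(\mathcal W)=I\cdot W$, all of this holds for $\mathbb V=\mathbb{H}^1$ (the solution of the complete electrode model converges to that of the shunt model, i.e. to the solution on $\mathbb{H}^1_0$),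 and for $\mathbb V=P\oplus\mathbb{R}^M_\diamond$ with any finite-dimensional subspace $P\subset H^1(\Omega)$ (the finite element approximations of the complete electrode model converge to those of the shunt model). -/

import Mathlib

open MeasureTheory Filter Topology Matrix
open scoped ContDiff Gradient InnerProductSpace

noncomputable section

namespace CEM

/-- `∂Ω` is locally the graph of a Lipschitz function over a hyperplane, with `Ω` lying (locally)
on one side of it: near each boundary point, in the coordinates given by a unit vector `e` and its
orthogonal complement, `Ω` is the strict epigraph of a Lipschitz function `γ`. -/
def HasLipschitzBoundary {n : ℕ} (Ω : Set (EuclideanSpace ℝ (Fin n))) : Prop :=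
  ∀ x ∈ frontier Ω, ∃ e : EuclideanSpace ℝ (Fin n), ‖e‖ = 1 ∧
    ∃ (K : NNReal) (γ : EuclideanSpace ℝ (Fin n) → ℝ), LipschitzWith K γ ∧
      ∀ᶠ y in 𝓝 x, (y ∈ Ω ↔ γ (y - ⟪e, y⟫_ℝ • e) < ⟪e, y⟫_ℝ)

/-- The surface measure `dS` on `∂Ω`: the `(n-1)`-dimensional Hausdorff measure in its Euclidean
normalisation. -/
def surfaceMeasure {n : ℕ} (Ω : Set (EuclideanSpace ℝ (Fin n))) :
    Measure (EuclideanSpace ℝ (Fin n)) :=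
  (μHE[n - 1]).restrict (frontier Ω)

/-- The electrodes: nonempty, connected, relatively open subsets of `∂Ω` that are well separated,
i.e. have pairwise disjoint closures. -/
structure IsElectrodeConfiguration {n M : ℕ} (Ω : Set (EuclideanSpace ℝ (Fin n)))
    (E : Fin M → Set (EuclideanSpace ℝ (Fin n))) : Prop where
  relOpen : ∀ m, ∃ O : Set (EuclideanSpace ℝ (Fin n)), IsOpen O ∧ E m = O ∩ frontier Ω
  connected : ∀ m, IsConnected (E m)
  separated : Pairwise fun m k => Disjoint (closure (E m)) (closure (E k))

/-- A measurable, symmetric conductivity with `σ₋|ξ|² ≤ ξᵀσξ ≤ σ₊|ξ|²` for all `ξ`, almost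
everywhere in `Ω`. -/
structure IsConductivity {n : ℕ} (Ω : Set (EuclideanSpace ℝ (Fin n)))
    (σ : EuclideanSpace ℝ (Fin n) → Matrix (Fin n) (Fin n) ℝ) (σminus σplus : ℝ) : Prop where
  measurable : ∀ i j, AEMeasurable (fun x => σ x i j) (volume.restrict Ω)
  symmetric : ∀ᵐ x ∂(volume.restrict Ω), (σ x).IsSymm
  minus_pos : 0 < σminus
  plus_pos : 0 < σplus
  bounds : ∀ᵐ x ∂(volume.restrict Ω), ∀ ξ : Fin n → ℝ,
    σminus * (ξ ⬝ᵥ ξ) ≤ ξ ⬝ᵥ (σ x *ᵥ ξ) ∧ ξ ⬝ᵥ (σ x *ᵥ ξ) ≤ σplus * (ξ ⬝ᵥ ξ)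

/-- `g` is the weak gradient of `u` in `Ω`. -/
def IsWeakGradient {n : ℕ} (Ω : Set (EuclideanSpace ℝ (Fin n)))
    (u : EuclideanSpace ℝ (Fin n) → ℝ)
    (g : EuclideanSpace ℝ (Fin n) → EuclideanSpace ℝ (Fin n)) : Prop :=
  ∀ φ : EuclideanSpace ℝ (Fin n) → ℝ, ContDiff ℝ ∞ φ → HasCompactSupport φ → tsupport φ ⊆ Ω →
    ∀ v : EuclideanSpace ℝ (Fin n),
      ∫ x in Ω, u x * fderiv ℝ φ x v = -∫ x in Ω, ⟪g x, v⟫_ℝ * φ x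

theorem integrable_mul_test {n : ℕ} {Ω : Set (EuclideanSpace ℝ (Fin n))}
    {u ψ : EuclideanSpace ℝ (Fin n) → ℝ} (hu : MemLp u 2 (volume.restrict Ω))
    (hψ : Continuous ψ) (hc : HasCompactSupport ψ) :
    Integrable (fun x => u x * ψ x) (volume.restrict Ω) :=
  hu.integrable_mul (q := 2) ((hψ.memLp_of_hasCompactSupport hc).restrict Ω)

theorem integrable_mul_fderiv_test {n : ℕ} {Ω : Set (EuclideanSpace ℝ (Fin n))}
    {u φ : EuclideanSpace ℝ (Fin n) → ℝ} (hu : MemLp u 2 (volume.restrict Ω))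
    (hφ : ContDiff ℝ ∞ φ) (hc : HasCompactSupport φ) (v : EuclideanSpace ℝ (Fin n)) :
    Integrable (fun x => u x * fderiv ℝ φ x v) (volume.restrict Ω) :=
  integrable_mul_test hu ((hφ.continuous_fderiv (by simp)).clm_apply continuous_const)
    (hc.fderiv_apply (𝕜 := ℝ) v)

/-- The Sobolev space `H¹(Ω)`, realised as the space of pairs `(u, ∇u)` with `u ∈ L²(Ω)` having the
weak gradient `∇u ∈ L²(Ω)ⁿ` (which `u` determines when `Ω` is open). The inherited inner product is
`∫_Ω (∇v · ∇w + v w) dx`. -/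
def H1 {n : ℕ} (Ω : Set (EuclideanSpace ℝ (Fin n))) :
    Submodule ℝ (WithLp 2 (Lp ℝ 2 (volume.restrict Ω) ×
      Lp (EuclideanSpace ℝ (Fin n)) 2 (volume.restrict Ω))) where
  carrier := {w | IsWeakGradient Ω w.fst w.snd}
  zero_mem' := by
    intro φ _ _ _ v
    have h1 : ∫ x in Ω, ((0 : Lp ℝ 2 (volume.restrict Ω)) :
        EuclideanSpace ℝ (Fin n) → ℝ) x * fderiv ℝ φ x v = ∫ _ in Ω, (0 : ℝ) := by
      refine integral_congr_ae ?_
      filter_upwards [Lp.coeFn_zero ℝ 2 (volume.restrict Ω)] with x hx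
      rw [hx, Pi.zero_apply, zero_mul]
    have h2 : ∫ x in Ω, ⟪((0 : Lp (EuclideanSpace ℝ (Fin n)) 2 (volume.restrict Ω)) :
        EuclideanSpace ℝ (Fin n) → EuclideanSpace ℝ (Fin n)) x, v⟫_ℝ * φ x
          = ∫ _ in Ω, (0 : ℝ) := by
      refine integral_congr_ae ?_
      filter_upwards [Lp.coeFn_zero (EuclideanSpace ℝ (Fin n)) 2 (volume.restrict Ω)] with x hx
      rw [hx, Pi.zero_apply, inner_zero_left, zero_mul]
    refine h1.trans (Eq.trans ?_ (congrArg Neg.neg h2).symm)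
    simp
  add_mem' := by
    intro a b ha hb φ hφ hc hs v
    have h1 : ∫ x in Ω, (a + b).fst x * fderiv ℝ φ x v
        = ∫ x in Ω, (a.fst x * fderiv ℝ φ x v + b.fst x * fderiv ℝ φ x v) := by
      refine integral_congr_ae ?_
      filter_upwards [Lp.coeFn_add a.fst b.fst] with x hx
      rw [WithLp.add_fst, hx, Pi.add_apply, add_mul]
    have h2 : ∫ x in Ω, ⟪(a + b).snd x, v⟫_ℝ * φ x
        = ∫ x in Ω, (⟪a.snd x, v⟫_ℝ * φ x + ⟪b.snd x, v⟫_ℝ * φ x) := by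
      refine integral_congr_ae ?_
      filter_upwards [Lp.coeFn_add a.snd b.snd] with x hx
      rw [WithLp.add_snd, hx, Pi.add_apply, inner_add_left, add_mul]
    rw [h1, h2, integral_add (integrable_mul_fderiv_test (Lp.memLp a.fst) hφ hc v)
      (integrable_mul_fderiv_test (Lp.memLp b.fst) hφ hc v),
      integral_add (integrable_mul_test ((Lp.memLp a.snd).inner_const v) hφ.continuous hc)
      (integrable_mul_test ((Lp.memLp b.snd).inner_const v) hφ.continuous hc),
      ha φ hφ hc hs v, hb φ hφ hc hs v]
    ring
  smul_mem' := by
    intro c a ha φ hφ hc hs v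
    have h1 : ∫ x in Ω, (c • a).fst x * fderiv ℝ φ x v
        = ∫ x in Ω, c * (a.fst x * fderiv ℝ φ x v) := by
      refine integral_congr_ae ?_
      filter_upwards [Lp.coeFn_smul c a.fst] with x hx
      rw [WithLp.smul_fst, hx, Pi.smul_apply, smul_eq_mul, mul_assoc]
    have h2 : ∫ x in Ω, ⟪(c • a).snd x, v⟫_ℝ * φ x
        = ∫ x in Ω, c * (⟪a.snd x, v⟫_ℝ * φ x) := by
      refine integral_congr_ae ?_
      filter_upwards [Lp.coeFn_smul c a.snd] with x hx
      rw [WithLp.smul_snd, hx, Pi.smul_apply, real_inner_smul_left, mul_assoc]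
    rw [h1, h2, integral_const_mul, integral_const_mul, ha φ hφ hc hs v]
    ring

/-- The function `v ∈ L²(Ω)` underlying an element of `H¹(Ω)`. -/
def h1Fun {n : ℕ} {Ω : Set (EuclideanSpace ℝ (Fin n))} (v : H1 Ω) :
    Lp ℝ 2 (volume.restrict Ω) :=
  (v : WithLp 2 (Lp ℝ 2 (volume.restrict Ω) ×
      Lp (EuclideanSpace ℝ (Fin n)) 2 (volume.restrict Ω))).fst

/-- The weak gradient `∇v ∈ L²(Ω)ⁿ` of an element of `H¹(Ω)`. -/
def h1Grad {n : ℕ} {Ω : Set (EuclideanSpace ℝ (Fin n))} (v : H1 Ω) :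
    Lp (EuclideanSpace ℝ (Fin n)) 2 (volume.restrict Ω) :=
  (v : WithLp 2 (Lp ℝ 2 (volume.restrict Ω) ×
      Lp (EuclideanSpace ℝ (Fin n)) 2 (volume.restrict Ω))).snd

/-- The pairs `(φ|_Ω, φ|_∂Ω)` with `φ` smooth on `ℝⁿ`, inside `H¹(Ω) × L²(∂Ω)`. -/
def smoothTraceGraph {n : ℕ} (Ω : Set (EuclideanSpace ℝ (Fin n))) :
    Submodule ℝ (H1 Ω × Lp ℝ 2 (surfaceMeasure Ω)) where
  carrier := {p | ∃ φ : EuclideanSpace ℝ (Fin n) → ℝ, ContDiff ℝ ∞ φ ∧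
    (∀ᵐ x ∂(volume.restrict Ω), h1Fun p.1 x = φ x) ∧
    (∀ᵐ x ∂(volume.restrict Ω), h1Grad p.1 x = ∇ φ x) ∧
    ∀ᵐ x ∂(surfaceMeasure Ω), p.2 x = φ x}
  zero_mem' := by
    refine ⟨fun _ => 0, contDiff_const, Lp.coeFn_zero ℝ 2 _, ?_, Lp.coeFn_zero ℝ 2 _⟩
    filter_upwards [Lp.coeFn_zero (EuclideanSpace ℝ (Fin n)) 2 (volume.restrict Ω)] with x hx
    rw [gradient_fun_const]
    exact hx
  add_mem' := by
    rintro a b ⟨φ, hφ, h1, h2, h3⟩ ⟨ψ, hψ, k1, k2, k3⟩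
    refine ⟨fun x => φ x + ψ x, hφ.add hψ, ?_, ?_, ?_⟩
    · filter_upwards [Lp.coeFn_add (h1Fun a.1) (h1Fun b.1), h1, k1] with x hx e1 e2
      exact hx.trans (congrArg₂ (· + ·) e1 e2)
    · filter_upwards [Lp.coeFn_add (h1Grad a.1) (h1Grad b.1), h2, k2] with x hx e1 e2
      refine hx.trans ((congrArg₂ (· + ·) e1 e2).trans ?_)
      simp only [gradient]
      rw [fderiv_fun_add (hφ.differentiable (by simp) x) (hψ.differentiable (by simp) x), map_add]
    · filter_upwards [Lp.coeFn_add a.2 b.2, h3, k3] with x hx e1 e2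
      exact hx.trans (congrArg₂ (· + ·) e1 e2)
  smul_mem' := by
    rintro c a ⟨φ, hφ, h1, h2, h3⟩
    refine ⟨fun x => c • φ x, hφ.const_smul c, ?_, ?_, ?_⟩
    · filter_upwards [Lp.coeFn_smul c (h1Fun a.1), h1] with x hx e1
      exact hx.trans (congrArg (c • ·) e1)
    · filter_upwards [Lp.coeFn_smul c (h1Grad a.1), h2] with x hx e1
      refine hx.trans ((congrArg (c • ·) e1).trans ?_)
      simp only [gradient]
      rw [fderiv_fun_const_smul (hφ.differentiable (by simp) x)]
      simp
    · filter_upwards [Lp.coeFn_smul c a.2, h3] with x hx e1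
      exact hx.trans (congrArg (c • ·) e1)

/-- The graph of the trace operator `H¹(Ω) → L²(∂Ω)`: the closure of the graph of the restriction
map `φ|_Ω ↦ φ|_∂Ω` on smooth functions. -/
def traceGraph {n : ℕ} (Ω : Set (EuclideanSpace ℝ (Fin n))) :
    Submodule ℝ (H1 Ω × Lp ℝ 2 (surfaceMeasure Ω)) :=
  (smoothTraceGraph Ω).topologicalClosure

open Classical in
/-- The trace of `v ∈ H¹(Ω)` on `∂Ω`: the `g ∈ L²(∂Ω)` for which `(v, g)` lies in the trace graph.
(For bounded Lipschitz `Ω` there is exactly one; the default value `0` is not used.) -/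
def trace {n : ℕ} {Ω : Set (EuclideanSpace ℝ (Fin n))} (v : H1 Ω) : Lp ℝ 2 (surfaceMeasure Ω) :=
  if h : ∃ g, (v, g) ∈ traceGraph Ω then h.choose else 0

/-- `ℝ^M_⋄`, the vectors of `ℝ^M` (with the Euclidean inner product) whose entries sum to zero. -/
def RDiamond (M : ℕ) : Submodule ℝ (EuclideanSpace ℝ (Fin M)) where
  carrier := {V | ∑ m, V m = 0}
  zero_mem' := by simp
  add_mem' := by
    intro a b ha hb
    change ∑ m, (a m + b m) = 0
    rw [Finset.sum_add_distrib, show ∑ m, a m = 0 from ha, show ∑ m, b m = 0 from hb, add_zero]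
  smul_mem' := by
    intro c a ha
    change ∑ m, c * a m = 0
    rw [← Finset.mul_sum, show ∑ m, a m = 0 from ha, mul_zero]

/-- `ℍ¹ = H¹(Ω) ⊕ ℝ^M_⋄`, with inner product `∫_Ω (∇v · ∇w + v w) dx + V · W`. -/
abbrev HH {n : ℕ} (Ω : Set (EuclideanSpace ℝ (Fin n))) (M : ℕ) : Type :=
  WithLp 2 (H1 Ω × RDiamond M)

/-- The voltage `V_m` of `(v, V) ∈ ℍ¹`. -/
def volt {n M : ℕ} {Ω : Set (EuclideanSpace ℝ (Fin n))} (V : HH Ω M) (m : Fin M) : ℝ :=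
  (V.snd : EuclideanSpace ℝ (Fin M)) m

/-- The bilinear form
`B(V, W) = ∫_Ω σ∇v · ∇w dx + ∑ₘ zₘ⁻¹ ∫_{Eₘ} (v - Vₘ)(w - Wₘ) dS`. -/
def cemForm {n M : ℕ} {Ω : Set (EuclideanSpace ℝ (Fin n))}
    (E : Fin M → Set (EuclideanSpace ℝ (Fin n)))
    (σ : EuclideanSpace ℝ (Fin n) → Matrix (Fin n) (Fin n) ℝ) (z : Fin M → ℝ)
    (V W : HH Ω M) : ℝ :=
  (∫ x in Ω, (σ x *ᵥ (h1Grad V.fst x).ofLp) ⬝ᵥ (h1Grad W.fst x).ofLp) +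
    ∑ m, 1 / z m * ∫ x in E m,
      (trace V.fst x - volt V m) * (trace W.fst x - volt W m) ∂(surfaceMeasure Ω)

/-- `ℍ¹₀`: those `(w, W) ∈ ℍ¹` whose trace equals `W_m` almost everywhere on `E_m`, for every `m`.
-/
def HH0 {n M : ℕ} (Ω : Set (EuclideanSpace ℝ (Fin n)))
    (E : Fin M → Set (EuclideanSpace ℝ (Fin n))) : Submodule ℝ (HH Ω M) where
  carrier := {W | ∃ g, (W.fst, g) ∈ traceGraph Ω ∧
    ∀ m, ∀ᵐ x ∂((surfaceMeasure Ω).restrict (E m)), g x = volt W m}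
  zero_mem' := by
    refine ⟨0, ?_, fun m => ?_⟩
    · rw [WithLp.zero_fst]
      exact (traceGraph Ω).zero_mem
    · filter_upwards [ae_restrict_of_ae (Lp.coeFn_zero ℝ 2 (surfaceMeasure Ω))] with x hx
      rw [hx, volt, WithLp.zero_snd]
      rfl
  add_mem' := by
    rintro a b ⟨g, hg, hg'⟩ ⟨k, hk, hk'⟩
    refine ⟨g + k, ?_, fun m => ?_⟩
    · have h := (traceGraph Ω).add_mem hg hk
      exact h
    · filter_upwards [ae_restrict_of_ae (Lp.coeFn_add g k), hg' m, hk' m] with x hx h1 h2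
      rw [hx, Pi.add_apply, h1, h2, volt, volt, volt, WithLp.add_snd]
      rfl
  smul_mem' := by
    rintro c a ⟨g, hg, hg'⟩
    refine ⟨c • g, ?_, fun m => ?_⟩
    · have h := (traceGraph Ω).smul_mem c hg
      exact h
    · filter_upwards [ae_restrict_of_ae (Lp.coeFn_smul c g), hg' m] with x hx h1
      rw [hx, Pi.smul_apply, h1, volt, volt, WithLp.smul_snd]
      rfl

/-- `U ∈ S` solves `B(U, W) = φ(W)` for all `W ∈ S`. -/
def IsGalerkinSolution {n M : ℕ} {Ω : Set (EuclideanSpace ℝ (Fin n))}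
    (E : Fin M → Set (EuclideanSpace ℝ (Fin n)))
    (σ : EuclideanSpace ℝ (Fin n) → Matrix (Fin n) (Fin n) ℝ) (z : Fin M → ℝ)
    (S : Submodule ℝ (HH Ω M)) (φ : S →ₗ[ℝ] ℝ) (U : S) : Prop :=
  ∀ W : S, cemForm E σ z (U : HH Ω M) (W : HH Ω M) = φ W

/-- For all `z ∈ (0,∞)^M` the problem on `V` has exactly one solution `U(z)`; the problem on
`V₀ = V ∩ ℍ¹₀` has exactly one solution `U₀`, the same for all `z ∈ (0,∞)^M`; and `U(z) → U₀` in
the norm of `ℍ¹` as `z → 0` in `(0,∞)^M`. -/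
def GalerkinConvergence {n M : ℕ} {Ω : Set (EuclideanSpace ℝ (Fin n))}
    (E : Fin M → Set (EuclideanSpace ℝ (Fin n)))
    (σ : EuclideanSpace ℝ (Fin n) → Matrix (Fin n) (Fin n) ℝ)
    (V : Submodule ℝ (HH Ω M)) (φ : V →ₗ[ℝ] ℝ) : Prop :=
  ∃ (U : (Fin M → ℝ) → V) (U₀ : ↥(V ⊓ HH0 Ω E)),
    (∀ z : Fin M → ℝ, (∀ m, 0 < z m) →
      ∀ X : V, IsGalerkinSolution E σ z V φ X ↔ X = U z) ∧
    (∀ z : Fin M → ℝ, (∀ m, 0 < z m) →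
      ∀ X : ↥(V ⊓ HH0 Ω E), IsGalerkinSolution E σ z (V ⊓ HH0 Ω E)
        (φ ∘ₗ Submodule.inclusion inf_le_left) X ↔ X = U₀) ∧
    Tendsto (fun z => (U z : HH Ω M)) (𝓝[{z : Fin M → ℝ | ∀ m, 0 < z m}] 0) (𝓝 (U₀ : HH Ω M))

/-- The functional `φ_I(W) = I · W` on `ℍ¹`. -/
def currentFunctional {n M : ℕ} (Ω : Set (EuclideanSpace ℝ (Fin n))) (I : RDiamond M) :
    HH Ω M →ₗ[ℝ] ℝ where
  toFun W := ∑ m, (I : EuclideanSpace ℝ (Fin M)) m * volt W m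
  map_add' := by
    intro a b
    rw [← Finset.sum_add_distrib]
    exact Finset.sum_congr rfl fun m _ => mul_add _ _ _
  map_smul' := by
    intro c a
    rw [RingHom.id_apply, smul_eq_mul, Finset.mul_sum]
    exact Finset.sum_congr rfl fun m _ => mul_left_comm _ _ _

/-- The space `P ⊕ ℝ^M_⋄ ⊆ ℍ¹`, for a subspace `P ⊆ H¹(Ω)`. -/
def spatialSum {n : ℕ} {Ω : Set (EuclideanSpace ℝ (Fin n))} (P : Submodule ℝ (H1 Ω)) (M : ℕ) :
    Submodule ℝ (HH Ω M) :=
  P.comap (WithLp.fstₗ 2 ℝ (H1 Ω) (RDiamond M))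

end CEM

end

/-!
The electrode terms of the form `B_z` are a penalty for the constraints that define `ℍ¹₀`. Write
`a` for the gradient form `∫_Ω σ∇v · ∇w` and `J_m (v, V) = (v - V_m)|_{E_m} ∈ L²(E_m)` for the
electrode residuals. Then `B_z = a + ∑ z_m⁻¹ ⟪J_m ·, J_m ·⟫`, and `ℍ¹₀` is the common kernel of the
`J_m`. If `B_{(1, …, 1)}` is coercive, every problem in the statement is solvable by Lax–Milgram,
and the limit is an abstract fact about Hilbert spaces (`CEM.penalty_limit`): the error `d = U(z) -
U₀` satisfies `c ‖d‖² ≤ ψ d` for a fixed functional `ψ` that vanishes on the kernel of the `J_m`;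
hence `d` stays bounded, the penalty forces `J_m d → 0`, and `ψ` is a norm limit of functionals
factoring through the `J_m`, so that `ψ d → 0`.

What remains is the analysis on the Lipschitz domain.

* Flowing the boundary along the chart direction compares surface measure times length with volume
  (`CEM.IsBoundaryChart.flow`). The fundamental theorem of calculus on these segments gives the
  trace inequality for smooth functions (`CEM.exists_trace_bound`), and conversely controls a small
  ball inside `Ω` by boundary values on a patch.
* From such a ball, translations inside the connected set `Ω`, and along cones near `∂Ω`, carry the
  estimate to all of `Ω`. This is the Poincaré inequality with an electrode term
  (`CEM.exists_poincare`); it needs no compact embedding. Applied to a constant, it also shows that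
  electrodes have positive measure.
* Smooth functions on `ℝⁿ` are dense in `H¹(Ω)` (`CEM.exists_smooth_approx`): mollify with kernels
  whose support is shifted into the cone, then glue with a partition of unity. No extension
  operator is needed. By density and the trace inequality the closed trace graph is the graph of a
  bounded operator (`CEM.exists_traceOp`), and the Poincaré inequality extends to `H¹(Ω)`.
* The Poincaré inequality on one electrode, together with `∑ V_m = 0`, controls the voltages and
  hence the whole norm of `ℍ¹` (`CEM.exists_coercive_of_poincare`).
-/

noncomputable section

namespace CEM

open Metric Set
open scoped ENNReal NNReal

variable {n M : ℕ} {Ω : Set (EuclideanSpace ℝ (Fin n))}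

/-! ### Lipschitz charts of the boundary -/

/-- A Lipschitz boundary chart at `p`, recorded through the height `h` above the boundary in the
direction of the unit vector `e`: near `p`, the set `Ω` is `{h > 0}` and `∂Ω` is `{h = 0}`. -/
structure IsBoundaryChart (Ω : Set (EuclideanSpace ℝ (Fin n))) (p e : EuclideanSpace ℝ (Fin n))
    (L : ℝ≥0) (h : EuclideanSpace ℝ (Fin n) → ℝ) (ρ : ℝ) : Prop where
  norm_eq : ‖e‖ = 1
  lipschitz : LipschitzWith L h
  height_add : ∀ y t, h (y + t • e) = h y + t
  radius_pos : 0 < ρ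
  mem_iff : ∀ y ∈ ball p ρ, y ∈ Ω ↔ 0 < h y
  frontier_iff : ∀ y ∈ ball p ρ, y ∈ frontier Ω ↔ h y = 0

/-- The height is `h y = ⟪e, y⟫ - γ (y - ⟪e, y⟫ e)`, with `γ` the local graph function. -/
theorem HasLipschitzBoundary.exists_chart (hΩ : HasLipschitzBoundary Ω) (ho : IsOpen Ω)
    {p : EuclideanSpace ℝ (Fin n)} (hp : p ∈ frontier Ω) :
    ∃ e L h ρ, IsBoundaryChart Ω p e L h ρ := by
  obtain ⟨e, he, K, γ, hγ, hev⟩ := hΩ p hp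
  obtain ⟨ρ, hρ, hball⟩ := Metric.eventually_nhds_iff_ball.1 hev
  set h : EuclideanSpace ℝ (Fin n) → ℝ := fun y => ⟪e, y⟫_ℝ - γ (y - ⟪e, y⟫_ℝ • e) with hh
  have hee : ⟪e, e⟫_ℝ = 1 := by rw [real_inner_self_eq_norm_sq, he]; norm_num
  have hadd : ∀ y t, h (y + t • e) = h y + t := by
    intro y t
    have h1 : ⟪e, y + t • e⟫_ℝ = ⟪e, y⟫_ℝ + t := by
      rw [inner_add_right, real_inner_smul_right, hee, mul_one]
    have h2 : y + t • e - (⟪e, y⟫_ℝ + t) • e = y - ⟪e, y⟫_ℝ • e := by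
      rw [add_smul]; abel
    simp only [hh, h1, h2]
    ring
  have hi : LipschitzWith 1 fun y : EuclideanSpace ℝ (Fin n) => ⟪e, y⟫_ℝ := by
    refine LipschitzWith.of_dist_le_mul fun x y => ?_
    rw [Real.dist_eq, ← inner_sub_right, dist_eq_norm]
    simpa [he] using abs_real_inner_le_norm e (x - y)
  have hs : LipschitzWith 1 fun t : ℝ => t • e := by
    refine LipschitzWith.of_dist_le_mul fun x y => ?_
    rw [dist_eq_norm, ← sub_smul, norm_smul, he, mul_one, Real.dist_eq, NNReal.coe_one, one_mul,
      Real.norm_eq_abs]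
  have hL : LipschitzWith (1 + K * (1 + 1 * 1)) h :=
    hi.sub (hγ.comp (LipschitzWith.id.sub (hs.comp hi)))
  have hmem : ∀ y ∈ ball p ρ, y ∈ Ω ↔ 0 < h y := fun y hy => by
    rw [hball y hy, hh]; simp only [sub_pos]
  refine ⟨e, _, h, ρ, he, hL, hadd, hρ, hmem, fun y hy => ?_⟩
  rw [ho.frontier_eq]
  constructor
  · rintro ⟨hc, hn⟩
    rw [hmem y hy, not_lt] at hn
    by_contra hne
    have hlt : h y < 0 := lt_of_le_of_ne hn hne
    have hnb : {x | h x < 0} ∩ ball p ρ ∈ 𝓝 y :=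
      inter_mem ((isOpen_lt hL.continuous continuous_const).mem_nhds hlt)
        (isOpen_ball.mem_nhds hy)
    obtain ⟨x, ⟨hx1, hx2⟩, hx3⟩ := mem_closure_iff_nhds.1 hc _ hnb
    exact absurd ((hmem x hx2).1 hx3) (not_lt.2 (le_of_lt hx1))
  · intro h0
    refine ⟨?_, fun hy' => by rw [hmem y hy, h0] at hy'; exact lt_irrefl _ hy'⟩
    have ht : Tendsto (fun t : ℝ => y + t • e) (𝓝[>] 0) (𝓝 y) := by
      have : Tendsto (fun t : ℝ => y + t • e) (𝓝 0) (𝓝 (y + (0 : ℝ) • e)) :=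
        (Continuous.tendsto (by fun_prop) _)
      rw [zero_smul, add_zero] at this
      exact this.mono_left nhdsWithin_le_nhds
    refine mem_closure_of_tendsto ht ?_
    filter_upwards [ht.eventually (isOpen_ball.mem_nhds hy), self_mem_nhdsWithin] with t h1 h2
    rw [hmem _ h1, hadd, h0, zero_add]
    exact h2

/-- The cone condition: near each point of the closure, `Ω` contains the truncated cones with a
common axis `e` and a common opening. At interior points `e = 0` is allowed. -/
theorem exists_cone (hΩ : HasLipschitzBoundary Ω) (ho : IsOpen Ω)
    {p : EuclideanSpace ℝ (Fin n)} (hp : p ∈ closure Ω) :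
    ∃ (e : EuclideanSpace ℝ (Fin n)) (r δ η : ℝ), 0 < r ∧ 0 < δ ∧ 0 < η ∧
      ∀ x ∈ ball p η ∩ Ω, ∀ t ∈ Ioc 0 δ, closedBall (x + t • e) (t * r) ⊆ Ω := by
  by_cases hpΩ : p ∈ Ω
  · obtain ⟨ε, hε, hb⟩ := Metric.isOpen_iff.1 ho p hpΩ
    refine ⟨0, 1, ε / 2, ε / 2, one_pos, by positivity, by positivity, ?_⟩
    rintro x ⟨hx, -⟩ t ⟨-, ht⟩ y hy
    rw [smul_zero, add_zero, mem_closedBall] at hy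
    rw [mem_ball] at hx
    apply hb
    rw [mem_ball]
    linarith [dist_triangle y x p]
  · have hfr : p ∈ frontier Ω := by rw [ho.frontier_eq]; exact ⟨hp, hpΩ⟩
    obtain ⟨e, L, h, ρ, hc⟩ := hΩ.exists_chart ho hfr
    have hρ := hc.radius_pos
    have hL : (0 : ℝ) ≤ L := L.2
    -- the opening `r` is chosen so that `h` cannot drop to zero inside the cone: `L * r < 1`
    have hr : (0 : ℝ) < 1 / (L + 1) := by positivity
    have hr1 : 1 / ((L : ℝ) + 1) ≤ 1 := by
      rw [div_le_one (by positivity)]; linarith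
    have hLr : (L : ℝ) * (1 / (L + 1)) < 1 := by
      rw [mul_one_div, div_lt_one (by positivity)]; linarith
    refine ⟨e, 1 / (L + 1), ρ / 4, ρ / 4, hr, by positivity, by positivity, ?_⟩
    rintro x ⟨hx, hxΩ⟩ t ⟨ht0, ht⟩ y hy
    rw [mem_closedBall] at hy
    rw [mem_ball] at hx
    have hxb : x ∈ ball p ρ := by rw [mem_ball]; linarith
    have h2 : dist (x + t • e) x = t := by
      rw [dist_eq_norm, add_sub_cancel_left, norm_smul, hc.norm_eq, mul_one, Real.norm_eq_abs,
        abs_of_pos ht0]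
    have h3 : t * (1 / ((L : ℝ) + 1)) ≤ t := mul_le_of_le_one_right ht0.le hr1
    have hyb : y ∈ ball p ρ := by
      rw [mem_ball]
      linarith [dist_triangle y (x + t • e) p, dist_triangle (x + t • e) x p]
    rw [hc.mem_iff y hyb]
    have h4 := hc.lipschitz.dist_le_mul y (x + t • e)
    rw [Real.dist_eq, hc.height_add] at h4
    have h5 := neg_le_of_abs_le h4
    have h6 : (L : ℝ) * dist y (x + t • e) ≤ L * (t * (1 / (L + 1))) :=
      mul_le_mul_of_nonneg_left hy hL
    have h7 : (L : ℝ) * (t * (1 / (L + 1))) = t * (L * (1 / (L + 1))) := by ring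
    have h8 : t * (L * (1 / ((L : ℝ) + 1))) < t * 1 := mul_lt_mul_of_pos_left hLr ht0
    have h9 := (hc.mem_iff x hxb).1 hxΩ
    linarith

/-! ### Surface measure and flow along the chart direction -/

/-- Tonelli's theorem for the splitting of space into the line `ℝ e` and its orthogonal complement.
-/
theorem lintegral_eq_lintegral_lines {e : EuclideanSpace ℝ (Fin n)} (he : ‖e‖ = 1)
    {F : EuclideanSpace ℝ (Fin n) → ℝ≥0∞} (hF : Measurable F) :
    ∫⁻ x, F x = ∫⁻ y : (ℝ ∙ e)ᗮ, ∫⁻ t : ℝ, F ((y : EuclideanSpace ℝ (Fin n)) + t • e) := by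
  have h1 := (ℝ ∙ e).measurePreserving_measurableEquivProd (0 : EuclideanSpace ℝ (Fin n))
  rw [InnerProductSpace.euclideanHausdorffMeasure_eq_volume] at h1
  rw [← h1.symm.lintegral_comp hF, Measure.volume_eq_prod,
    lintegral_prod_symm' (fun a => F (((ℝ ∙ e).measurableEquivProd 0).symm a))
      (hF.comp (MeasurableEquiv.measurable _))]
  refine lintegral_congr fun y => ?_
  have h2 := (LinearIsometryEquiv.toSpanUnitSingleton (𝕜 := ℝ) e he).measurePreserving
  rw [← h2.lintegral_comp]
  · refine lintegral_congr fun t => ?_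
    rw [Submodule.measurableEquivProd_symm_apply, vadd_eq_add, add_zero, add_comm]
    rfl
  · exact hF.comp ((MeasurableEquiv.measurable _).comp measurable_prodMk_right)

theorem finrank_orthogonal_unit {e : EuclideanSpace ℝ (Fin n)} (he : ‖e‖ = 1) :
    Module.finrank ℝ (ℝ ∙ e)ᗮ = n - 1 := by
  have h := (ℝ ∙ e).finrank_add_finrank_orthogonal
  rw [finrank_span_singleton (by rintro rfl; simp at he), finrank_euclideanSpace_fin] at h
  omega

theorem _root_.AntilipschitzWith.euclideanHausdorffMeasure_preimage_le {X Y : Type*}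
    [EMetricSpace X] [EMetricSpace Y] [MeasurableSpace X] [BorelSpace X] [MeasurableSpace Y]
    [BorelSpace Y] {f : X → Y} (hf : AntilipschitzWith 1 f) (d : ℕ) (s : Set Y) :
    μHE[d] (f ⁻¹' s) ≤ μHE[d] s := by
  simp_rw [Measure.euclideanHausdorffMeasure_def, Measure.smul_apply]
  have := hf.hausdorffMeasure_preimage_le (Nat.cast_nonneg d) s
  rw [ENNReal.coe_one, ENNReal.one_rpow, one_mul] at this
  gcongr

theorem _root_.LipschitzWith.euclideanHausdorffMeasure_image_le {X Y : Type*}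
    [EMetricSpace X] [EMetricSpace Y] [MeasurableSpace X] [BorelSpace X] [MeasurableSpace Y]
    [BorelSpace Y] {K : ℝ≥0} {f : X → Y} (hf : LipschitzWith K f) (d : ℕ) (s : Set X) :
    μHE[d] (f '' s) ≤ (K : ℝ≥0∞) ^ d * μHE[d] s := by
  simp_rw [Measure.euclideanHausdorffMeasure_def, Measure.smul_apply]
  have := (hf.lipschitzOnWith (s := s)).hausdorffMeasure_image_le (Nat.cast_nonneg d)
  rw [ENNReal.rpow_natCast] at this
  rw [mul_smul_comm]
  gcongr

/-- Flowing a boundary patch `N ∩ ∂Ω` along the chart direction `e` for times in `(0, t₀)` sweeps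
out a region that stays inside `Ω` and contains a ball, and the product of surface measure and time
on it is comparable with volume. Both comparisons come from the parametrisation of `∂Ω` by the
hyperplane `eᗮ`, which is Lipschitz and whose inverse, the orthogonal projection, is 1-Lipschitz. -/
theorem IsBoundaryChart.flow {p e : EuclideanSpace ℝ (Fin n)} {L : ℝ≥0}
    {h : EuclideanSpace ℝ (Fin n) → ℝ} {ρ : ℝ} (hc : IsBoundaryChart Ω p e L h ρ)
    (ho : IsOpen Ω) (hp : p ∈ frontier Ω) {O : Set (EuclideanSpace ℝ (Fin n))} (hO : O ∈ 𝓝 p) :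
    ∃ (t₀ : ℝ) (N : Set (EuclideanSpace ℝ (Fin n))) (C : ℝ≥0∞) (q : EuclideanSpace ℝ (Fin n))
      (r : ℝ), 0 < t₀ ∧ IsOpen N ∧ p ∈ N ∧ N ⊆ O ∧ C ≠ ⊤ ∧ 0 < r ∧ ball q r ⊆ Ω ∧
      surfaceMeasure Ω N < ⊤ ∧
      (∀ x ∈ frontier Ω ∩ N, ∀ t ∈ Ioo 0 t₀, x + t • e ∈ Ω) ∧
      (∀ F : EuclideanSpace ℝ (Fin n) → ℝ≥0∞, Measurable F →
        ∫⁻ x in N, (∫⁻ t in Ioo 0 t₀, F (x + t • e)) ∂(surfaceMeasure Ω) ≤ C * ∫⁻ x in Ω, F x) ∧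
      (∀ F : EuclideanSpace ℝ (Fin n) → ℝ≥0∞, Measurable F →
        ∫⁻ x in ball q r, F x ≤
          ∫⁻ x in N, (∫⁻ t in Ioo 0 t₀, F (x + t • e)) ∂(surfaceMeasure Ω)) := by
  obtain ⟨η₀, hη₀, hηO⟩ := Metric.mem_nhds_iff.1 hO
  have he := hc.norm_eq
  have hρ := hc.radius_pos
  have hL : (0 : ℝ) ≤ L := L.2
  set η : ℝ := min η₀ (ρ / 2) with hη
  have hηpos : 0 < η := lt_min hη₀ (by positivity)
  have hη1 : η ≤ η₀ := min_le_left _ _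
  have hη2 : η ≤ ρ / 2 := min_le_right _ _
  set N : Set (EuclideanSpace ℝ (Fin n)) := ball p η with hN
  set S : Set (EuclideanSpace ℝ (Fin n)) := frontier Ω ∩ N with hS
  have hSm : MeasurableSet S := isClosed_frontier.measurableSet.inter measurableSet_ball
  have hNS : (surfaceMeasure Ω).restrict N = (μHE[n - 1]).restrict S := by
    rw [surfaceMeasure, Measure.restrict_restrict measurableSet_ball, inter_comm]
  -- the parametrisation of the boundary by the hyperplane orthogonal to `e`
  set G : (ℝ ∙ e)ᗮ → EuclideanSpace ℝ (Fin n) := fun y =>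
    (y : EuclideanSpace ℝ (Fin n)) + (-h y) • e with hG
  have hhG : ∀ y, h (G y) = 0 := fun y => by rw [hG]; simp only [hc.height_add]; ring
  have hs : LipschitzWith 1 fun t : ℝ => t • e := by
    refine LipschitzWith.of_dist_le_mul fun x y => ?_
    rw [dist_eq_norm, ← sub_smul, norm_smul, he, mul_one, Real.dist_eq, NNReal.coe_one, one_mul,
      Real.norm_eq_abs]
  have hsub : LipschitzWith 1 ((↑) : (ℝ ∙ e)ᗮ → EuclideanSpace ℝ (Fin n)) :=
    LipschitzWith.subtype_val _
  have hGl : LipschitzWith (1 + 1 * (L * 1)) G :=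
    hsub.add (hs.comp (hc.lipschitz.comp hsub).neg)
  have hGa : AntilipschitzWith 1 G := by
    refine AntilipschitzWith.of_le_mul_dist fun y z => ?_
    rw [NNReal.coe_one, one_mul, dist_eq_norm, dist_eq_norm]
    set c : ℝ := -h y - -h z
    have h1 : G y - G z = ((y - z : (ℝ ∙ e)ᗮ) : EuclideanSpace ℝ (Fin n)) + c • e := by
      simp only [hG, c, sub_smul, Submodule.coe_sub]; abel
    have h2 : ⟪((y - z : (ℝ ∙ e)ᗮ) : EuclideanSpace ℝ (Fin n)), c • e⟫_ℝ = 0 := by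
      rw [real_inner_smul_right, real_inner_comm,
        Submodule.mem_orthogonal_singleton_iff_inner_right.1 (y - z).2, mul_zero]
    rw [h1]
    have h3 := norm_add_sq_eq_norm_sq_add_norm_sq_of_inner_eq_zero _ _ h2
    change ‖((y - z : (ℝ ∙ e)ᗮ) : EuclideanSpace ℝ (Fin n))‖ ≤ _
    nlinarith [norm_nonneg (((y - z : (ℝ ∙ e)ᗮ) : EuclideanSpace ℝ (Fin n)) + c • e),
      norm_nonneg ((y - z : (ℝ ∙ e)ᗮ) : EuclideanSpace ℝ (Fin n)), mul_self_nonneg ‖c • e‖]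
  have hGm : Measurable G := hGl.continuous.measurable
  have hGS : MeasurableSet (G ⁻¹' S) := hGm hSm
  have hSG : ∀ x ∈ S, x ∈ range G := by
    rintro x ⟨hxf, hxN⟩
    have hxb : x ∈ ball p ρ := by
      rw [hN, mem_ball] at hxN; rw [mem_ball]; linarith
    have h0 := (hc.frontier_iff x hxb).1 hxf
    refine ⟨⟨x + (-⟪e, x⟫_ℝ) • e, ?_⟩, ?_⟩
    · rw [Submodule.mem_orthogonal_singleton_iff_inner_right, inner_add_right,
        real_inner_smul_right, real_inner_self_eq_norm_sq, he]
      ring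
    · simp only [hG, hc.height_add, h0]
      rw [add_assoc, ← add_smul]
      simp
  have hvol : (volume : Measure (ℝ ∙ e)ᗮ) = μHE[n - 1] := by
    rw [← InnerProductSpace.euclideanHausdorffMeasure_eq_volume, finrank_orthogonal_unit he]
  set C : ℝ≥0∞ := ((1 + 1 * (L * 1) : ℝ≥0) : ℝ≥0∞) ^ (n - 1) with hC
  have hCtop : C ≠ ⊤ := ENNReal.pow_ne_top ENNReal.coe_ne_top
  have hup : (μHE[n - 1]).restrict S ≤ C • ((volume.restrict (G ⁻¹' S)).map G) := by
    refine Measure.le_iff.2 fun A hA => ?_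
    rw [Measure.restrict_apply hA, Measure.smul_apply, Measure.map_apply hGm hA,
      Measure.restrict_apply (hGm hA), ← preimage_inter, smul_eq_mul, hvol]
    have h1 : A ∩ S = G '' (G ⁻¹' (A ∩ S)) := by
      rw [image_preimage_eq_inter_range]
      exact (inter_eq_left.2 fun x hx => hSG x hx.2).symm
    conv_lhs => rw [h1]
    exact hGl.euclideanHausdorffMeasure_image_le _ _
  have hlow : (volume.restrict (G ⁻¹' S)).map G ≤ (μHE[n - 1]).restrict S := by
    refine Measure.le_iff.2 fun A hA => ?_
    rw [Measure.restrict_apply hA, Measure.map_apply hGm hA,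
      Measure.restrict_apply (hGm hA), ← preimage_inter, hvol]
    exact hGa.euclideanHausdorffMeasure_preimage_le _ _
  have hfin : (μHE[n - 1]) S < ⊤ := by
    have h1 := hup univ
    rw [Measure.restrict_apply_univ, Measure.smul_apply, Measure.map_apply hGm MeasurableSet.univ,
      preimage_univ, Measure.restrict_apply_univ, smul_eq_mul] at h1
    refine h1.trans_lt (ENNReal.mul_lt_top hCtop.lt_top ?_)
    exact (hGa.isBounded_preimage (isBounded_ball.subset inter_subset_right)).measure_lt_top
  have hsurf : surfaceMeasure Ω N < ⊤ := by
    rw [← Measure.restrict_apply_univ, hNS, Measure.restrict_apply_univ]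
    exact hfin
  set t₀ : ℝ := ρ / 2 with ht₀
  have ht₀pos : 0 < t₀ := by positivity
  have hmeas : ∀ F : EuclideanSpace ℝ (Fin n) → ℝ≥0∞, Measurable F →
      Measurable fun x => ∫⁻ t in Ioo 0 t₀, F (x + t • e) := fun F hF =>
    Measurable.lintegral_prod_right'
      (f := fun z : EuclideanSpace ℝ (Fin n) × ℝ => F (z.1 + z.2 • e))
      (hF.comp (Continuous.measurable (by fun_prop)))
  have hin : ∀ x ∈ S, ∀ t ∈ Ioo 0 t₀, x + t • e ∈ Ω := by
    rintro x ⟨hxf, hxN⟩ t ⟨ht, ht'⟩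
    rw [hN, mem_ball] at hxN
    have hxb : x ∈ ball p ρ := by rw [mem_ball]; linarith
    have h2 : dist (x + t • e) x = t := by
      rw [dist_eq_norm, add_sub_cancel_left, norm_smul, he, mul_one, Real.norm_eq_abs,
        abs_of_pos ht]
    have hxb' : x + t • e ∈ ball p ρ := by
      rw [mem_ball]; linarith [dist_triangle (x + t • e) x p]
    rw [hc.mem_iff _ hxb', hc.height_add, (hc.frontier_iff x hxb).1 hxf, zero_add]
    exact ht
  -- the ball around `p + τ • e` consists of points `x + t • e` with `x ∈ S` and `0 < t < t₀`
  set τ : ℝ := min t₀ η / 4 with hτ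
  have hτpos : 0 < τ := by have := lt_min ht₀pos hηpos; positivity
  have hτ1 : 4 * τ ≤ t₀ := by rw [hτ]; linarith [min_le_left t₀ η]
  have hτ2 : 4 * τ ≤ η := by rw [hτ]; linarith [min_le_right t₀ η]
  set r : ℝ := τ / (1 + L) with hr
  have hrpos : 0 < r := by positivity
  have hLr : (L : ℝ) * r + r = τ := by rw [hr]; field_simp; ring
  have hball : ∀ y : (ℝ ∙ e)ᗮ, ∀ t : ℝ, G y + t • e ∈ ball (p + τ • e) r →
      G y ∈ S ∧ t ∈ Ioo 0 t₀ := by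
    intro y t hy
    have hpb : p ∈ ball p ρ := mem_ball_self hρ
    have h1 : h (G y + t • e) = t := by rw [hc.height_add, hhG, zero_add]
    have h2 : h (p + τ • e) = τ := by
      rw [hc.height_add, (hc.frontier_iff p hpb).1 hp, zero_add]
    have h3 := hc.lipschitz.dist_le_mul (G y + t • e) (p + τ • e)
    rw [h1, h2, Real.dist_eq] at h3
    rw [mem_ball] at hy
    have h4 : (L : ℝ) * dist (G y + t • e) (p + τ • e) ≤ L * r :=
      mul_le_mul_of_nonneg_left hy.le hL
    have h5 := abs_le.1 (h3.trans h4)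
    have h6 : dist (G y) p ≤ dist (G y + t • e) (p + τ • e) + |t - τ| := by
      rw [dist_eq_norm, dist_eq_norm]
      have : G y - p = (G y + t • e - (p + τ • e)) - (t - τ) • e := by
        rw [sub_smul]; abel
      rw [this]
      refine (norm_sub_le _ _).trans ?_
      rw [norm_smul, he, mul_one, Real.norm_eq_abs]
    have hGN : G y ∈ ball p η := by rw [mem_ball]; linarith [h3.trans h4]
    refine ⟨⟨?_, hGN⟩, by linarith [h5.1], by linarith [h5.2]⟩
    rw [hc.frontier_iff _ (by rw [mem_ball] at hGN ⊢; linarith)]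
    exact hhG y
  have hline : ∀ F : EuclideanSpace ℝ (Fin n) → ℝ≥0∞, Measurable F →
      ∫⁻ x, F x = ∫⁻ y, ∫⁻ t : ℝ, F (G y + t • e) := by
    intro F hF
    rw [lintegral_eq_lintegral_lines he hF]
    refine lintegral_congr fun y => ?_
    rw [← lintegral_add_left_eq_self _ (-h y)]
    refine lintegral_congr fun t => ?_
    rw [hG, add_smul, ← add_assoc]
  have hpar : ∀ F : EuclideanSpace ℝ (Fin n) → ℝ≥0∞,
      ∫⁻ y in G ⁻¹' S, ∫⁻ t in Ioo 0 t₀, F (G y + t • e) =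
        ∫⁻ y, ∫⁻ t : ℝ, (G ⁻¹' S).indicator 1 y * (Ioo 0 t₀).indicator 1 t * F (G y + t • e) := by
    intro F
    rw [← lintegral_indicator hGS]
    refine lintegral_congr fun y => ?_
    by_cases hy : y ∈ G ⁻¹' S
    · rw [indicator_of_mem hy, ← lintegral_indicator measurableSet_Ioo]
      refine lintegral_congr fun t => ?_
      by_cases ht : t ∈ Ioo 0 t₀
      · simp [indicator_of_mem hy, ht]
      · simp [indicator_of_notMem ht]
    · simp [indicator_of_notMem hy]
  refine ⟨t₀, N, C, p + τ • e, r, ht₀pos, isOpen_ball, mem_ball_self hηpos,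
    (ball_subset_ball hη1).trans hηO, hCtop, hrpos, ?_, hsurf, hin, fun F hF => ?_, fun F hF => ?_⟩
  · intro y hy
    have hyρ : y ∈ ball p ρ := by
      rw [mem_ball] at hy ⊢
      have : dist (p + τ • e) p = τ := by
        rw [dist_eq_norm, add_sub_cancel_left, norm_smul, he, mul_one, Real.norm_eq_abs,
          abs_of_pos hτpos]
      nlinarith [dist_triangle y (p + τ • e) p, mul_nonneg hL hrpos.le]
    rw [hc.mem_iff y hyρ]
    have h2 : h (p + τ • e) = τ := by
      rw [hc.height_add, (hc.frontier_iff p (mem_ball_self hρ)).1 hp, zero_add]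
    have h3 := hc.lipschitz.dist_le_mul y (p + τ • e)
    rw [h2, Real.dist_eq] at h3
    rw [mem_ball] at hy
    have h4 : (L : ℝ) * dist y (p + τ • e) ≤ L * r := mul_le_mul_of_nonneg_left hy.le hL
    linarith [(abs_le.1 (h3.trans h4)).1]
  · rw [hNS]
    calc ∫⁻ x in S, (∫⁻ t in Ioo 0 t₀, F (x + t • e)) ∂μHE[n - 1]
        ≤ ∫⁻ x, (∫⁻ t in Ioo 0 t₀, F (x + t • e)) ∂(C • ((volume.restrict (G ⁻¹' S)).map G)) :=
          lintegral_mono' hup le_rfl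
      _ = C * ∫⁻ y in G ⁻¹' S, ∫⁻ t in Ioo 0 t₀, F (G y + t • e) := by
          rw [lintegral_smul_measure, lintegral_map (hmeas F hF) hGm, smul_eq_mul]
      _ ≤ C * ∫⁻ x in Ω, F x := by
          gcongr
          rw [hpar, ← lintegral_indicator ho.measurableSet,
            hline _ (hF.indicator ho.measurableSet)]
          refine lintegral_mono fun y => lintegral_mono fun t => ?_
          by_cases hy : y ∈ G ⁻¹' S
          · by_cases ht : t ∈ Ioo 0 t₀
            · simp [indicator_of_mem hy, indicator_of_mem ht, indicator_of_mem (hin (G y) hy t ht)]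
            · simp [indicator_of_notMem ht]
          · simp [indicator_of_notMem hy]
  · rw [hNS]
    calc ∫⁻ x in ball (p + τ • e) r, F x
        = ∫⁻ y, ∫⁻ t : ℝ, (ball (p + τ • e) r).indicator F (G y + t • e) := by
          rw [← lintegral_indicator measurableSet_ball, hline _ (hF.indicator measurableSet_ball)]
      _ ≤ ∫⁻ y in G ⁻¹' S, ∫⁻ t in Ioo 0 t₀, F (G y + t • e) := by
          rw [hpar]
          refine lintegral_mono fun y => lintegral_mono fun t => ?_
          by_cases hb : G y + t • e ∈ ball (p + τ • e) r
          · obtain ⟨h1, h2⟩ := hball y t hb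
            have h1' : y ∈ G ⁻¹' S := h1
            simp [indicator_of_mem hb, indicator_of_mem h1', indicator_of_mem h2]
          · simp [indicator_of_notMem hb]
      _ = ∫⁻ x, (∫⁻ t in Ioo 0 t₀, F (x + t • e)) ∂((volume.restrict (G ⁻¹' S)).map G) := by
          rw [lintegral_map (hmeas F hF) hGm]
      _ ≤ ∫⁻ x in S, (∫⁻ t in Ioo 0 t₀, F (x + t • e)) ∂μHE[n - 1] :=
          lintegral_mono' hlow le_rfl

/-! ### Trace and Poincaré inequalities for continuously differentiable functions -/

theorem sq_lintegral_le {α : Type*} [MeasurableSpace α] (μ : Measure α) {f : α → ℝ≥0∞}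
    (hf : AEMeasurable f μ) : (∫⁻ x, f x ∂μ) ^ 2 ≤ μ univ * ∫⁻ x, f x ^ 2 ∂μ := by
  have h := ENNReal.lintegral_mul_le_Lp_mul_Lq μ Real.HolderConjugate.two_two
    (f := fun _ => 1) (g := f) aemeasurable_const hf
  simp only [Pi.mul_apply, one_mul, ENNReal.rpow_two, one_pow, lintegral_one] at h
  calc (∫⁻ x, f x ∂μ) ^ 2
      ≤ (μ univ ^ (1 / 2 : ℝ) * (∫⁻ x, f x ^ 2 ∂μ) ^ (1 / 2 : ℝ)) ^ 2 := by gcongr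
    _ = μ univ * ∫⁻ x, f x ^ 2 ∂μ := by
      rw [mul_pow, ← ENNReal.rpow_natCast, ← ENNReal.rpow_natCast, ← ENNReal.rpow_mul,
        ← ENNReal.rpow_mul]
      norm_num

theorem enorm_sq_le_of_sub (a b : ℝ) : ‖a‖ₑ ^ 2 ≤ 2 * ‖b‖ₑ ^ 2 + 2 * ‖a - b‖ₑ ^ 2 := by
  simp only [Real.enorm_eq_ofReal_abs]
  rw [← ENNReal.ofReal_pow (abs_nonneg _), ← ENNReal.ofReal_pow (abs_nonneg _),
    ← ENNReal.ofReal_pow (abs_nonneg _), sq_abs, sq_abs, sq_abs,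
    ← ENNReal.ofReal_ofNat, ← ENNReal.ofReal_mul (by norm_num), ← ENNReal.ofReal_mul (by norm_num),
    ← ENNReal.ofReal_add (by positivity) (by positivity)]
  exact ENNReal.ofReal_le_ofReal (by nlinarith [sq_nonneg (a - 2 * b)])

/-- The fundamental theorem of calculus and the Cauchy–Schwarz inequality along a segment. -/
theorem enorm_sub_sq_le_line {φ : EuclideanSpace ℝ (Fin n) → ℝ} (hφ : ContDiff ℝ 1 φ)
    (x e : EuclideanSpace ℝ (Fin n)) {t : ℝ} (ht : 0 ≤ t) :
    ‖φ (x + t • e) - φ x‖ₑ ^ 2 ≤ ENNReal.ofReal t * ‖e‖ₑ ^ 2 *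
      ∫⁻ s in Ioo 0 t, ‖fderiv ℝ φ (x + s • e)‖ₑ ^ 2 := by
  have hcd : Continuous fun s : ℝ => fderiv ℝ φ (x + s • e) :=
    (hφ.continuous_fderiv one_ne_zero).comp (by fun_prop)
  have hd : ∀ s : ℝ, HasDerivAt (fun s : ℝ => φ (x + s • e)) (fderiv ℝ φ (x + s • e) e) s := by
    intro s
    have h1 : HasDerivAt (fun s : ℝ => x + s • e) e s := by
      simpa using ((hasDerivAt_id s).smul_const e).const_add x
    exact ((hφ.differentiable one_ne_zero (x + s • e)).hasFDerivAt).comp_hasDerivAt s h1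
  have hint := intervalIntegral.integral_eq_sub_of_hasDerivAt (a := 0) (b := t)
    (fun s _ => hd s) ((hcd.clm_apply continuous_const).intervalIntegrable _ _)
  rw [zero_smul, add_zero] at hint
  rw [← hint, intervalIntegral.integral_of_le ht, integral_Ioc_eq_integral_Ioo]
  have hle : ‖∫ s in Ioo 0 t, fderiv ℝ φ (x + s • e) e‖ₑ ≤
      ∫⁻ s in Ioo 0 t, ‖e‖ₑ * ‖fderiv ℝ φ (x + s • e)‖ₑ := by
    refine (enorm_integral_le_lintegral_enorm _).trans (lintegral_mono fun s => ?_)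
    rw [mul_comm]
    exact ContinuousLinearMap.le_opENorm _ _
  calc ‖∫ s in Ioo 0 t, fderiv ℝ φ (x + s • e) e‖ₑ ^ 2
      ≤ (∫⁻ s in Ioo 0 t, ‖e‖ₑ * ‖fderiv ℝ φ (x + s • e)‖ₑ) ^ 2 := by gcongr
    _ ≤ (volume.restrict (Ioo 0 t)) univ *
        ∫⁻ s in Ioo 0 t, (‖e‖ₑ * ‖fderiv ℝ φ (x + s • e)‖ₑ) ^ 2 :=
      sq_lintegral_le _ (hcd.enorm.measurable.const_mul _).aemeasurable
    _ = _ := by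
      simp only [mul_pow]
      rw [lintegral_const_mul _ (hcd.enorm.measurable.pow_const 2), Measure.restrict_apply_univ,
        Real.volume_Ioo, sub_zero, mul_assoc]

/-- If translation by `τ` moves `A` into `B` along segments inside `Ω`, the `L²` norm on `A` is
controlled by the one on `B` and the Dirichlet energy on `Ω`. -/
theorem lintegral_sq_le_translate (ho : IsOpen Ω) {φ : EuclideanSpace ℝ (Fin n) → ℝ}
    (hφ : ContDiff ℝ 1 φ) (τ : EuclideanSpace ℝ (Fin n)) {A B : Set (EuclideanSpace ℝ (Fin n))}
    (hA : MeasurableSet A) (hB : MeasurableSet B) (hAB : ∀ x ∈ A, x + τ ∈ B)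
    (hΩ : ∀ x ∈ A, ∀ s ∈ Ioo (0 : ℝ) 1, x + s • τ ∈ Ω) :
    ∫⁻ x in A, ‖φ x‖ₑ ^ 2 ≤ 2 * (∫⁻ x in B, ‖φ x‖ₑ ^ 2) +
      2 * ‖τ‖ₑ ^ 2 * ∫⁻ x in Ω, ‖fderiv ℝ φ x‖ₑ ^ 2 := by
  have hm : Measurable fun x => ‖φ x‖ₑ ^ 2 := hφ.continuous.enorm.measurable.pow_const 2
  have hD : Measurable fun x => ‖fderiv ℝ φ x‖ₑ ^ 2 :=
    (hφ.continuous_fderiv one_ne_zero).enorm.measurable.pow_const 2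
  have hD2 : Measurable fun z : EuclideanSpace ℝ (Fin n) × ℝ =>
      ‖fderiv ℝ φ (z.1 + z.2 • τ)‖ₑ ^ 2 := hD.comp (Continuous.measurable (by fun_prop))
  -- translation invariance of the volume
  have hshift : ∀ (F : EuclideanSpace ℝ (Fin n) → ℝ≥0∞) (v : EuclideanSpace ℝ (Fin n))
      (B' : Set (EuclideanSpace ℝ (Fin n))), MeasurableSet B' → (∀ x ∈ A, x + v ∈ B') →
      ∫⁻ x in A, F (x + v) ≤ ∫⁻ x in B', F x := by
    intro F v B' hB' h
    rw [← lintegral_indicator hA, ← lintegral_indicator hB',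
      ← lintegral_add_right_eq_self (B'.indicator F) v]
    refine lintegral_mono fun x => ?_
    by_cases hx : x ∈ A
    · rw [indicator_of_mem hx, indicator_of_mem (h x hx)]
    · rw [indicator_of_notMem hx]; exact zero_le
  calc ∫⁻ x in A, ‖φ x‖ₑ ^ 2
      ≤ ∫⁻ x in A, (2 * ‖φ (x + τ)‖ₑ ^ 2 +
          2 * (‖τ‖ₑ ^ 2 * ∫⁻ s in Ioo (0 : ℝ) 1, ‖fderiv ℝ φ (x + s • τ)‖ₑ ^ 2)) := by
        refine lintegral_mono fun x => (enorm_sq_le_of_sub (φ x) (φ (x + τ))).trans ?_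
        gcongr
        have h := enorm_sub_sq_le_line hφ x τ zero_le_one
        rwa [one_smul, ENNReal.ofReal_one, one_mul, ← neg_sub, enorm_neg] at h
    _ = 2 * (∫⁻ x in A, ‖φ (x + τ)‖ₑ ^ 2) + 2 * ‖τ‖ₑ ^ 2 *
          ∫⁻ x in A, ∫⁻ s in Ioo (0 : ℝ) 1, ‖fderiv ℝ φ (x + s • τ)‖ₑ ^ 2 := by
        have hi : Measurable fun x => ∫⁻ s in Ioo (0 : ℝ) 1, ‖fderiv ℝ φ (x + s • τ)‖ₑ ^ 2 :=
          hD2.lintegral_prod_right'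
        rw [lintegral_add_right _ ((hi.const_mul _).const_mul _),
          lintegral_const_mul 2 (f := fun x => ‖φ (x + τ)‖ₑ ^ 2)
            (hm.comp (measurable_add_const τ)),
          lintegral_const_mul _ (hi.const_mul _), lintegral_const_mul _ hi, mul_assoc]
    _ ≤ _ := by
        gcongr 2 * ?_ + 2 * ‖τ‖ₑ ^ 2 * ?_
        · exact hshift (fun x => ‖φ x‖ₑ ^ 2) τ B hB hAB
        · rw [lintegral_lintegral_swap (f := fun x s => ‖fderiv ℝ φ (x + s • τ)‖ₑ ^ 2)
            hD2.aemeasurable]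
          calc ∫⁻ s in Ioo (0 : ℝ) 1, ∫⁻ x in A, ‖fderiv ℝ φ (x + s • τ)‖ₑ ^ 2
              ≤ ∫⁻ s in Ioo (0 : ℝ) 1, ∫⁻ x in Ω, ‖fderiv ℝ φ x‖ₑ ^ 2 :=
                setLIntegral_mono measurable_const fun s hs =>
                  hshift (fun x => ‖fderiv ℝ φ x‖ₑ ^ 2) (s • τ) Ω ho.measurableSet
                    fun x hx => hΩ x hx s hs
            _ = ∫⁻ x in Ω, ‖fderiv ℝ φ x‖ₑ ^ 2 := by simp

/-- The deviation of `φ` from `φ x` along the segment from `x` in direction `e` is controlled by the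
energy on that segment. -/
theorem lintegral_flow_sub_le {e : EuclideanSpace ℝ (Fin n)} (he : ‖e‖ₑ = 1) {t₀ : ℝ}
    {φ : EuclideanSpace ℝ (Fin n) → ℝ} (hφ : ContDiff ℝ 1 φ)
    (x : EuclideanSpace ℝ (Fin n)) :
    ∫⁻ t in Ioo 0 t₀, ‖φ (x + t • e) - φ x‖ₑ ^ 2 ≤
      ENNReal.ofReal t₀ ^ 2 * ∫⁻ t in Ioo 0 t₀, ‖fderiv ℝ φ (x + t • e)‖ₑ ^ 2 := by
  calc ∫⁻ t in Ioo 0 t₀, ‖φ (x + t • e) - φ x‖ₑ ^ 2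
      ≤ ∫⁻ t in Ioo 0 t₀, (ENNReal.ofReal t₀ *
          ∫⁻ s in Ioo 0 t₀, ‖fderiv ℝ φ (x + s • e)‖ₑ ^ 2) := by
        refine setLIntegral_mono measurable_const fun t ht => ?_
        refine (enorm_sub_sq_le_line hφ x e ht.1.le).trans ?_
        rw [he, one_pow, mul_one]
        gcongr
        · exact ht.2.le
        · exact ht.2.le
    _ = _ := by
        rw [lintegral_const, Measure.restrict_apply_univ, Real.volume_Ioo, sub_zero]
        ring

/-- The local trace inequality: compare `φ x` with the mean of `φ` over the segment `x + (0, t₀) e`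
and integrate over the boundary patch. -/
theorem exists_local_trace_bound (hΩ : HasLipschitzBoundary Ω) (ho : IsOpen Ω)
    {p : EuclideanSpace ℝ (Fin n)} (hp : p ∈ frontier Ω) :
    ∃ N ∈ 𝓝 p, surfaceMeasure Ω N < ⊤ ∧ ∃ C : ℝ≥0∞, C ≠ ⊤ ∧
      ∀ φ : EuclideanSpace ℝ (Fin n) → ℝ, ContDiff ℝ 1 φ →
        ∫⁻ x in N, ‖φ x‖ₑ ^ 2 ∂(surfaceMeasure Ω) ≤
          C * ((∫⁻ x in Ω, ‖φ x‖ₑ ^ 2) + ∫⁻ x in Ω, ‖fderiv ℝ φ x‖ₑ ^ 2) := by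
  obtain ⟨e, L, h, ρ, hc⟩ := hΩ.exists_chart ho hp
  obtain ⟨t₀, N, C, -, -, ht₀, hN, hpN, -, hC, -, -, hfin, -, hup, -⟩ :=
    hc.flow ho hp univ_mem
  have he : ‖e‖ₑ = 1 := by rw [← ofReal_norm, hc.norm_eq, ENNReal.ofReal_one]
  have ht0 : ENNReal.ofReal t₀ ≠ 0 := by simpa using ht₀
  refine ⟨N, hN.mem_nhds hpN, hfin,
    (ENNReal.ofReal t₀)⁻¹ * (2 * C + 2 * (ENNReal.ofReal t₀ ^ 2 * C)),
    by finiteness, fun φ hφ => ?_⟩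
  have hm : Measurable fun x => ‖φ x‖ₑ ^ 2 := hφ.continuous.enorm.measurable.pow_const 2
  have hD : Measurable fun x => ‖fderiv ℝ φ x‖ₑ ^ 2 :=
    (hφ.continuous_fderiv one_ne_zero).enorm.measurable.pow_const 2
  have hflow : ∀ F : EuclideanSpace ℝ (Fin n) → ℝ≥0∞, Measurable F →
      Measurable fun x => ∫⁻ t in Ioo 0 t₀, F (x + t • e) := fun F hF =>
    Measurable.lintegral_prod_right'
      (f := fun z : EuclideanSpace ℝ (Fin n) × ℝ => F (z.1 + z.2 • e))
      (hF.comp (Continuous.measurable (by fun_prop)))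
  have hpt : ∀ x, ENNReal.ofReal t₀ * ‖φ x‖ₑ ^ 2 ≤
      2 * (∫⁻ t in Ioo 0 t₀, ‖φ (x + t • e)‖ₑ ^ 2) +
        2 * (ENNReal.ofReal t₀ ^ 2 * ∫⁻ t in Ioo 0 t₀, ‖fderiv ℝ φ (x + t • e)‖ₑ ^ 2) := by
    intro x
    have hline : Measurable fun t : ℝ => ‖φ (x + t • e)‖ₑ ^ 2 :=
      hm.comp (Continuous.measurable (by fun_prop))
    calc ENNReal.ofReal t₀ * ‖φ x‖ₑ ^ 2 = ∫⁻ t in Ioo 0 t₀, ‖φ x‖ₑ ^ 2 := by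
          rw [lintegral_const, Measure.restrict_apply_univ, Real.volume_Ioo, sub_zero, mul_comm]
      _ ≤ ∫⁻ t in Ioo 0 t₀, (2 * ‖φ (x + t • e)‖ₑ ^ 2 + 2 * ‖φ (x + t • e) - φ x‖ₑ ^ 2) := by
          refine lintegral_mono fun t => ?_
          rw [← enorm_neg (φ (x + t • e) - φ x), neg_sub]
          exact enorm_sq_le_of_sub _ _
      _ = 2 * (∫⁻ t in Ioo 0 t₀, ‖φ (x + t • e)‖ₑ ^ 2) +
            2 * ∫⁻ t in Ioo 0 t₀, ‖φ (x + t • e) - φ x‖ₑ ^ 2 := by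
          rw [lintegral_add_left (hline.const_mul _), lintegral_const_mul _ hline,
            lintegral_const_mul' _ _ (by finiteness)]
      _ ≤ _ := by
          gcongr
          exact lintegral_flow_sub_le he hφ x
  rw [mul_assoc, ← ENNReal.mul_le_iff_le_inv ht0 ENNReal.ofReal_ne_top]
  calc ENNReal.ofReal t₀ * ∫⁻ x in N, ‖φ x‖ₑ ^ 2 ∂(surfaceMeasure Ω)
      = ∫⁻ x in N, ENNReal.ofReal t₀ * ‖φ x‖ₑ ^ 2 ∂(surfaceMeasure Ω) :=
        (lintegral_const_mul _ hm).symm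
    _ ≤ ∫⁻ x in N, (2 * (∫⁻ t in Ioo 0 t₀, ‖φ (x + t • e)‖ₑ ^ 2) +
          2 * (ENNReal.ofReal t₀ ^ 2 *
            ∫⁻ t in Ioo 0 t₀, ‖fderiv ℝ φ (x + t • e)‖ₑ ^ 2)) ∂(surfaceMeasure Ω) :=
        lintegral_mono hpt
    _ = 2 * (∫⁻ x in N, (∫⁻ t in Ioo 0 t₀, ‖φ (x + t • e)‖ₑ ^ 2) ∂(surfaceMeasure Ω)) +
          2 * (ENNReal.ofReal t₀ ^ 2 * ∫⁻ x in N, (∫⁻ t in Ioo 0 t₀,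
            ‖fderiv ℝ φ (x + t • e)‖ₑ ^ 2) ∂(surfaceMeasure Ω)) := by
        rw [lintegral_add_left ((hflow _ hm).const_mul _), lintegral_const_mul _ (hflow _ hm),
          lintegral_const_mul' _ _ (by finiteness), lintegral_const_mul _ (hflow _ hD)]
    _ ≤ 2 * (C * ∫⁻ x in Ω, ‖φ x‖ₑ ^ 2) +
          2 * (ENNReal.ofReal t₀ ^ 2 * (C * ∫⁻ x in Ω, ‖fderiv ℝ φ x‖ₑ ^ 2)) := by
        gcongr
        · exact hup _ hm
        · exact hup _ hD
    _ ≤ (2 * C + 2 * (ENNReal.ofReal t₀ ^ 2 * C)) *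
          ((∫⁻ x in Ω, ‖φ x‖ₑ ^ 2) + ∫⁻ x in Ω, ‖fderiv ℝ φ x‖ₑ ^ 2) := by
        rw [add_mul]
        refine add_le_add ?_ ?_
        · rw [mul_assoc]; gcongr; exact le_self_add
        · rw [mul_assoc, mul_assoc]; gcongr; exact le_add_self

/-- The trace inequality for `C¹` functions. Compactness of `∂Ω` reduces it, and the
finiteness of the surface measure, to the local statement. -/
theorem exists_trace_bound (hΩ : HasLipschitzBoundary Ω) (ho : IsOpen Ω)
    (hb : Bornology.IsBounded Ω) :
    surfaceMeasure Ω univ < ⊤ ∧ ∃ C : ℝ≥0∞, C ≠ ⊤ ∧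
      ∀ φ : EuclideanSpace ℝ (Fin n) → ℝ, ContDiff ℝ 1 φ →
        ∫⁻ x, ‖φ x‖ₑ ^ 2 ∂(surfaceMeasure Ω) ≤
          C * ((∫⁻ x in Ω, ‖φ x‖ₑ ^ 2) + ∫⁻ x in Ω, ‖fderiv ℝ φ x‖ₑ ^ 2) := by
  have hcomp : IsCompact (frontier Ω) :=
    hb.isCompact_closure.of_isClosed_subset isClosed_frontier frontier_subset_closure
  have key := hcomp.induction_on (p := fun K => surfaceMeasure Ω K < ⊤ ∧ ∃ C : ℝ≥0∞, C ≠ ⊤ ∧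
      ∀ φ : EuclideanSpace ℝ (Fin n) → ℝ, ContDiff ℝ 1 φ →
        ∫⁻ x in K, ‖φ x‖ₑ ^ 2 ∂(surfaceMeasure Ω) ≤
          C * ((∫⁻ x in Ω, ‖φ x‖ₑ ^ 2) + ∫⁻ x in Ω, ‖fderiv ℝ φ x‖ₑ ^ 2))
    ⟨by simp, 0, by simp, by simp⟩
    (fun K K' hKK' ⟨h1, C, hC, h2⟩ => ⟨(measure_mono hKK').trans_lt h1, C, hC, fun φ hφ =>
      (lintegral_mono_set hKK').trans (h2 φ hφ)⟩)
    (fun K K' ⟨h1, C, hC, h2⟩ ⟨h1', C', hC', h2'⟩ =>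
      ⟨(measure_union_le _ _).trans_lt (ENNReal.add_lt_top.2 ⟨h1, h1'⟩), C + C',
        ENNReal.add_ne_top.2 ⟨hC, hC'⟩, fun φ hφ =>
        (lintegral_union_le _ _ _).trans (by rw [add_mul]; exact add_le_add (h2 φ hφ) (h2' φ hφ))⟩)
    (fun p hp => by
      obtain ⟨N, hN, h⟩ := exists_local_trace_bound hΩ ho hp
      exact ⟨N, mem_nhdsWithin_of_mem_nhds hN, h⟩)
  have hr : (surfaceMeasure Ω).restrict (frontier Ω) = surfaceMeasure Ω := by
    rw [surfaceMeasure, Measure.restrict_restrict isClosed_frontier.measurableSet, inter_self]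
  rw [hr, ← Measure.restrict_apply_univ, hr] at key
  exact key

/-- The reverse of the local trace inequality: boundary values on a patch and the energy control `φ`
on a small ball above the patch. -/
theorem exists_start_ball (hΩ : HasLipschitzBoundary Ω) (ho : IsOpen Ω)
    {p : EuclideanSpace ℝ (Fin n)} (hp : p ∈ frontier Ω) {O : Set (EuclideanSpace ℝ (Fin n))}
    (hO : O ∈ 𝓝 p) :
    ∃ (q : EuclideanSpace ℝ (Fin n)) (r : ℝ), 0 < r ∧ ball q r ⊆ Ω ∧ ∃ C : ℝ≥0∞, C ≠ ⊤ ∧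
      ∀ φ : EuclideanSpace ℝ (Fin n) → ℝ, ContDiff ℝ 1 φ →
        ∫⁻ x in ball q r, ‖φ x‖ₑ ^ 2 ≤ C * ((∫⁻ x in O, ‖φ x‖ₑ ^ 2 ∂(surfaceMeasure Ω)) +
          ∫⁻ x in Ω, ‖fderiv ℝ φ x‖ₑ ^ 2) := by
  obtain ⟨e, L, h, ρ, hc⟩ := hΩ.exists_chart ho hp
  obtain ⟨t₀, N, C, q, r, ht₀, hN, hpN, hNO, hC, hr, hball, hfin, -, hup, hlow⟩ :=
    hc.flow ho hp hO
  have he : ‖e‖ₑ = 1 := by rw [← ofReal_norm, hc.norm_eq, ENNReal.ofReal_one]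
  refine ⟨q, r, hr, hball, 2 * ENNReal.ofReal t₀ + 2 * (ENNReal.ofReal t₀ ^ 2 * C),
    by finiteness, fun φ hφ => ?_⟩
  have hm : Measurable fun x => ‖φ x‖ₑ ^ 2 := hφ.continuous.enorm.measurable.pow_const 2
  have hD : Measurable fun x => ‖fderiv ℝ φ x‖ₑ ^ 2 :=
    (hφ.continuous_fderiv one_ne_zero).enorm.measurable.pow_const 2
  have hflow : ∀ F : EuclideanSpace ℝ (Fin n) → ℝ≥0∞, Measurable F →
      Measurable fun x => ∫⁻ t in Ioo 0 t₀, F (x + t • e) := fun F hF =>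
    Measurable.lintegral_prod_right'
      (f := fun z : EuclideanSpace ℝ (Fin n) × ℝ => F (z.1 + z.2 • e))
      (hF.comp (Continuous.measurable (by fun_prop)))
  calc ∫⁻ x in ball q r, ‖φ x‖ₑ ^ 2
      ≤ ∫⁻ x in N, (∫⁻ t in Ioo 0 t₀, ‖φ (x + t • e)‖ₑ ^ 2) ∂(surfaceMeasure Ω) := hlow _ hm
    _ ≤ ∫⁻ x in N, (2 * ENNReal.ofReal t₀ * ‖φ x‖ₑ ^ 2 + 2 * (ENNReal.ofReal t₀ ^ 2 *
          ∫⁻ t in Ioo 0 t₀, ‖fderiv ℝ φ (x + t • e)‖ₑ ^ 2)) ∂(surfaceMeasure Ω) := by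
        refine lintegral_mono fun x => ?_
        calc ∫⁻ t in Ioo 0 t₀, ‖φ (x + t • e)‖ₑ ^ 2
            ≤ ∫⁻ t in Ioo 0 t₀, (2 * ‖φ x‖ₑ ^ 2 + 2 * ‖φ (x + t • e) - φ x‖ₑ ^ 2) :=
              lintegral_mono fun t => enorm_sq_le_of_sub _ _
          _ = 2 * ENNReal.ofReal t₀ * ‖φ x‖ₑ ^ 2 +
                2 * ∫⁻ t in Ioo 0 t₀, ‖φ (x + t • e) - φ x‖ₑ ^ 2 := by
              rw [lintegral_add_left measurable_const, lintegral_const,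
                lintegral_const_mul' _ _ (by finiteness), Measure.restrict_apply_univ,
                Real.volume_Ioo, sub_zero]
              ring
          _ ≤ _ := by
              gcongr
              exact lintegral_flow_sub_le he hφ x
    _ = 2 * ENNReal.ofReal t₀ * (∫⁻ x in N, ‖φ x‖ₑ ^ 2 ∂(surfaceMeasure Ω)) +
          2 * (ENNReal.ofReal t₀ ^ 2 * ∫⁻ x in N, (∫⁻ t in Ioo 0 t₀,
            ‖fderiv ℝ φ (x + t • e)‖ₑ ^ 2) ∂(surfaceMeasure Ω)) := by
        rw [lintegral_add_left (hm.const_mul _), lintegral_const_mul _ hm,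
          lintegral_const_mul' _ _ (by finiteness), lintegral_const_mul _ (hflow _ hD)]
    _ ≤ 2 * ENNReal.ofReal t₀ * (∫⁻ x in O, ‖φ x‖ₑ ^ 2 ∂(surfaceMeasure Ω)) +
          2 * (ENNReal.ofReal t₀ ^ 2 * (C * ∫⁻ x in Ω, ‖fderiv ℝ φ x‖ₑ ^ 2)) := by
        gcongr
        exact hup _ hD
    _ ≤ _ := by
        rw [add_mul]
        refine add_le_add ?_ ?_
        · gcongr; exact le_self_add
        · rw [mul_assoc, mul_assoc]; gcongr; exact le_add_self

/-- Poincaré inequality with a boundary term. The local estimate spreads from a ball above the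
boundary patch `O ∩ ∂Ω` to all of `Ω` by translations inside `Ω`, using connectedness, and to the
closure by translations along the cone directions; compactness makes the constant uniform. -/
theorem exists_poincare (hΩ : HasLipschitzBoundary Ω) (ho : IsOpen Ω)
    (hb : Bornology.IsBounded Ω) (hconn : IsPreconnected Ω)
    {p : EuclideanSpace ℝ (Fin n)} (hp : p ∈ frontier Ω) {O : Set (EuclideanSpace ℝ (Fin n))}
    (hO : O ∈ 𝓝 p) :
    ∃ C : ℝ≥0∞, C ≠ ⊤ ∧ ∀ φ : EuclideanSpace ℝ (Fin n) → ℝ, ContDiff ℝ 1 φ →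
      ∫⁻ x in Ω, ‖φ x‖ₑ ^ 2 ≤ C * ((∫⁻ x in O, ‖φ x‖ₑ ^ 2 ∂(surfaceMeasure Ω)) +
        ∫⁻ x in Ω, ‖fderiv ℝ φ x‖ₑ ^ 2) := by
  set P : Set (EuclideanSpace ℝ (Fin n)) → Prop := fun A =>
    ∃ C : ℝ≥0∞, C ≠ ⊤ ∧ ∀ φ : EuclideanSpace ℝ (Fin n) → ℝ, ContDiff ℝ 1 φ →
      ∫⁻ x in A ∩ Ω, ‖φ x‖ₑ ^ 2 ≤ C * ((∫⁻ x in O, ‖φ x‖ₑ ^ 2 ∂(surfaceMeasure Ω)) +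
        ∫⁻ x in Ω, ‖fderiv ℝ φ x‖ₑ ^ 2) with hP
  have hmono : ∀ A B, A ⊆ B → P B → P A := fun A B hAB ⟨C, hC, h⟩ => ⟨C, hC, fun φ hφ =>
    (lintegral_mono_set (inter_subset_inter_left _ hAB)).trans (h φ hφ)⟩
  have htrans : ∀ (A B : Set (EuclideanSpace ℝ (Fin n))) (τ : EuclideanSpace ℝ (Fin n)),
      MeasurableSet A → MeasurableSet B → (∀ x ∈ A ∩ Ω, x + τ ∈ B ∩ Ω) →
      (∀ x ∈ A ∩ Ω, ∀ s ∈ Ioo (0 : ℝ) 1, x + s • τ ∈ Ω) → P B → P A := by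
    rintro A B τ hA hB hAB hpath ⟨C, hC, h⟩
    refine ⟨2 * C + 2 * ‖τ‖ₑ ^ 2, by finiteness, fun φ hφ => ?_⟩
    refine (lintegral_sq_le_translate ho hφ τ (hA.inter ho.measurableSet)
      (hB.inter ho.measurableSet) hAB hpath).trans ?_
    rw [add_mul]
    refine add_le_add ?_ ?_
    · rw [mul_assoc]; gcongr; exact h φ hφ
    · gcongr; exact le_add_self
  -- the points near which the estimate holds; the goal is `closure Ω ⊆ g`
  set g : Set (EuclideanSpace ℝ (Fin n)) := {x | ∃ r > 0, P (ball x r)} with hg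
  have hgo : IsOpen g := by
    refine Metric.isOpen_iff.2 ?_
    rintro x ⟨r, hr, h⟩
    refine ⟨r / 2, by positivity, fun y hy => ⟨r / 2, by positivity, hmono _ _ ?_ h⟩⟩
    refine ball_subset_ball' ?_
    rw [mem_ball] at hy
    linarith
  obtain ⟨q, r, hr, hqr, hstart⟩ := exists_start_ball hΩ ho hp hO
  have hqg : q ∈ g := by
    refine ⟨r, hr, ?_⟩
    obtain ⟨C, hC, h⟩ := hstart
    exact ⟨C, hC, fun φ hφ => (lintegral_mono_set inter_subset_left).trans (h φ hφ)⟩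
  have hΩg : Ω ⊆ g := by
    refine hconn.subset_of_closure_inter_subset hgo ⟨q, hqr (mem_ball_self hr), hqg⟩ ?_
    rintro x ⟨hxc, hxΩ⟩
    obtain ⟨R, hR, hRb⟩ := Metric.isOpen_iff.1 ho x hxΩ
    obtain ⟨y, ⟨ρ, hρ, hy⟩, hxy⟩ := Metric.mem_closure_iff.1 hxc (R / 2) (by positivity)
    have hin : ∀ x' ∈ ball x (min ρ (R / 2)), ∀ s ∈ Icc (0 : ℝ) 1, x' + s • (y - x) ∈ Ω := by
      rintro x' hx' s ⟨hs0, hs1⟩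
      apply hRb
      rw [mem_ball] at hx' ⊢
      have h1 : dist (x' + s • (y - x)) x' ≤ dist x y := by
        rw [dist_eq_norm, add_sub_cancel_left, norm_smul, Real.norm_eq_abs, abs_of_nonneg hs0,
          dist_comm, dist_eq_norm]
        exact mul_le_of_le_one_left (norm_nonneg _) hs1
      linarith [dist_triangle (x' + s • (y - x)) x' x, min_le_right ρ (R / 2)]
    refine ⟨min ρ (R / 2), by positivity, htrans _ (ball y ρ) (y - x) measurableSet_ball
      measurableSet_ball ?_ ?_ hy⟩
    · rintro x' ⟨hx', -⟩
      refine ⟨?_, by simpa using hin x' hx' 1 ⟨zero_le_one, le_rfl⟩⟩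
      rw [mem_ball, dist_eq_norm] at hx' ⊢
      rw [show x' + (y - x) - y = x' - x by abel]
      exact hx'.trans_le (min_le_left _ _)
    · rintro x' ⟨hx', -⟩ s hs
      exact hin x' hx' s ⟨hs.1.le, hs.2.le⟩
  have hcg : closure Ω ⊆ g := by
    intro x hx
    obtain ⟨e, r', δ, η, hr', hδ, hη, hcone⟩ := exists_cone hΩ ho hx
    have hxe : x + δ • e ∈ Ω := by
      obtain ⟨y, hyΩ, hxy⟩ := Metric.mem_closure_iff.1 hx (min η (δ * r')) (by positivity)
      refine hcone y ⟨?_, hyΩ⟩ δ ⟨hδ, le_rfl⟩ ?_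
      · rw [mem_ball, dist_comm]; exact hxy.trans_le (min_le_left _ _)
      · rw [mem_closedBall, dist_add_right]; exact (hxy.trans_le (min_le_right _ _)).le
    obtain ⟨ρ, hρ, hP'⟩ := hΩg hxe
    have hin : ∀ x' ∈ ball x (min ρ η) ∩ Ω, ∀ s ∈ Ioc (0 : ℝ) 1, x' + s • δ • e ∈ Ω := by
      rintro x' ⟨hx', hx'Ω⟩ s ⟨hs0, hs1⟩
      refine hcone x' ⟨ball_subset_ball (min_le_right _ _) hx', hx'Ω⟩ (s * δ)
        ⟨by positivity, mul_le_of_le_one_left hδ.le hs1⟩ ?_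
      rw [smul_smul]
      exact mem_closedBall_self (by positivity)
    refine ⟨min ρ η, by positivity, htrans _ (ball (x + δ • e) ρ) (δ • e) measurableSet_ball
      measurableSet_ball ?_ (fun x' hx' s hs => hin x' hx' s ⟨hs.1, hs.2.le⟩) hP'⟩
    intro x' hx'
    refine ⟨?_, by simpa using hin x' hx' 1 ⟨zero_lt_one, le_rfl⟩⟩
    rw [mem_ball, dist_add_right]
    exact (mem_ball.1 hx'.1).trans_le (min_le_left _ _)
  have key : P (closure Ω) := hb.isCompact_closure.induction_on
    ⟨0, by simp, by simp⟩ (fun A B hAB => hmono A B hAB)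
    (fun A B ⟨C, hC, h⟩ ⟨C', hC', h'⟩ => ⟨C + C', ENNReal.add_ne_top.2 ⟨hC, hC'⟩, fun φ hφ => by
      rw [union_inter_distrib_right, add_mul]
      exact (lintegral_union_le _ _ _).trans (add_le_add (h φ hφ) (h' φ hφ))⟩)
    (fun x hx => by
      obtain ⟨r, hr, h⟩ := hcg hx
      exact ⟨ball x r, mem_nhdsWithin_of_mem_nhds (ball_mem_nhds x hr), h⟩)
  obtain ⟨C, hC, h⟩ := key
  rw [inter_eq_right.2 subset_closure] at h
  exact ⟨C, hC, h⟩

/-! ### Density of smooth functions in the Sobolev space -/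

/-- Continuity of translations in `L²`. -/
theorem exists_translation_bound {F : Type*} [NormedAddCommGroup F]
    {f : EuclideanSpace ℝ (Fin n) → F} (hf : MemLp f 2 volume) {ε : ℝ≥0∞} (hε : ε ≠ 0) :
    ∃ δ > 0, ∀ z : EuclideanSpace ℝ (Fin n), ‖z‖ ≤ δ →
      eLpNorm (fun x => f (x - z) - f x) 2 volume ≤ ε := by
  have hmp : ∀ z : EuclideanSpace ℝ (Fin n),
      MeasurePreserving (fun x : EuclideanSpace ℝ (Fin n) => x - z) volume volume :=
    fun z => measurePreserving_sub_right volume z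
  let S : C(EuclideanSpace ℝ (Fin n), C(EuclideanSpace ℝ (Fin n), EuclideanSpace ℝ (Fin n))) :=
    ContinuousMap.curry ⟨fun q => q.2 - q.1, by fun_prop⟩
  have hS : ∀ z, MeasurePreserving (S z) volume volume := hmp
  have hcont : Continuous fun z => Lp.compMeasurePreserving (S z) (hS z) hf.toLp :=
    Continuous.compMeasurePreservingLp continuous_const S.continuous hS (by simp)
  have hz : ∀ z, edist (Lp.compMeasurePreserving (S z) (hS z) hf.toLp)
      (Lp.compMeasurePreserving (S 0) (hS 0) hf.toLp) =
        eLpNorm (fun x => f (x - z) - f x) 2 volume := by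
    intro z
    rw [Lp.toLp_compMeasurePreserving, Lp.toLp_compMeasurePreserving, Lp.edist_toLp_toLp]
    congr 1
    ext x
    simp [S]
  obtain ⟨δ, hδ, h⟩ := Metric.eventually_nhds_iff_ball.1
    (hcont.tendsto 0 (Metric.eball_mem_nhds _ (pos_iff_ne_zero.2 hε)))
  refine ⟨δ / 2, by positivity, fun z hzδ => ?_⟩
  rw [← hz]
  refine le_of_lt (h z ?_)
  rw [mem_ball_zero_iff]
  linarith

theorem eLpNorm_two_sq {α F : Type*} [MeasurableSpace α] [NormedAddCommGroup F] (μ : Measure α)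
    (f : α → F) : eLpNorm f 2 μ ^ 2 = ∫⁻ x, ‖f x‖ₑ ^ 2 ∂μ := by
  have h := eLpNorm_nnreal_pow_eq_lintegral (f := f) (μ := μ) (p := 2) two_ne_zero
  simpa using h

/-- Averaging over small translations is close to the identity in `L²`. -/
theorem exists_average_bound {F : Type*} [NormedAddCommGroup F] [NormedSpace ℝ F] [CompleteSpace F]
    {f : EuclideanSpace ℝ (Fin n) → F} (hf : MemLp f 2 volume) (hfm : StronglyMeasurable f)
    {ε : ℝ≥0∞} (hε : ε ≠ 0) :
    ∃ δ > 0, ∀ π : Measure (EuclideanSpace ℝ (Fin n)), IsProbabilityMeasure π →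
      (∀ᵐ z ∂π, ‖z‖ ≤ δ) → (∀ x, Integrable (fun z => f (x - z)) π) →
      eLpNorm (fun x => (∫ z, f (x - z) ∂π) - f x) 2 volume ≤ ε := by
  obtain ⟨δ, hδ, h⟩ := exists_translation_bound hf hε
  refine ⟨δ, hδ, fun π hπ hsupp hint => ?_⟩
  have hsm : StronglyMeasurable fun q : EuclideanSpace ℝ (Fin n) × EuclideanSpace ℝ (Fin n) =>
      f (q.1 - q.2) - f q.1 :=
    (hfm.comp_measurable (measurable_fst.sub measurable_snd)).sub
      (hfm.comp_measurable measurable_fst)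
  have hm : Measurable fun q : EuclideanSpace ℝ (Fin n) × EuclideanSpace ℝ (Fin n) =>
      ‖f (q.1 - q.2) - f q.1‖ₑ ^ 2 := hsm.enorm.pow_const 2
  rw [← ENNReal.pow_le_pow_left_iff (two_ne_zero), eLpNorm_two_sq]
  calc ∫⁻ x, ‖(∫ z, f (x - z) ∂π) - f x‖ₑ ^ 2
      ≤ ∫⁻ x, ∫⁻ z, ‖f (x - z) - f x‖ₑ ^ 2 ∂π := by
        refine lintegral_mono fun x => ?_
        have h1 : (∫ z, f (x - z) ∂π) - f x = ∫ z, (f (x - z) - f x) ∂π := by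
          rw [integral_sub (hint x) (integrable_const _), integral_const]
          simp
        have h2 : Measurable fun z => ‖f (x - z) - f x‖ₑ :=
          hsm.enorm.comp measurable_prodMk_left
        calc ‖(∫ z, f (x - z) ∂π) - f x‖ₑ ^ 2
            ≤ (∫⁻ z, ‖f (x - z) - f x‖ₑ ∂π) ^ 2 := by
              rw [h1]; gcongr; exact enorm_integral_le_lintegral_enorm _
          _ ≤ ∫⁻ z, ‖f (x - z) - f x‖ₑ ^ 2 ∂π := by
              have := sq_lintegral_le π h2.aemeasurable
              rwa [measure_univ, one_mul] at this
    _ = ∫⁻ z, (∫⁻ x, ‖f (x - z) - f x‖ₑ ^ 2) ∂π :=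
        lintegral_lintegral_swap (f := fun x z => ‖f (x - z) - f x‖ₑ ^ 2) hm.aemeasurable
    _ ≤ ∫⁻ z, ε ^ 2 ∂π := by
        refine lintegral_mono_ae ?_
        filter_upwards [hsupp] with z hz
        rw [← eLpNorm_two_sq]
        gcongr
        exact h z hz
    _ = ε ^ 2 := by simp

/-- If the reflected kernel `k (x - ·)` is a test function on `Ω`, the gradient at `x` of the
mollification is the mollification of the weak gradient. -/
theorem gradient_convolution (ho : IsOpen Ω) (u : H1 Ω) {k : EuclideanSpace ℝ (Fin n) → ℝ}
    (hkd : ContDiff ℝ ∞ k) (hks : HasCompactSupport k) {x : EuclideanSpace ℝ (Fin n)}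
    (hψt : tsupport (fun t => k (x - t)) ⊆ Ω) :
    ∇ (convolution (Ω.indicator (h1Fun u)) k (ContinuousLinearMap.lsmul ℝ ℝ) volume) x =
      ∫ z, k z • Ω.indicator (h1Grad u) (x - z) := by
  set U : EuclideanSpace ℝ (Fin n) → ℝ := Ω.indicator (h1Fun u) with hU
  set g : EuclideanSpace ℝ (Fin n) → EuclideanSpace ℝ (Fin n) := Ω.indicator (h1Grad u) with hg
  have hUL : MemLp U 2 volume :=
    (memLp_indicator_iff_restrict ho.measurableSet).2 (Lp.memLp _)
  have hgL : MemLp g 2 volume :=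
    (memLp_indicator_iff_restrict ho.measurableSet).2 (Lp.memLp _)
  have hUloc : LocallyIntegrable U volume := hUL.locallyIntegrable (by norm_num)
  have hψd : ContDiff ℝ ∞ fun t => k (x - t) := hkd.comp (contDiff_const.sub contDiff_id)
  have hψs : HasCompactSupport fun t => k (x - t) :=
    hks.comp_homeomorph (Homeomorph.subLeft x)
  have hint : Integrable (fun z => k z • g (x - z)) volume := by
    have hgx : MemLp (fun z => g (x - z)) 2 volume :=
      hgL.comp_measurePreserving (Measure.measurePreserving_sub_left volume x)
    exact memLp_one_iff_integrable.1
      (hgx.smul (hkd.continuous.memLp_of_hasCompactSupport (p := 2) hks))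
  refine ext_inner_right ℝ fun v => ?_
  have h4 := hks.hasFDerivAt_convolution_right (ContinuousLinearMap.lsmul ℝ ℝ) hUloc
    (hkd.of_le (by simp)) x
  have h5 : ∀ t, fderiv ℝ (fun t => k (x - t)) t v = -fderiv ℝ k (x - t) v := by
    intro t
    have h6 := (hkd.differentiable (by simp) (x - t)).hasFDerivAt.comp t
      ((hasFDerivAt_const x t).sub (hasFDerivAt_id t))
    have h7 : fderiv ℝ (fun t => k (x - t)) t = _ := h6.fderiv
    simp [h7]
  have h8 : ∫ t in Ω, h1Fun u t * fderiv ℝ (fun t => k (x - t)) t v =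
      -∫ t in Ω, ⟪h1Grad u t, v⟫_ℝ * k (x - t) := u.2 (fun t => k (x - t)) hψd hψs hψt v
  calc ⟪∇ (convolution U k (ContinuousLinearMap.lsmul ℝ ℝ) volume) x, v⟫_ℝ
      = convolution U (fun a => fderiv ℝ k a v) (ContinuousLinearMap.lsmul ℝ ℝ) volume x := by
        rw [gradient, InnerProductSpace.toDual_symm_apply, h4.fderiv,
          convolution_precompR_apply _ hUloc (hks.fderiv ℝ) (hkd.continuous_fderiv (by simp))]
    _ = -∫ t in Ω, h1Fun u t * fderiv ℝ (fun t => k (x - t)) t v := by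
        rw [convolution_def, ← integral_neg, ← integral_indicator ho.measurableSet]
        refine integral_congr_ae (Eventually.of_forall fun t => ?_)
        by_cases ht : t ∈ Ω
        · simp only [hU, indicator_of_mem ht, h5, ContinuousLinearMap.lsmul_apply, smul_eq_mul,
            mul_neg, neg_neg]
        · simp only [hU, indicator_of_notMem ht, ContinuousLinearMap.lsmul_apply, zero_smul]
    _ = ∫ t, ⟪k (x - t) • g (x - (x - t)), v⟫_ℝ := by
        rw [h8, neg_neg, ← integral_indicator ho.measurableSet]
        refine integral_congr_ae (Eventually.of_forall fun t => ?_)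
        by_cases ht : t ∈ Ω
        · simp only [hg, sub_sub_cancel, indicator_of_mem ht, real_inner_smul_left, mul_comm]
        · simp only [hg, sub_sub_cancel, indicator_of_notMem ht, smul_zero, inner_zero_left]
    _ = ∫ z, ⟪k z • g (x - z), v⟫_ℝ :=
        integral_sub_left_eq_self (fun z => ⟪k z • g (x - z), v⟫_ℝ) volume x
    _ = ⟪∫ z, k z • g (x - z), v⟫_ℝ := by
        rw [real_inner_comm, ← integral_inner hint]
        exact integral_congr_ae (Eventually.of_forall fun z => real_inner_comm _ _)

/-- Mollification with an off-centre kernel. In the cone region `ball p η ∩ Ω` the kernel only sees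
points of `Ω`, so there the gradient of the mollification is the mollified weak gradient; no
extension operator is needed. -/
theorem exists_local_approx (hΩ : HasLipschitzBoundary Ω) (ho : IsOpen Ω)
    {p : EuclideanSpace ℝ (Fin n)} (hp : p ∈ closure Ω) :
    ∃ η > 0, ∀ (u : H1 Ω) (ε : ℝ≥0∞), ε ≠ 0 → ∃ w : EuclideanSpace ℝ (Fin n) → ℝ,
      ContDiff ℝ ∞ w ∧
      eLpNorm (fun x => w x - h1Fun u x) 2 (volume.restrict Ω) ≤ ε ∧
      eLpNorm (fun x => ∇ w x - h1Grad u x) 2 (volume.restrict (ball p η ∩ Ω)) ≤ ε := by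
  obtain ⟨e, r, δ, η, hr, hδ, hη, hcone⟩ := exists_cone hΩ ho hp
  refine ⟨η, hη, fun u ε hε => ?_⟩
  -- zero extensions of the function and of its weak gradient
  set U : EuclideanSpace ℝ (Fin n) → ℝ := Ω.indicator (h1Fun u) with hU
  set g : EuclideanSpace ℝ (Fin n) → EuclideanSpace ℝ (Fin n) := Ω.indicator (h1Grad u) with hg
  have hUL : MemLp U 2 volume :=
    (memLp_indicator_iff_restrict ho.measurableSet).2 (Lp.memLp _)
  have hgL : MemLp g 2 volume :=
    (memLp_indicator_iff_restrict ho.measurableSet).2 (Lp.memLp _)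
  have hUm : StronglyMeasurable U := (Lp.stronglyMeasurable _).indicator ho.measurableSet
  have hgm : StronglyMeasurable g := (Lp.stronglyMeasurable _).indicator ho.measurableSet
  obtain ⟨δ₁, hδ₁, h₁⟩ := exists_average_bound hUL hUm hε
  obtain ⟨δ₂, hδ₂, h₂⟩ := exists_average_bound hgL hgm hε
  set d : ℝ := ‖e‖ + r with hd
  have hdpos : 0 < d := by positivity
  set τ : ℝ := min δ (min δ₁ δ₂ / d) with hτ
  have hτpos : 0 < τ := by positivity
  have hτd : τ * d ≤ min δ₁ δ₂ := by
    rw [← le_div_iff₀ hdpos]; exact min_le_right _ _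
  -- the kernel lives in a ball around `-τ e`, so the mollification at `x` averages over points of
  -- the ball around `x + τ e`, which the cone condition places inside `Ω`
  let b : ContDiffBump (-(τ • e)) :=
    ⟨τ * r / 2, τ * r, by positivity, by linarith [mul_pos hτpos hr]⟩
  set k : EuclideanSpace ℝ (Fin n) → ℝ := b.normed volume with hk
  have hkc : Continuous k := b.continuous_normed
  have hks : HasCompactSupport k := b.hasCompactSupport_normed
  have hkd : ContDiff ℝ ∞ k := b.contDiff_normed
  have hk0 : ∀ x, 0 ≤ k x := fun x => b.nonneg_normed x
  have hkt : tsupport k = closedBall (-(τ • e)) (τ * r) := b.tsupport_normed_eq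
  have hkint : ∫ x, k x = 1 := b.integral_normed
  set π : Measure (EuclideanSpace ℝ (Fin n)) :=
    volume.withDensity fun x => ENNReal.ofReal (k x) with hπ
  have hkm : Measurable fun x => ENNReal.ofReal (k x) := hkc.measurable.ennreal_ofReal
  have hπp : IsProbabilityMeasure π := by
    refine ⟨?_⟩
    rw [hπ, withDensity_apply _ MeasurableSet.univ, Measure.restrict_univ,
      ← ofReal_integral_eq_lintegral_ofReal (hkc.integrable_of_hasCompactSupport hks)
        (Eventually.of_forall hk0), hkint, ENNReal.ofReal_one]
  have hπs : ∀ᵐ z ∂π, ‖z‖ ≤ min δ₁ δ₂ := by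
    rw [hπ, ae_withDensity_iff hkm]
    refine Eventually.of_forall fun z hz => ?_
    have hz' : z ∈ closedBall (-(τ • e)) (τ * r) := by
      rw [← hkt]
      refine subset_tsupport _ fun h0 => hz ?_
      simp [h0]
    rw [mem_closedBall, dist_eq_norm, sub_neg_eq_add] at hz'
    have h3 : ‖z‖ ≤ ‖z + τ • e‖ + ‖τ • e‖ := by
      simpa using norm_sub_le (z + τ • e) (τ • e)
    rw [norm_smul, Real.norm_eq_abs, abs_of_pos hτpos] at h3
    have h4 : τ * r + τ * ‖e‖ = τ * d := by rw [hd]; ring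
    linarith
  have hsmul : ∀ {F : Type} [NormedAddCommGroup F] [NormedSpace ℝ F]
      (f : EuclideanSpace ℝ (Fin n) → F), ∫ z, f z ∂π = ∫ z, k z • f z := by
    intro F _ _ f
    rw [hπ, integral_withDensity_eq_integral_toReal_smul hkm (by simp)]
    simp_rw [ENNReal.toReal_ofReal (hk0 _)]
  have hkL : MemLp k 2 volume := hkc.memLp_of_hasCompactSupport hks
  have hint : ∀ {F : Type} [NormedAddCommGroup F] [NormedSpace ℝ F]
      {f : EuclideanSpace ℝ (Fin n) → F}, MemLp f 2 volume →
      ∀ x, Integrable (fun z => f (x - z)) π := by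
    intro F _ _ f hf x
    rw [hπ, integrable_withDensity_iff_integrable_smul' hkm (by simp)]
    simp_rw [ENNReal.toReal_ofReal (hk0 _)]
    have hfx : MemLp (fun z => f (x - z)) 2 volume :=
      hf.comp_measurePreserving (Measure.measurePreserving_sub_left volume x)
    exact memLp_one_iff_integrable.1 (hfx.smul hkL)
  have hUloc : LocallyIntegrable U volume := hUL.locallyIntegrable (by norm_num)
  set w : EuclideanSpace ℝ (Fin n) → ℝ :=
    convolution U k (ContinuousLinearMap.lsmul ℝ ℝ) volume with hw
  have hwsmooth : ContDiff ℝ ∞ w := hks.contDiff_convolution_right _ hUloc hkd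
  have hwavg : ∀ x, w x = ∫ z, U (x - z) ∂π := by
    intro x
    rw [hw, convolution_eq_swap, hsmul]
    refine integral_congr_ae (Eventually.of_forall fun z => ?_)
    simp [mul_comm]
  have hgrad : ∀ x ∈ ball p η ∩ Ω, ∇ w x = ∫ z, g (x - z) ∂π := by
    intro x hx
    have hsub : ∀ t, k (x - t) ≠ 0 → t ∈ closedBall (x + τ • e) (τ * r) := by
      intro t ht
      have h3 : x - t ∈ closedBall (-(τ • e)) (τ * r) := by
        rw [← hkt]; exact subset_tsupport _ ht
      rw [mem_closedBall, dist_eq_norm] at h3 ⊢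
      rw [← norm_neg]
      refine le_of_eq_of_le (congrArg _ ?_) h3
      abel
    have hcb : closedBall (x + τ • e) (τ * r) ⊆ Ω :=
      hcone x hx τ ⟨hτpos, min_le_left _ _⟩
    have hψt : tsupport (fun t => k (x - t)) ⊆ Ω :=
      (closure_minimal hsub isClosed_closedBall).trans hcb
    rw [hsmul]
    exact gradient_convolution ho u hkd hks hψt
  refine ⟨w, hwsmooth, ?_, ?_⟩
  · calc eLpNorm (fun x => w x - h1Fun u x) 2 (volume.restrict Ω)
        = eLpNorm (fun x => (∫ z, U (x - z) ∂π) - U x) 2 (volume.restrict Ω) := by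
          refine eLpNorm_congr_ae ?_
          filter_upwards [ae_restrict_mem ho.measurableSet] with x hx
          rw [hwavg, hU, indicator_of_mem hx]
      _ ≤ _ := eLpNorm_mono_measure _ Measure.restrict_le_self
      _ ≤ ε := h₁ π hπp (hπs.mono fun z hz => hz.trans (min_le_left _ _)) (hint hUL)
  · calc eLpNorm (fun x => ∇ w x - h1Grad u x) 2 (volume.restrict (ball p η ∩ Ω))
        = eLpNorm (fun x => (∫ z, g (x - z) ∂π) - g x) 2 (volume.restrict (ball p η ∩ Ω)) := by
          refine eLpNorm_congr_ae ?_
          filter_upwards [ae_restrict_mem (measurableSet_ball.inter ho.measurableSet)] with x hx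
          rw [hgrad x hx, hg, indicator_of_mem hx.2]
      _ ≤ _ := eLpNorm_mono_measure _ Measure.restrict_le_self
      _ ≤ ε := h₂ π hπp (hπs.mono fun z hz => hz.trans (min_le_right _ _)) (hint hgL)

open scoped Manifold

theorem exists_smooth_partition {K : Set (EuclideanSpace ℝ (Fin n))} (hK : IsCompact K)
    (η : ∀ p ∈ K, ℝ) (hη : ∀ p hp, 0 < η p hp) :
    ∃ (t : Finset K) (χ : t → EuclideanSpace ℝ (Fin n) → ℝ), (∀ i, ContDiff ℝ ∞ (χ i)) ∧
      (∀ i x, |χ i x| ≤ 1) ∧ (∀ (i : t) x, x ∉ ball (i : EuclideanSpace ℝ (Fin n)) (η i.1 i.1.2) →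
        χ i x = 0) ∧ ∀ x ∈ K, ∑ i, χ i x = 1 := by
  obtain ⟨t, ht⟩ := hK.elim_nhds_subcover' (fun p hp => ball p (η p hp))
    fun p hp => ball_mem_nhds p (hη p hp)
  obtain ⟨f, hf⟩ := SmoothPartitionOfUnity.exists_isSubordinate
    𝓘(ℝ, EuclideanSpace ℝ (Fin n)) hK.isClosed
    (fun i : t => ball (i : EuclideanSpace ℝ (Fin n)) (η i.1 i.1.2)) (fun i => isOpen_ball)
    (fun x hx => by
      obtain ⟨i, hi, hxi⟩ := mem_iUnion₂.1 (ht hx)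
      exact mem_iUnion.2 ⟨⟨i, hi⟩, hxi⟩)
  refine ⟨t, fun i => f i, fun i => (f i).contMDiff.contDiff, fun i x => ?_, fun i x hx => ?_,
    fun x hx => ?_⟩
  · rw [abs_of_nonneg (f.nonneg i x)]; exact f.le_one i x
  · by_contra h
    exact hx (hf i (subset_tsupport _ h))
  · rw [← finsum_eq_sum_of_fintype]; exact f.sum_eq_one hx

theorem gradient_eq_toDual_symm (φ : EuclideanSpace ℝ (Fin n) → ℝ) (x : EuclideanSpace ℝ (Fin n)) :
    ∇ φ x = (InnerProductSpace.toDual ℝ (EuclideanSpace ℝ (Fin n))).symm (fderiv ℝ φ x) := rfl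

theorem continuous_gradient {φ : EuclideanSpace ℝ (Fin n) → ℝ} (hφ : ContDiff ℝ ∞ φ) :
    Continuous (∇ φ) :=
  (LinearIsometryEquiv.continuous _).comp (hφ.continuous_fderiv (by simp))

/-- Density of smooth functions on `ℝⁿ` in `H¹(Ω)`: glue the local approximations with a partition
of unity. In the gradient, the terms containing derivatives of the cut-offs only see the differences
`w i - u`, as those derivatives sum to zero on `Ω`. -/
theorem exists_smooth_approx (hΩ : HasLipschitzBoundary Ω) (ho : IsOpen Ω)
    (hb : Bornology.IsBounded Ω) (u : H1 Ω) {ε : ℝ≥0∞} (hε : ε ≠ 0) :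
    ∃ φ : EuclideanSpace ℝ (Fin n) → ℝ, ContDiff ℝ ∞ φ ∧
      eLpNorm (fun x => φ x - h1Fun u x) 2 (volume.restrict Ω) ≤ ε ∧
      eLpNorm (fun x => ∇ φ x - h1Grad u x) 2 (volume.restrict Ω) ≤ ε := by
  choose η hη hloc using fun p (hp : p ∈ closure Ω) => exists_local_approx hΩ ho hp
  obtain ⟨t, χ, hχ, hχ1, hχ0, hsum⟩ := exists_smooth_partition hb.isCompact_closure η hη
  have hbd : ∃ C : ℝ≥0, ∀ i : t, ∀ x ∈ Ω, ‖∇ (χ i) x‖ ≤ C := by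
    have h : ∀ i : t, ∃ C : ℝ≥0, ∀ x ∈ Ω, ‖∇ (χ i) x‖ ≤ C := fun i => by
      obtain ⟨C, hC⟩ := hb.isCompact_closure.exists_bound_of_continuousOn
        (continuous_gradient (hχ i)).continuousOn
      exact ⟨C.toNNReal, fun x hx => (hC x (subset_closure hx)).trans (Real.le_coe_toNNReal C)⟩
    choose C hC using h
    exact ⟨∑ i, C i, fun i x hx => (hC i x hx).trans
      (by exact_mod_cast Finset.single_le_sum (f := C) (fun j _ => zero_le) (Finset.mem_univ i))⟩
  obtain ⟨C, hC⟩ := hbd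
  set K : ℝ≥0∞ := ∑ _i : t, (1 + (C : ℝ≥0∞)) with hK
  have hKtop : K ≠ ⊤ := by simp [hK, ENNReal.mul_eq_top]
  have hε' : ε / K ≠ 0 := ENNReal.div_ne_zero.2 ⟨hε, hKtop⟩
  have hKε : K * (ε / K) ≤ ε := ENNReal.mul_div_le
  have hKε' : ∑ _i : t, (ε / K + C * (ε / K)) ≤ ε := by
    refine le_trans (le_of_eq ?_) hKε
    rw [hK, Finset.sum_mul]
    refine Finset.sum_congr rfl fun i _ => ?_
    ring
  choose w hw hwu hwg using fun i : t => hloc i.1 i.1.2 u (ε / K) hε'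
  have hwc : ∀ i, Continuous (w i) := fun i => (hw i).continuous
  have hχc : ∀ i, Continuous (χ i) := fun i => (hχ i).continuous
  have hum : AEStronglyMeasurable (h1Fun u) (volume.restrict Ω) := Lp.aestronglyMeasurable _
  have hgm : AEStronglyMeasurable (h1Grad u) (volume.restrict Ω) := Lp.aestronglyMeasurable _
  have hgrad : ∀ x, ∇ (fun x => ∑ i, χ i x * w i x) x =
      ∑ i, (χ i x • ∇ (w i) x + w i x • ∇ (χ i) x) := by
    intro x
    simp only [gradient_eq_toDual_symm]
    rw [fderiv_fun_sum (A := fun i x => χ i x * w i x) fun i _ =>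
      ((hχ i).differentiable (by simp) x).mul ((hw i).differentiable (by simp) x), map_sum]
    refine Finset.sum_congr rfl fun i _ => ?_
    rw [fderiv_fun_mul ((hχ i).differentiable (by simp) x) ((hw i).differentiable (by simp) x)]
    simp
  -- on `Ω` the cut-offs sum to one, so their gradients cancel
  have hsumgrad : ∀ x ∈ Ω, ∑ i, ∇ (χ i) x = 0 := by
    intro x hx
    have h1 : (fun y => ∑ i, χ i y) =ᶠ[𝓝 x] fun _ => 1 := by
      filter_upwards [ho.mem_nhds hx] with y hy using hsum y (subset_closure hy)
    have h2 := h1.fderiv_eq (𝕜 := ℝ)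
    rw [fderiv_fun_sum fun i _ => (hχ i).differentiable (by simp) x, fderiv_fun_const] at h2
    simp only [gradient_eq_toDual_symm]
    rw [← map_sum, h2]
    simp
  refine ⟨fun x => ∑ i, χ i x * w i x, ContDiff.sum fun i _ => (hχ i).mul (hw i), ?_, ?_⟩
  · calc eLpNorm (fun x => ∑ i, χ i x * w i x - h1Fun u x) 2 (volume.restrict Ω)
        = eLpNorm (∑ i, fun x => χ i x * (w i x - h1Fun u x)) 2 (volume.restrict Ω) := by
          refine eLpNorm_congr_ae ?_
          filter_upwards [ae_restrict_mem ho.measurableSet] with x hx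
          rw [Finset.sum_apply]
          simp only [mul_sub]
          rw [Finset.sum_sub_distrib, ← Finset.sum_mul, hsum x (subset_closure hx), one_mul]
      _ ≤ ∑ i, eLpNorm (fun x => χ i x * (w i x - h1Fun u x)) 2 (volume.restrict Ω) :=
          eLpNorm_sum_le (fun i _ => (hχc i).aestronglyMeasurable.mul
            ((hwc i).aestronglyMeasurable.sub hum)) (by norm_num)
      _ ≤ ∑ _i : t, (ε / K + C * (ε / K)) := by
          refine Finset.sum_le_sum fun i _ => ?_
          refine (eLpNorm_mono fun x => ?_).trans ((hwu i).trans le_self_add)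
          rw [norm_mul]
          exact mul_le_of_le_one_left (norm_nonneg _) (hχ1 i x)
      _ ≤ ε := hKε'
  · have hgc : ∀ i, AEStronglyMeasurable (fun x => χ i x • (∇ (w i) x - h1Grad u x))
        (volume.restrict Ω) := fun i => (hχc i).aestronglyMeasurable.smul
          ((continuous_gradient (hw i)).aestronglyMeasurable.sub hgm)
    have huc : ∀ i, AEStronglyMeasurable (fun x => (w i x - h1Fun u x) • ∇ (χ i) x)
        (volume.restrict Ω) := fun i => ((hwc i).aestronglyMeasurable.sub hum).smul
          (continuous_gradient (hχ i)).aestronglyMeasurable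
    calc eLpNorm (fun x => ∇ (fun x => ∑ i, χ i x * w i x) x - h1Grad u x) 2 (volume.restrict Ω)
        = eLpNorm (∑ i, ((fun x => χ i x • (∇ (w i) x - h1Grad u x)) +
            fun x => (w i x - h1Fun u x) • ∇ (χ i) x)) 2 (volume.restrict Ω) := by
          refine eLpNorm_congr_ae ?_
          filter_upwards [ae_restrict_mem ho.measurableSet] with x hx
          rw [Finset.sum_apply, hgrad]
          simp only [Pi.add_apply, smul_sub, sub_smul]
          simp only [Finset.sum_add_distrib, Finset.sum_sub_distrib]
          rw [← Finset.smul_sum, hsumgrad x hx, ← Finset.sum_smul, hsum x (subset_closure hx),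
            one_smul, smul_zero, sub_zero]
          abel
      _ ≤ ∑ i, eLpNorm ((fun x => χ i x • (∇ (w i) x - h1Grad u x)) +
            fun x => (w i x - h1Fun u x) • ∇ (χ i) x) 2 (volume.restrict Ω) :=
          eLpNorm_sum_le (fun i _ => (hgc i).add (huc i)) (by norm_num)
      _ ≤ ∑ _i : t, (ε / K + C * (ε / K)) := by
          refine Finset.sum_le_sum fun i _ => (eLpNorm_add_le (hgc i) (huc i)
            (by norm_num)).trans (add_le_add ?_ ?_)
          · calc eLpNorm (fun x => χ i x • (∇ (w i) x - h1Grad u x)) 2 (volume.restrict Ω)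
                ≤ eLpNorm ((ball (i : EuclideanSpace ℝ (Fin n)) (η i.1 i.1.2)).indicator
                    fun x => ∇ (w i) x - h1Grad u x) 2 (volume.restrict Ω) := by
                  refine eLpNorm_mono fun x => ?_
                  by_cases hx : x ∈ ball (i : EuclideanSpace ℝ (Fin n)) (η i.1 i.1.2)
                  · rw [indicator_of_mem hx, norm_smul]
                    exact mul_le_of_le_one_left (norm_nonneg _) (hχ1 i x)
                  · rw [hχ0 i x hx, zero_smul, norm_zero]
                    exact norm_nonneg _
              _ ≤ ε / K := by
                  rw [eLpNorm_indicator_eq_eLpNorm_restrict measurableSet_ball,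
                    Measure.restrict_restrict measurableSet_ball]
                  exact hwg i
          · have h := eLpNorm_le_mul_eLpNorm_of_ae_le_mul (p := 2) (μ := volume.restrict Ω)
              (f := fun x => (w i x - h1Fun u x) • ∇ (χ i) x)
              (g := fun x => w i x - h1Fun u x) (c := C) (by
                filter_upwards [ae_restrict_mem ho.measurableSet] with x hx
                rw [norm_smul, mul_comm]
                exact mul_le_mul_of_nonneg_right (hC i x hx) (norm_nonneg _))
            rw [ENNReal.ofReal_coe_nnreal] at h
            refine h.trans ?_
            gcongr
            exact hwu i
      _ ≤ ε := hKε'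

theorem isWeakGradient_of_contDiff {φ : EuclideanSpace ℝ (Fin n) → ℝ}
    (hφ : ContDiff ℝ ∞ φ) : IsWeakGradient Ω φ (∇ φ) := by
  intro ψ hψ hc hs v
  have hz : ∀ x, x ∉ Ω → ψ x = 0 := fun x hx => by
    by_contra h; exact hx (hs (subset_tsupport _ h))
  have hz' : ∀ x, x ∉ Ω → fderiv ℝ ψ x v = 0 := fun x hx => by
    have : fderiv ℝ ψ x = 0 := by
      by_contra h
      exact hx (hs (tsupport_fderiv_subset ℝ (subset_tsupport _ h)))
    rw [this]; rfl
  have hcd : HasCompactSupport fun x => fderiv ℝ ψ x v := hc.fderiv_apply (𝕜 := ℝ) v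
  have hψc : Continuous fun x => fderiv ℝ ψ x v :=
    (hψ.continuous_fderiv (by simp)).clm_apply continuous_const
  have hφc : Continuous fun x => fderiv ℝ φ x v :=
    (hφ.continuous_fderiv (by simp)).clm_apply continuous_const
  have key := integral_mul_fderiv_eq_neg_fderiv_mul_of_integrable (μ := volume) (f := φ) (g := ψ)
    (v := v)
    ((hφc.mul hψ.continuous).integrable_of_hasCompactSupport hc.mul_left)
    ((hφ.continuous.mul hψc).integrable_of_hasCompactSupport hcd.mul_left)
    ((hφ.continuous.mul hψ.continuous).integrable_of_hasCompactSupport hc.mul_left)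
    (fun x _ => hφ.differentiable (by simp) x) (fun x _ => hψ.differentiable (by simp) x)
  rw [setIntegral_eq_integral_of_forall_compl_eq_zero fun x hx => by rw [hz' x hx, mul_zero],
    setIntegral_eq_integral_of_forall_compl_eq_zero fun x hx => by rw [hz x hx, mul_zero], key]
  simp only [gradient_eq_toDual_symm, InnerProductSpace.toDual_symm_apply]

theorem IsWeakGradient.congr_ae {u u' : EuclideanSpace ℝ (Fin n) → ℝ}
    {g g' : EuclideanSpace ℝ (Fin n) → EuclideanSpace ℝ (Fin n)} (h : IsWeakGradient Ω u g)
    (hu : u' =ᵐ[volume.restrict Ω] u) (hg : g' =ᵐ[volume.restrict Ω] g) :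
    IsWeakGradient Ω u' g' := by
  intro φ hφ hc hs v
  have h1 : ∫ x in Ω, u' x * fderiv ℝ φ x v = ∫ x in Ω, u x * fderiv ℝ φ x v :=
    integral_congr_ae (by filter_upwards [hu] with x hx; rw [hx])
  have h2 : ∫ x in Ω, ⟪g' x, v⟫_ℝ * φ x = ∫ x in Ω, ⟪g x, v⟫_ℝ * φ x :=
    integral_congr_ae (by filter_upwards [hg] with x hx; rw [hx])
  rw [h1, h2]
  exact h φ hφ hc hs v

/-- The restrictions of a smooth function to `Ω` and `∂Ω`, as an element of the trace graph. -/
theorem exists_mem_smoothTraceGraph (ho : IsOpen Ω) (hb : Bornology.IsBounded Ω)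
    (hfin : surfaceMeasure Ω univ < ⊤) {φ : EuclideanSpace ℝ (Fin n) → ℝ} (hφ : ContDiff ℝ ∞ φ) :
    ∃ q ∈ smoothTraceGraph Ω, h1Fun q.1 =ᵐ[volume.restrict Ω] φ ∧
      h1Grad q.1 =ᵐ[volume.restrict Ω] ∇ φ ∧ q.2 =ᵐ[surfaceMeasure Ω] φ := by
  have : IsFiniteMeasure (surfaceMeasure Ω) := ⟨hfin⟩
  have : IsFiniteMeasure (volume.restrict Ω) := ⟨by
    rw [Measure.restrict_apply_univ]; exact hb.measure_lt_top⟩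
  obtain ⟨C, hC⟩ := hb.isCompact_closure.exists_bound_of_continuousOn hφ.continuous.continuousOn
  obtain ⟨D, hD⟩ := hb.isCompact_closure.exists_bound_of_continuousOn
    (continuous_gradient hφ).continuousOn
  have h1 : MemLp φ 2 (volume.restrict Ω) := by
    refine MemLp.of_bound hφ.continuous.aestronglyMeasurable C ?_
    filter_upwards [ae_restrict_mem ho.measurableSet] with x hx using hC x (subset_closure hx)
  have h2 : MemLp (∇ φ) 2 (volume.restrict Ω) := by
    refine MemLp.of_bound (continuous_gradient hφ).aestronglyMeasurable D ?_
    filter_upwards [ae_restrict_mem ho.measurableSet] with x hx using hD x (subset_closure hx)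
  have h3 : MemLp φ 2 (surfaceMeasure Ω) := by
    refine MemLp.of_bound hφ.continuous.aestronglyMeasurable C ?_
    filter_upwards [ae_restrict_mem isClosed_frontier.measurableSet] with x hx
      using hC x (frontier_subset_closure hx)
  let w : H1 Ω := ⟨WithLp.toLp 2 (h1.toLp, h2.toLp),
    (isWeakGradient_of_contDiff hφ).congr_ae h1.coeFn_toLp h2.coeFn_toLp⟩
  exact ⟨(w, h3.toLp), ⟨φ, hφ, h1.coeFn_toLp, h2.coeFn_toLp, h3.coeFn_toLp⟩, h1.coeFn_toLp,
    h2.coeFn_toLp, h3.coeFn_toLp⟩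

/-! ### The trace operator -/

/-- `v ↦ v`, as a bounded operator `H¹(Ω) → L²(Ω)`. -/
def h1FunL (Ω : Set (EuclideanSpace ℝ (Fin n))) : H1 Ω →L[ℝ] Lp ℝ 2 (volume.restrict Ω) :=
  (WithLp.fstL 2 ℝ _ _).comp (H1 Ω).subtypeL

/-- `v ↦ ∇v`, as a bounded operator `H¹(Ω) → L²(Ω)ⁿ`. -/
def h1GradL (Ω : Set (EuclideanSpace ℝ (Fin n))) :
    H1 Ω →L[ℝ] Lp (EuclideanSpace ℝ (Fin n)) 2 (volume.restrict Ω) :=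
  (WithLp.sndL 2 ℝ _ _).comp (H1 Ω).subtypeL

theorem h1GradL_apply (v : H1 Ω) : h1GradL Ω v = h1Grad v := rfl

theorem norm_sq_h1 (v : H1 Ω) : ‖v‖ ^ 2 = ‖h1Fun v‖ ^ 2 + ‖h1Grad v‖ ^ 2 := by
  rw [Submodule.coe_norm, WithLp.prod_norm_sq_eq_of_L2]
  rfl

/-- Each test function turns the weak gradient condition into a closed linear condition. -/
theorem isClosed_h1 : IsClosed (H1 Ω : Set (WithLp 2 (Lp ℝ 2 (volume.restrict Ω) ×
      Lp (EuclideanSpace ℝ (Fin n)) 2 (volume.restrict Ω)))) := by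
  have hset : (H1 Ω : Set (WithLp 2 (Lp ℝ 2 (volume.restrict Ω) ×
      Lp (EuclideanSpace ℝ (Fin n)) 2 (volume.restrict Ω)))) =
      ⋂ (φ : EuclideanSpace ℝ (Fin n) → ℝ) (_ : ContDiff ℝ ∞ φ) (_ : HasCompactSupport φ)
        (_ : tsupport φ ⊆ Ω) (v : EuclideanSpace ℝ (Fin n)),
        {w | ∫ x in Ω, w.fst x * fderiv ℝ φ x v = -∫ x in Ω, ⟪w.snd x, v⟫_ℝ * φ x} := by
    ext w
    simp only [mem_iInter]
    rfl
  rw [hset]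
  refine isClosed_iInter fun φ => isClosed_iInter fun hφ => isClosed_iInter fun hc =>
    isClosed_iInter fun hs => isClosed_iInter fun v => ?_
  -- both sides are inner products with fixed elements of `L²`
  have h1 : MemLp (fun x => fderiv ℝ φ x v) 2 (volume.restrict Ω) :=
    (((hφ.continuous_fderiv (by simp)).clm_apply continuous_const).memLp_of_hasCompactSupport
      (hc.fderiv_apply (𝕜 := ℝ) v)).restrict Ω
  have h2 : MemLp (fun x => φ x • v) 2 (volume.restrict Ω) :=
    ((hφ.continuous.smul continuous_const).memLp_of_hasCompactSupport hc.smul_right).restrict Ω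
  have e1 : ∀ w : Lp ℝ 2 (volume.restrict Ω),
      ∫ x in Ω, w x * fderiv ℝ φ x v = ⟪h1.toLp, w⟫_ℝ := by
    intro w
    rw [L2.inner_def]
    refine integral_congr_ae ?_
    filter_upwards [h1.coeFn_toLp] with x hx
    rw [hx]
    simp
  have e2 : ∀ w : Lp (EuclideanSpace ℝ (Fin n)) 2 (volume.restrict Ω),
      ∫ x in Ω, ⟪w x, v⟫_ℝ * φ x = ⟪h2.toLp, w⟫_ℝ := by
    intro w
    rw [L2.inner_def]
    refine integral_congr_ae ?_
    filter_upwards [h2.coeFn_toLp] with x hx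
    rw [hx, real_inner_smul_left, real_inner_comm, mul_comm]
  simp only [e1, e2]
  exact isClosed_eq (continuous_const.inner (WithLp.fstL 2 ℝ _ _).continuous)
    (continuous_const.inner (WithLp.sndL 2 ℝ _ _).continuous).neg

instance : CompleteSpace (H1 Ω) := isClosed_h1.completeSpace_coe

theorem lintegral_enorm_sq {α F : Type*} [MeasurableSpace α] [NormedAddCommGroup F]
    {μ : Measure α} (f : Lp F 2 μ) : ∫⁻ x, ‖f x‖ₑ ^ 2 ∂μ = ENNReal.ofReal (‖f‖ ^ 2) := by
  rw [← eLpNorm_two_sq, ← Lp.enorm_def, ENNReal.ofReal_pow (norm_nonneg _), ofReal_norm]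

theorem lintegral_enorm_sq_of_ae {α F : Type*} [MeasurableSpace α] [NormedAddCommGroup F]
    {μ : Measure α} (f : Lp F 2 μ) {g : α → F} (h : f =ᵐ[μ] g) :
    ∫⁻ x, ‖g x‖ₑ ^ 2 ∂μ = ENNReal.ofReal (‖f‖ ^ 2) := by
  rw [← lintegral_enorm_sq]
  refine lintegral_congr_ae ?_
  filter_upwards [h] with x hx
  rw [hx]

theorem enorm_fderiv_eq (φ : EuclideanSpace ℝ (Fin n) → ℝ) (x : EuclideanSpace ℝ (Fin n)) :
    ‖fderiv ℝ φ x‖ₑ = ‖∇ φ x‖ₑ := by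
  rw [gradient_eq_toDual_symm, LinearIsometryEquiv.enorm_map]

theorem le_toReal_mul_of_ofReal_le {a b : ℝ} {C : ℝ≥0∞} (hC : C ≠ ⊤) (hb : 0 ≤ b)
    (h : ENNReal.ofReal a ≤ C * ENNReal.ofReal b) : a ≤ C.toReal * b := by
  rw [← ENNReal.ofReal_toReal hC, ← ENNReal.ofReal_mul ENNReal.toReal_nonneg] at h
  exact (ENNReal.ofReal_le_ofReal_iff (by positivity)).1 h

/-- The trace inequality passes from smooth functions to the closure of their trace graph. -/
theorem exists_traceGraph_bound (hΩ : HasLipschitzBoundary Ω) (ho : IsOpen Ω)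
    (hb : Bornology.IsBounded Ω) :
    ∃ C : ℝ, 0 ≤ C ∧ ∀ q ∈ traceGraph Ω, ‖q.2‖ ≤ C * ‖q.1‖ := by
  obtain ⟨C, hC, h⟩ := (exists_trace_bound hΩ ho hb).2
  refine ⟨√C.toReal, Real.sqrt_nonneg _, ?_⟩
  have hcl : IsClosed {q : H1 Ω × Lp ℝ 2 (surfaceMeasure Ω) | ‖q.2‖ ≤ √C.toReal * ‖q.1‖} :=
    isClosed_le continuous_snd.norm (continuous_const.mul continuous_fst.norm)
  intro q hq
  rw [traceGraph, ← SetLike.mem_coe, Submodule.topologicalClosure_coe] at hq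
  refine closure_minimal ?_ hcl hq
  rintro q ⟨φ, hφ, h1, h2, h3⟩
  have key := h φ (hφ.of_le (by simp))
  simp_rw [enorm_fderiv_eq] at key
  rw [lintegral_enorm_sq_of_ae q.2 h3, lintegral_enorm_sq_of_ae (h1Fun q.1) h1,
    lintegral_enorm_sq_of_ae (h1Grad q.1) h2,
    ← ENNReal.ofReal_add (by positivity) (by positivity), ← norm_sq_h1] at key
  have key' := le_toReal_mul_of_ofReal_le hC (by positivity) key
  have := Real.sqrt_le_sqrt key'
  rwa [Real.sqrt_sq (norm_nonneg _), Real.sqrt_mul ENNReal.toReal_nonneg,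
    Real.sqrt_sq (norm_nonneg _)] at this

/-- The Poincaré inequality passes from smooth functions to the closure of their trace graph. -/
theorem exists_traceGraph_poincare (hΩ : HasLipschitzBoundary Ω) (ho : IsOpen Ω)
    (hb : Bornology.IsBounded Ω) (hconn : IsPreconnected Ω)
    {E : Set (EuclideanSpace ℝ (Fin n))} (hE : ∃ O, IsOpen O ∧ E = O ∩ frontier Ω)
    (hne : E.Nonempty) :
    ∃ C : ℝ, 0 ≤ C ∧ ∀ q ∈ traceGraph Ω, ‖h1Fun q.1‖ ^ 2 ≤
      C * (‖LpToLpRestrictCLM _ ℝ ℝ (surfaceMeasure Ω) 2 E q.2‖ ^ 2 + ‖h1Grad q.1‖ ^ 2) := by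
  obtain ⟨O, hO, rfl⟩ := hE
  obtain ⟨p, hpO, hp⟩ := hne
  obtain ⟨C, hC, h⟩ := exists_poincare hΩ ho hb hconn hp (hO.mem_nhds hpO)
  refine ⟨C.toReal, ENNReal.toReal_nonneg, ?_⟩
  have hcl : IsClosed {q : H1 Ω × Lp ℝ 2 (surfaceMeasure Ω) | ‖h1Fun q.1‖ ^ 2 ≤ C.toReal *
      (‖LpToLpRestrictCLM _ ℝ ℝ (surfaceMeasure Ω) 2 (O ∩ frontier Ω) q.2‖ ^ 2 +
        ‖h1Grad q.1‖ ^ 2)} :=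
    isClosed_le (((h1FunL Ω).continuous.comp continuous_fst).norm.pow 2)
      (continuous_const.mul ((((ContinuousLinearMap.continuous _).comp continuous_snd).norm.pow 2).add
        (((h1GradL Ω).continuous.comp continuous_fst).norm.pow 2)))
  intro q hq
  rw [traceGraph, ← SetLike.mem_coe, Submodule.topologicalClosure_coe] at hq
  refine closure_minimal ?_ hcl hq
  rintro q ⟨φ, hφ, h1, h2, h3⟩
  have key := h φ (hφ.of_le (by simp))
  have hr : (surfaceMeasure Ω).restrict O = (surfaceMeasure Ω).restrict (O ∩ frontier Ω) := by
    rw [surfaceMeasure, Measure.restrict_restrict hO.measurableSet, Measure.restrict_restrict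
      (hO.measurableSet.inter isClosed_frontier.measurableSet), inter_assoc, inter_self]
  have h4 := (LpToLpRestrictCLM_coeFn ℝ (O ∩ frontier Ω) q.2).trans (ae_restrict_of_ae h3)
  simp_rw [enorm_fderiv_eq] at key
  rw [hr, lintegral_enorm_sq_of_ae _ h4, lintegral_enorm_sq_of_ae (h1Fun q.1) h1,
    lintegral_enorm_sq_of_ae (h1Grad q.1) h2,
    ← ENNReal.ofReal_add (by positivity) (by positivity)] at key
  exact le_toReal_mul_of_ofReal_le hC (by positivity) key

/-- A nonempty relatively open part of `∂Ω` has positive measure: otherwise the Poincaré inequality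
for the constant `1` would give `|Ω| = 0`. -/
theorem surfaceMeasure_pos (hΩ : HasLipschitzBoundary Ω) (ho : IsOpen Ω)
    (hb : Bornology.IsBounded Ω) (hne : Ω.Nonempty) (hconn : IsPreconnected Ω)
    {E : Set (EuclideanSpace ℝ (Fin n))} (hE : ∃ O, IsOpen O ∧ E = O ∩ frontier Ω)
    (hEne : E.Nonempty) : surfaceMeasure Ω E ≠ 0 := by
  obtain ⟨O, hO, rfl⟩ := hE
  obtain ⟨p, hpO, hp⟩ := hEne
  obtain ⟨C, hC, h⟩ := exists_poincare hΩ ho hb hconn hp (hO.mem_nhds hpO)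
  have key := h (fun _ => 1) contDiff_const
  intro h0
  have h1 : surfaceMeasure Ω O = 0 := by
    rw [surfaceMeasure, Measure.restrict_apply
      (hO.measurableSet.inter isClosed_frontier.measurableSet), inter_assoc, inter_self] at h0
    rw [surfaceMeasure, Measure.restrict_apply hO.measurableSet, h0]
  have h2 : (volume.restrict Ω) univ ≤ 0 := by
    have h3 : ∀ x : EuclideanSpace ℝ (Fin n),
        ‖fderiv ℝ (fun _ : EuclideanSpace ℝ (Fin n) => (1 : ℝ)) x‖ₑ ^ 2 = 0 := fun x => by
      rw [enorm_fderiv_eq, gradient_fun_const, enorm_zero, zero_pow two_ne_zero]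
    simpa only [h3, Measure.restrict_eq_zero.2 h1, lintegral_zero_measure, lintegral_zero, add_zero,
      mul_zero, enorm_one, one_pow, lintegral_one, Measure.coe_zero, Pi.zero_apply] using key
  rw [Measure.restrict_apply_univ] at h2
  exact (ho.measure_pos volume hne).ne' (le_antisymm h2 zero_le)

/-- A closed linear relation with dense domain that satisfies a bound `‖y‖ ≤ C ‖x‖` is the graph of
a bounded operator. -/
theorem exists_clm_of_graph {X Y : Type*} [NormedAddCommGroup X] [NormedSpace ℝ X]
    [CompleteSpace X] [NormedAddCommGroup Y] [NormedSpace ℝ Y] [CompleteSpace Y]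
    (G : Submodule ℝ (X × Y)) (hG : IsClosed (G : Set (X × Y))) {C : ℝ} (hC : 0 ≤ C)
    (hbd : ∀ q ∈ G, ‖q.2‖ ≤ C * ‖q.1‖) (hd : ∀ v, ∀ ε > 0, ∃ q ∈ G, ‖q.1 - v‖ < ε) :
    ∃ T : X →L[ℝ] Y, ∀ v g, (v, g) ∈ G ↔ g = T v := by
  have : CompleteSpace G := hG.completeSpace_coe
  have hanti : AntilipschitzWith (max 1 C.toNNReal) fun q : G => q.1.1 := by
    refine AddMonoidHomClass.antilipschitz_of_bound
      ((LinearMap.fst ℝ X Y).comp G.subtype) fun q => ?_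
    change ‖q.1‖ ≤ _ * ‖q.1.1‖
    rw [Prod.norm_def, NNReal.coe_max, NNReal.coe_one, Real.coe_toNNReal _ hC]
    refine max_le ?_ ((hbd q.1 q.2).trans ?_)
    · exact le_mul_of_one_le_left (norm_nonneg _) (le_max_left _ _)
    · exact mul_le_mul_of_nonneg_right (le_max_right _ _) (norm_nonneg _)
  have hrange : IsClosed (range fun q : G => q.1.1) :=
    hanti.isClosed_range (uniformContinuous_fst.comp uniformContinuous_subtype_val)
  have hex : ∀ v, ∃ g, (v, g) ∈ G := fun v => by
    have hdense : v ∈ closure (range fun q : G => q.1.1) := by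
      refine Metric.mem_closure_iff.2 fun ε hε => ?_
      obtain ⟨q, hq, h⟩ := hd v ε hε
      exact ⟨q.1, ⟨⟨q, hq⟩, rfl⟩, by rwa [dist_comm, dist_eq_norm]⟩
    rw [hrange.closure_eq] at hdense
    obtain ⟨q, rfl⟩ := hdense
    exact ⟨q.1.2, q.2⟩
  choose T hT using hex
  have huniq : ∀ v g, (v, g) ∈ G → g = T v := fun v g hg => by
    have h0 := hbd _ (G.sub_mem hg (hT v))
    simpa [sub_eq_zero] using h0
  let T' : X →ₗ[ℝ] Y :=
    { toFun := T
      map_add' := fun v w => (huniq _ _ (G.add_mem (hT v) (hT w))).symm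
      map_smul' := fun c v => (huniq _ _ (G.smul_mem c (hT v))).symm }
  refine ⟨T'.mkContinuous C fun v => hbd _ (hT v), fun v g => ⟨huniq v g, ?_⟩⟩
  rintro rfl
  exact hT v

theorem norm_sub_le_of_eLpNorm_le {α F : Type*} [MeasurableSpace α] [NormedAddCommGroup F]
    {μ : Measure α} {f g : Lp F 2 μ} {φ : α → F} (hf : f =ᵐ[μ] φ) {ε : ℝ} (hε : 0 ≤ ε)
    (h : eLpNorm (fun x => φ x - g x) 2 μ ≤ ENNReal.ofReal ε) : ‖f - g‖ ≤ ε := by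
  rw [← ENNReal.ofReal_le_ofReal_iff hε, ofReal_norm, Lp.enorm_def]
  refine le_trans (le_of_eq (eLpNorm_congr_ae ?_)) h
  filter_upwards [Lp.coeFn_sub f g, hf] with x hx hx'
  rw [hx, Pi.sub_apply, hx']

theorem norm_h1_le (v : H1 Ω) : ‖v‖ ≤ ‖h1Fun v‖ + ‖h1Grad v‖ := by
  refine le_of_sq_le_sq ?_ (by positivity)
  rw [norm_sq_h1]
  nlinarith [norm_nonneg (h1Fun v), norm_nonneg (h1Grad v)]

theorem exists_mem_smoothTraceGraph_near (hΩ : HasLipschitzBoundary Ω) (ho : IsOpen Ω)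
    (hb : Bornology.IsBounded Ω) (v : H1 Ω) {ε : ℝ} (hε : 0 < ε) :
    ∃ q ∈ smoothTraceGraph Ω, ‖q.1 - v‖ < ε := by
  have hfin := (exists_trace_bound hΩ ho hb).1
  have hε3 : 0 < ε / 3 := by positivity
  obtain ⟨φ, h⟩ := exists_smooth_approx hΩ ho hb v (ENNReal.ofReal_pos.2 hε3).ne'
  refine (exists_mem_smoothTraceGraph ho hb hfin h.1).imp fun q hq => ⟨hq.1, ?_⟩
  refine (norm_h1_le _).trans_lt (lt_of_le_of_lt (b := ε / 3 + ε / 3) ?_ (by linarith))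
  exact add_le_add (norm_sub_le_of_eLpNorm_le hq.2.1 hε3.le h.2.1)
    (norm_sub_le_of_eLpNorm_le hq.2.2.1 hε3.le h.2.2)

theorem mem_traceGraph_trace {v : H1 Ω} (h : ∃ g, (v, g) ∈ traceGraph Ω) :
    (v, trace v) ∈ traceGraph Ω := by
  have e : trace v = h.choose := dif_pos h
  rw [e]
  exact h.choose_spec

/-- The trace is a bounded linear operator `H¹(Ω) → L²(∂Ω)`. -/
theorem exists_traceOp (hΩ : HasLipschitzBoundary Ω) (ho : IsOpen Ω)
    (hb : Bornology.IsBounded Ω) :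
    ∃ T : H1 Ω →L[ℝ] Lp ℝ 2 (surfaceMeasure Ω),
      (∀ v, trace v = T v) ∧ ∀ v g, (v, g) ∈ traceGraph Ω ↔ g = T v := by
  obtain ⟨C, h⟩ := exists_traceGraph_bound hΩ ho hb
  have hd : ∀ v : H1 Ω, ∀ ε > 0, ∃ q ∈ traceGraph Ω, ‖q.1 - v‖ < ε := fun v ε hε =>
    (exists_mem_smoothTraceGraph_near hΩ ho hb v hε).imp fun q hq =>
      ⟨Submodule.le_topologicalClosure _ hq.1, hq.2⟩
  have hex : ∃ T : H1 Ω →L[ℝ] Lp ℝ 2 (surfaceMeasure Ω),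
      ∀ v g, (v, g) ∈ traceGraph Ω ↔ g = T v :=
    exists_clm_of_graph (traceGraph Ω) (Submodule.isClosed_topologicalClosure _) h.1 h.2 hd
  exact hex.imp fun T hT => ⟨fun v => (hT v (trace v)).1
    (mem_traceGraph_trace ⟨T v, (hT v (T v)).2 rfl⟩), hT⟩

/-! ### Penalised coercive problems in Hilbert space -/

section Penalty

variable {V : Type*} [NormedAddCommGroup V] [InnerProductSpace ℝ V]

/-- The bounded bilinear form `(v, w) ↦ ⟪J v, J w⟫`. -/
def innerComp {Y : Type*} [NormedAddCommGroup Y] [InnerProductSpace ℝ Y] (J : V →L[ℝ] Y) :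
    V →L[ℝ] V →L[ℝ] ℝ :=
  LinearMap.mkContinuous₂
    (LinearMap.mk₂ ℝ (fun v w => ⟪J v, J w⟫_ℝ)
      (fun v v' w => by rw [map_add, inner_add_left])
      (fun c v w => by rw [map_smul, real_inner_smul_left, smul_eq_mul])
      (fun v w w' => by rw [map_add, inner_add_right])
      (fun c v w => by rw [map_smul, real_inner_smul_right, smul_eq_mul]))
    (‖J‖ * ‖J‖) (fun v w => by
      refine (norm_inner_le_norm (𝕜 := ℝ) (J v) (J w)).trans ?_
      calc ‖J v‖ * ‖J w‖ ≤ (‖J‖ * ‖v‖) * (‖J‖ * ‖w‖) := by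
            gcongr <;> exact J.le_opNorm _
        _ = ‖J‖ * ‖J‖ * ‖v‖ * ‖w‖ := by ring)

theorem innerComp_apply {Y : Type*} [NormedAddCommGroup Y] [InnerProductSpace ℝ Y] (J : V →L[ℝ] Y)
    (v w : V) : innerComp J v w = ⟪J v, J w⟫_ℝ := rfl

variable [CompleteSpace V]

/-- The Lax–Milgram theorem for functionals. -/
theorem existsUnique_of_isCoercive {B : V →L[ℝ] V →L[ℝ] ℝ} (hB : IsCoercive B) (φ : V →L[ℝ] ℝ) :
    ∃! u, ∀ w, B u w = φ w := by
  set r := (InnerProductSpace.toDual ℝ V).symm φ with hr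
  have hφ : ∀ w, ⟪r, w⟫_ℝ = φ w := fun w => InnerProductSpace.toDual_symm_apply
  refine ⟨hB.continuousLinearEquivOfBilin.symm r, fun w => ?_, fun u hu => ?_⟩
  · rw [← hB.continuousLinearEquivOfBilin_apply, ContinuousLinearEquiv.apply_symm_apply, hφ]
  · rw [ContinuousLinearEquiv.eq_symm_apply]
    refine ext_inner_right ℝ fun w => ?_
    rw [hB.continuousLinearEquivOfBilin_apply, hu, hφ]

/-- A functional vanishing on `⋂ ker J_m` is approximated by functionals
`d ↦ ∑ ⟪J_m y, J_m d⟫`, since these form the range of the adjoint of an operator with that kernel.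
-/
theorem exists_approx_of_vanish {ι : Type*} [Fintype ι] {Y : ι → Type*}
    [∀ m, NormedAddCommGroup (Y m)] [∀ m, InnerProductSpace ℝ (Y m)] [∀ m, CompleteSpace (Y m)]
    (J : ∀ m, V →L[ℝ] Y m) (ψ : V →L[ℝ] ℝ) (hψ : ∀ v, (∀ m, J m v = 0) → ψ v = 0)
    {ε : ℝ} (hε : 0 < ε) :
    ∃ y, ∀ d, |ψ d - ∑ m, ⟪J m y, J m d⟫_ℝ| ≤ ε * ‖d‖ := by
  let B : V →L[ℝ] V := ∑ m, (ContinuousLinearMap.adjoint (J m)).comp (J m)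
  have hB : ∀ y d, ⟪y, B d⟫_ℝ = ∑ m, ⟪J m y, J m d⟫_ℝ := by
    intro y d
    simp [B, inner_sum, ContinuousLinearMap.adjoint_inner_right]
  set r := (InnerProductSpace.toDual ℝ V).symm ψ with hr
  have hrψ : ∀ w, ⟪r, w⟫_ℝ = ψ w := fun w => InnerProductSpace.toDual_symm_apply
  have hmem : r ∈ (LinearMap.ker (B : V →ₗ[ℝ] V))ᗮ := by
    rw [Submodule.mem_orthogonal']
    intro d hd
    rw [hrψ]
    refine hψ d fun m => ?_
    have h0 : ∑ m, ⟪J m d, J m d⟫_ℝ = 0 := by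
      rw [← hB, show B d = 0 from hd, inner_zero_right]
    have h1 := (Finset.sum_eq_zero_iff_of_nonneg fun m _ => real_inner_self_nonneg).1 h0 m
      (Finset.mem_univ m)
    exact inner_self_eq_zero.1 h1
  rw [ContinuousLinearMap.orthogonal_ker] at hmem
  obtain ⟨-, ⟨y, rfl⟩, hy⟩ := Metric.mem_closure_iff.1 hmem ε hε
  refine ⟨y, fun d => ?_⟩
  rw [← hB, ← hrψ, ← ContinuousLinearMap.adjoint_inner_left, ← inner_sub_left]
  rw [dist_eq_norm] at hy
  exact (abs_real_inner_le_norm _ _).trans (mul_le_mul_of_nonneg_right hy.le (norm_nonneg _))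

/-- The solutions of the problems with form `a + ∑ z_m⁻¹ ⟪J_m ·, J_m ·⟫` converge, as `z → 0`, to
the solution of the problem with form `a` constrained to `⋂ ker J_m`. Testing with the error `d = U
z - U₀` gives `c ‖d‖² ≤ ψ d` for `ψ = φ - a U₀`, a functional that vanishes on `⋂ ker J_m`. So `d`
is bounded, the penalty forces `J_m d → 0`, and approximating `ψ` by functionals of the `J_m` gives
`ψ d → 0`. -/
theorem penalty_limit {ι : Type*} [Fintype ι] {Y : ι → Type*}
    [∀ m, NormedAddCommGroup (Y m)] [∀ m, InnerProductSpace ℝ (Y m)] [∀ m, CompleteSpace (Y m)]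
    (J : ∀ m, V →L[ℝ] Y m) (a : V →L[ℝ] V →L[ℝ] ℝ) (ha : ∀ v, 0 ≤ a v v) {c : ℝ} (hc : 0 < c)
    (hcoer : ∀ v, c * ‖v‖ ^ 2 ≤ a v v + ∑ m, ‖J m v‖ ^ 2) (φ : V →L[ℝ] ℝ) :
    ∃ (U : (ι → ℝ) → V) (U₀ : V), (∀ m, J m U₀ = 0) ∧
      (∀ z : ι → ℝ, (∀ m, 0 < z m) → ∀ X,
        (∀ W, a X W + ∑ m, 1 / z m * ⟪J m X, J m W⟫_ℝ = φ W) ↔ X = U z) ∧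
      (∀ X, (∀ m, J m X = 0) → ((∀ W, (∀ m, J m W = 0) → a X W = φ W) ↔ X = U₀)) ∧
      Tendsto U (𝓝[{z : ι → ℝ | ∀ m, 0 < z m}] 0) (𝓝 U₀) := by
  -- the penalised problems
  let B : (ι → ℝ) → V →L[ℝ] V →L[ℝ] ℝ := fun z => a + ∑ m, (1 / z m) • innerComp (J m)
  have hB : ∀ z v w, B z v w = a v w + ∑ m, 1 / z m * ⟪J m v, J m w⟫_ℝ := by
    intro z v w
    simp [B, innerComp_apply]
  have hBcoer : ∀ z : ι → ℝ, (∀ m, 0 < z m) → IsCoercive (B z) := by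
    intro z hz
    -- the form for `z` dominates `κ` times the form for `z = 1`
    obtain ⟨κ, hκ, hκ1, hκz⟩ : ∃ κ : ℝ, 0 < κ ∧ κ ≤ 1 ∧ ∀ m, κ ≤ 1 / z m := by
      have hs : 0 ≤ ∑ m, z m := Finset.sum_nonneg fun m _ => (hz m).le
      refine ⟨1 / (1 + ∑ m, z m), by positivity, ?_, fun m => ?_⟩
      · rw [div_le_one (by positivity)]; linarith
      · refine one_div_le_one_div_of_le (hz m) ?_
        linarith [Finset.single_le_sum (f := z) (fun m _ => (hz m).le) (Finset.mem_univ m)]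
    refine ⟨κ * c, by positivity, fun v => ?_⟩
    rw [hB]
    calc κ * c * ‖v‖ * ‖v‖ = κ * (c * ‖v‖ ^ 2) := by ring
      _ ≤ κ * (a v v + ∑ m, ‖J m v‖ ^ 2) := by gcongr; exact hcoer v
      _ = κ * a v v + ∑ m, κ * ‖J m v‖ ^ 2 := by rw [mul_add, Finset.mul_sum]
      _ ≤ _ := by
        refine add_le_add (mul_le_of_le_one_left (ha v) hκ1) (Finset.sum_le_sum fun m _ => ?_)
        rw [real_inner_self_eq_norm_sq]
        exact mul_le_mul_of_nonneg_right (hκz m) (by positivity)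
  have hUex : ∀ z : ι → ℝ, ∃ u, (∀ m, 0 < z m) → ∀ X, (∀ W, B z X W = φ W) ↔ X = u := by
    intro z
    by_cases hz : ∀ m, 0 < z m
    · obtain ⟨u, hu, huniq⟩ := existsUnique_of_isCoercive (hBcoer z hz) φ
      exact ⟨u, fun _ X => ⟨huniq X, fun h => h ▸ hu⟩⟩
    · exact ⟨0, fun h => absurd h hz⟩
  choose U hU using hUex
  -- the constrained problem
  let V₀ : Submodule ℝ V := ⨅ m, LinearMap.ker (J m : V →ₗ[ℝ] Y m)
  have hV₀ : ∀ v, v ∈ V₀ ↔ ∀ m, J m v = 0 := fun v => by simp [V₀]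
  have hV₀c : IsClosed (V₀ : Set V) := by
    have : (V₀ : Set V) = ⋂ m, {v | J m v = 0} := by ext v; simp [hV₀]
    rw [this]
    exact isClosed_iInter fun m => isClosed_eq (J m).continuous continuous_const
  have : CompleteSpace V₀ := hV₀c.completeSpace_coe
  let a₀ : V₀ →L[ℝ] V₀ →L[ℝ] ℝ := a.bilinearComp V₀.subtypeL V₀.subtypeL
  have ha₀ : IsCoercive a₀ := by
    refine ⟨c, hc, fun v => ?_⟩
    have h := hcoer v
    have h0 : ∑ m, ‖J m (v : V)‖ ^ 2 = 0 :=
      Finset.sum_eq_zero fun m _ => by rw [(hV₀ v).1 v.2 m]; simp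
    rw [h0, add_zero] at h
    calc c * ‖v‖ * ‖v‖ = c * ‖(v : V)‖ ^ 2 := by rw [Submodule.coe_norm]; ring
      _ ≤ a v v := h
  obtain ⟨U₀, hU₀, hU₀u⟩ := existsUnique_of_isCoercive ha₀ (φ.comp V₀.subtypeL)
  have hJU₀ := (hV₀ U₀).1 U₀.2
  refine ⟨U, U₀, hJU₀, fun z hz X => ?_, fun X hX => ⟨fun h => ?_, fun h W hW => ?_⟩, ?_⟩
  · rw [← hU z hz X]; simp_rw [hB]
  · exact congrArg Subtype.val (hU₀u ⟨X, (hV₀ X).2 hX⟩ fun W => h W ((hV₀ W).1 W.2))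
  · subst h; exact hU₀ ⟨W, (hV₀ W).2 hW⟩
  · -- the error `d` satisfies `B z d d = ψ d`, where `ψ` vanishes on `⋂ ker J_m`
    set ψ : V →L[ℝ] ℝ := φ - a U₀ with hψdef
    have hψ0 : ∀ v, (∀ m, J m v = 0) → ψ v = 0 := fun v hv => by
      have : a U₀ v = φ v := hU₀ ⟨v, (hV₀ v).2 hv⟩
      simp [hψdef, this]
    set d : (ι → ℝ) → V := fun z => U z - U₀ with hd
    have hBd : ∀ z : ι → ℝ, (∀ m, 0 < z m) → B z (d z) (d z) = ψ (d z) := by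
      intro z hz
      have h1 := (hU z hz (U z)).2 rfl (d z)
      have h2 : B z U₀ (d z) = a U₀ (d z) := by
        rw [hB]; simp [hJU₀]
      rw [hd] at *
      simp only [map_sub, _root_.sub_apply, hψdef] at *
      linarith
    set S : Set (ι → ℝ) := {z | ∀ m, 0 < z m} with hS
    have hpos : ∀ᶠ z in 𝓝[S] (0 : ι → ℝ), ∀ m, 0 < z m := self_mem_nhdsWithin
    have hsmall : ∀ᶠ z in 𝓝[S] (0 : ι → ℝ), ∀ m, z m < 1 := by
      refine eventually_all.2 fun m => ?_
      have : Tendsto (fun z : ι → ℝ => z m) (𝓝[S] 0) (𝓝 0) :=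
        ((continuous_apply m).tendsto (0 : ι → ℝ)).mono_left nhdsWithin_le_nhds
      exact this.eventually (gt_mem_nhds one_pos)
    have hterm : ∀ z : ι → ℝ, (∀ m, 0 < z m) → ∀ m, 0 ≤ 1 / z m * ⟪J m (d z), J m (d z)⟫_ℝ :=
      fun z hz m => mul_nonneg (one_div_pos.2 (hz m)).le real_inner_self_nonneg
    have hcd : ∀ᶠ z in 𝓝[S] (0 : ι → ℝ), c * ‖d z‖ ^ 2 ≤ ψ (d z) := by
      filter_upwards [hpos, hsmall] with z hz hz1
      rw [← hBd z hz, hB]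
      refine (hcoer _).trans (add_le_add_right (Finset.sum_le_sum fun m _ => ?_) _)
      rw [real_inner_self_eq_norm_sq]
      exact le_mul_of_one_le_left (by positivity) ((one_le_div (hz m)).2 (hz1 m).le)
    set R : ℝ := ‖ψ‖ / c with hR
    have hR0 : 0 ≤ R := by positivity
    have hdR : ∀ᶠ z in 𝓝[S] (0 : ι → ℝ), ‖d z‖ ≤ R := by
      filter_upwards [hcd] with z hz
      have h1 : c * ‖d z‖ ^ 2 ≤ ‖ψ‖ * ‖d z‖ :=
        hz.trans ((le_abs_self _).trans (ψ.le_opNorm _))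
      rw [hR, le_div_iff₀ hc]
      by_contra! h
      rcases (norm_nonneg (d z)).eq_or_lt with h0 | h0
      · rw [← h0, zero_mul] at h; exact absurd h (not_lt.2 (norm_nonneg _))
      · nlinarith
    have hJd : ∀ m, Tendsto (fun z => J m (d z)) (𝓝[S] 0) (𝓝 0) := by
      intro m
      rw [tendsto_zero_iff_norm_tendsto_zero]
      have hz0 : Tendsto (fun z : ι → ℝ => √(z m * (‖ψ‖ * R))) (𝓝[S] 0) (𝓝 0) := by
        have : Tendsto (fun z : ι → ℝ => √(z m * (‖ψ‖ * R))) (𝓝 0)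
            (𝓝 √((0 : ι → ℝ) m * (‖ψ‖ * R))) := Continuous.tendsto (by fun_prop) _
        simp only [Pi.zero_apply, zero_mul, Real.sqrt_zero] at this
        exact this.mono_left nhdsWithin_le_nhds
      refine squeeze_zero' (Eventually.of_forall fun z => norm_nonneg _) ?_ hz0
      filter_upwards [hpos, hdR] with z hz hzR
      refine Real.le_sqrt_of_sq_le ?_
      have h1 : 1 / z m * ⟪J m (d z), J m (d z)⟫_ℝ ≤ ψ (d z) := by
        rw [← hBd z hz, hB]
        have := Finset.single_le_sum (fun m _ => hterm z hz m) (Finset.mem_univ m)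
        linarith [ha (d z)]
      have h2 : ψ (d z) ≤ ‖ψ‖ * R := ((le_abs_self _).trans (ψ.le_opNorm _)).trans
        (mul_le_mul_of_nonneg_left hzR (norm_nonneg _))
      rw [real_inner_self_eq_norm_sq, one_div, inv_mul_le_iff₀ (hz m)] at h1
      exact h1.trans (mul_le_mul_of_nonneg_left h2 (hz m).le)
    have hψd : Tendsto (fun z => ψ (d z)) (𝓝[S] 0) (𝓝 0) := by
      refine Metric.tendsto_nhds.2 fun ε hε => ?_
      obtain ⟨y, hy⟩ := exists_approx_of_vanish J ψ hψ0
        (show 0 < ε / (2 * (R + 1)) by positivity)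
      have hsum : Tendsto (fun z => ∑ m, ⟪J m y, J m (d z)⟫_ℝ) (𝓝[S] 0) (𝓝 0) := by
        have := tendsto_finsetSum (Finset.univ : Finset ι) fun m _ =>
          (tendsto_const_nhds (x := J m y)).inner (𝕜 := ℝ) (hJd m)
        simpa using this
      filter_upwards [hdR, Metric.tendsto_nhds.1 hsum (ε / 2) (by positivity)] with z hz hz'
      rw [Real.dist_eq, sub_zero] at hz' ⊢
      have h1 := hy (d z)
      have h2 : ε / (2 * (R + 1)) * ‖d z‖ ≤ ε / 2 := by
        calc ε / (2 * (R + 1)) * ‖d z‖ ≤ ε / (2 * (R + 1)) * (R + 1) := by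
              gcongr; linarith
          _ = ε / 2 := by field_simp
      calc |ψ (d z)| = |(ψ (d z) - ∑ m, ⟪J m y, J m (d z)⟫_ℝ) + ∑ m, ⟪J m y, J m (d z)⟫_ℝ| := by
            rw [sub_add_cancel]
        _ ≤ _ := abs_add_le _ _
        _ < ε := by linarith
    rw [tendsto_iff_norm_sub_tendsto_zero]
    have hz0 : Tendsto (fun z => √(ψ (d z) / c)) (𝓝[S] 0) (𝓝 0) := by
      have := (hψd.div_const c).sqrt
      simpa using this
    refine squeeze_zero' (Eventually.of_forall fun z => norm_nonneg _) ?_ hz0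
    filter_upwards [hcd] with z hz
    refine Real.le_sqrt_of_sq_le ?_
    rw [le_div_iff₀ hc, mul_comm]
    exact hz

end Penalty

/-- The penalty limit for a form on an ambient space, restricted to a closed subspace. -/
theorem penalty_limit_of_isClosed {X ι : Type*} [NormedAddCommGroup X] [InnerProductSpace ℝ X]
    [CompleteSpace X] [Fintype ι] {Y : ι → Type*}
    [∀ m, NormedAddCommGroup (Y m)] [∀ m, InnerProductSpace ℝ (Y m)] [∀ m, CompleteSpace (Y m)]
    (J : ∀ m, X →L[ℝ] Y m) (a : X →L[ℝ] X →L[ℝ] ℝ) (ha : ∀ v, 0 ≤ a v v) {c : ℝ} (hc : 0 < c)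
    (hcoer : ∀ v, c * ‖v‖ ^ 2 ≤ a v v + ∑ m, ‖J m v‖ ^ 2) {S : Submodule ℝ X}
    (hS : IsClosed (S : Set X)) (φ : S →L[ℝ] ℝ) :
    ∃ (U : (ι → ℝ) → S) (U₀ : S), (∀ m, J m U₀ = 0) ∧
      (∀ z : ι → ℝ, (∀ m, 0 < z m) → ∀ V : S,
        (∀ W : S, a V W + ∑ m, 1 / z m * ⟪J m V, J m W⟫_ℝ = φ W) ↔ V = U z) ∧
      (∀ V : S, (∀ m, J m V = 0) →
        ((∀ W : S, (∀ m, J m W = 0) → a V W = φ W) ↔ V = U₀)) ∧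
      Tendsto (fun z => (U z : X)) (𝓝[{z : ι → ℝ | ∀ m, 0 < z m}] 0) (𝓝 (U₀ : X)) := by
  have : CompleteSpace S := hS.completeSpace_coe
  obtain ⟨U, U₀, hU₀, hU, hU₀', hlim⟩ := penalty_limit (fun m => (J m).comp S.subtypeL)
    (a.bilinearComp S.subtypeL S.subtypeL) (fun v => ha v) hc (fun v => hcoer v) φ
  exact ⟨U, U₀, hU₀, hU, hU₀', (continuous_subtype_val.tendsto U₀).comp hlim⟩

/-! ### Coercivity and electrode residuals -/

/-- A Poincaré inequality for one electrode controls the whole norm on `H¹(Ω) ⊕ ℝ^M_⋄`: subtract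
the constant `x m₀`, compare the other voltages with it through the trace inequality, and recover
`x m₀` itself from `∑ x m = 0`. -/
theorem exists_coercive_of_poincare {H G Y : Type*} {Z : Fin M → Type*}
    [NormedAddCommGroup H] [NormedSpace ℝ H] [NormedAddCommGroup G] [NormedSpace ℝ G]
    [NormedAddCommGroup Y] [NormedSpace ℝ Y]
    [∀ m, NormedAddCommGroup (Z m)] [∀ m, NormedSpace ℝ (Z m)]
    (grad : H →L[ℝ] G) (T : H →L[ℝ] Y) (R : ∀ m, Y →L[ℝ] Z m) (one : H) (hone : grad one = 0)
    (hne : ∀ m, R m (T one) ≠ 0) (m₀ : Fin M) {C : ℝ} (hC : 0 ≤ C)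
    (hP : ∀ v, ‖v‖ ^ 2 ≤ C * (‖R m₀ (T v)‖ ^ 2 + ‖grad v‖ ^ 2)) :
    ∃ K > 0, ∀ v, ∀ x : Fin M → ℝ, ∑ m, x m = 0 → ‖v‖ ^ 2 + ∑ m, x m ^ 2 ≤
      K * (‖grad v‖ ^ 2 + ∑ m, ‖R m (T v) - x m • R m (T one)‖ ^ 2) := by
  -- `b m` bounds `|x m - x m₀|` in terms of the right-hand side
  set b : Fin M → ℝ := fun m => (‖(R m).comp T‖ * √C + 1) / ‖R m (T one)‖ with hb
  have hb0 : ∀ m, 0 ≤ b m := fun m => by positivity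
  set B : ℝ := ∑ m, b m with hB
  have hB0 : 0 ≤ B := Finset.sum_nonneg fun m _ => hb0 m
  refine ⟨2 * C + 2 * (B * ‖one‖) ^ 2 + M * (2 * B) ^ 2 + 1, by positivity, fun v x hx => ?_⟩
  set D : ℝ := ‖grad v‖ ^ 2 + ∑ m, ‖R m (T v) - x m • R m (T one)‖ ^ 2 with hD
  have hsum0 : 0 ≤ ∑ m, ‖R m (T v) - x m • R m (T one)‖ ^ 2 := by positivity
  have hD0 : 0 ≤ D := by positivity
  have hJ : ∀ m, ‖R m (T v) - x m • R m (T one)‖ ^ 2 ≤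
      ∑ m, ‖R m (T v) - x m • R m (T one)‖ ^ 2 := fun m =>
    Finset.single_le_sum (f := fun m => ‖R m (T v) - x m • R m (T one)‖ ^ 2)
      (fun m _ => by positivity) (Finset.mem_univ m)
  set s : ℝ := √D with hs
  have hs0 : 0 ≤ s := Real.sqrt_nonneg _
  have hsD : s ^ 2 = D := Real.sq_sqrt hD0
  have hJs : ∀ m, ‖R m (T v) - x m • R m (T one)‖ ≤ s := fun m =>
    Real.le_sqrt_of_sq_le (by linarith [hJ m, sq_nonneg ‖grad v‖])
  set k : ℝ := x m₀ with hk
  set v' : H := v - k • one with hv'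
  have hRT : ∀ m, R m (T v') = R m (T v) - k • R m (T one) := fun m => by simp [hv']
  have hg : grad v' = grad v := by simp [hv', hone]
  have hv's : ‖v'‖ ≤ √C * s := by
    rw [hs, ← Real.sqrt_mul hC]
    refine Real.le_sqrt_of_sq_le ((hP v').trans ?_)
    rw [hRT, hg]
    exact mul_le_mul_of_nonneg_left (by linarith [hJ m₀]) hC
  have hdiff : ∀ m, |x m - k| ≤ b m * s := by
    intro m
    have hpos : 0 < ‖R m (T one)‖ := norm_pos_iff.2 (hne m)
    have h1 : (x m - k) • R m (T one) = R m (T v') - (R m (T v) - x m • R m (T one)) := by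
      rw [hRT, sub_smul]; abel
    have h2 : |x m - k| * ‖R m (T one)‖ ≤ (‖(R m).comp T‖ * √C + 1) * s := by
      rw [← Real.norm_eq_abs, ← norm_smul, h1]
      calc ‖R m (T v') - (R m (T v) - x m • R m (T one))‖
          ≤ ‖((R m).comp T) v'‖ + s := (norm_sub_le _ _).trans (add_le_add le_rfl (hJs m))
        _ ≤ ‖(R m).comp T‖ * (√C * s) + s := by
          gcongr
          exact (ContinuousLinearMap.le_opNorm _ _).trans
            (mul_le_mul_of_nonneg_left hv's (norm_nonneg _))
        _ = _ := by ring
    rw [hb, div_mul_eq_mul_div, le_div_iff₀ hpos]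
    exact h2
  have hkB : |k| ≤ B * s := by
    have hM : (1 : ℝ) ≤ M := by exact_mod_cast (Nat.zero_le _).trans_lt m₀.2
    -- the voltages sum to zero, so their deviations from `k` sum to `-M k`
    have h1 : (M : ℝ) * k = -∑ m, (x m - k) := by
      rw [Finset.sum_sub_distrib, hx]; simp
    calc |k| ≤ M * |k| := le_mul_of_one_le_left (abs_nonneg _) hM
      _ = |∑ m, (x m - k)| := by
        rw [← abs_neg (∑ m, (x m - k)), ← h1, abs_mul, Nat.abs_cast]
      _ ≤ ∑ m, |x m - k| := Finset.abs_sum_le_sum_abs _ _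
      _ ≤ ∑ m, b m * s := Finset.sum_le_sum fun m _ => hdiff m
      _ = B * s := by rw [hB, Finset.sum_mul]
  have hxB : ∀ m, x m ^ 2 ≤ (2 * B) ^ 2 * D := by
    intro m
    have h1 : b m * s ≤ B * s := mul_le_mul_of_nonneg_right
      (Finset.single_le_sum (f := b) (fun m _ => hb0 m) (Finset.mem_univ m)) hs0
    have h2 : |x m| ≤ 2 * B * s := by
      calc |x m| = |(x m - k) + k| := by rw [sub_add_cancel]
        _ ≤ |x m - k| + |k| := abs_add_le _ _
        _ ≤ 2 * B * s := by linarith [hdiff m]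
    rw [← sq_abs, ← hsD, ← mul_pow]
    exact pow_le_pow_left₀ (abs_nonneg _) h2 2
  have hxs : ∑ m, x m ^ 2 ≤ M * (2 * B) ^ 2 * D := by
    refine (Finset.sum_le_sum fun m _ => hxB m).trans (le_of_eq ?_)
    simp [mul_assoc]
  have hvs : ‖v‖ ≤ √C * s + B * s * ‖one‖ := by
    calc ‖v‖ = ‖v' + k • one‖ := by rw [hv', sub_add_cancel]
      _ ≤ ‖v'‖ + |k| * ‖one‖ := (norm_add_le _ _).trans (by rw [norm_smul, Real.norm_eq_abs])
      _ ≤ _ := by gcongr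
  have hv2 : ‖v‖ ^ 2 ≤ (2 * C + 2 * (B * ‖one‖) ^ 2) * D := by
    refine (pow_le_pow_left₀ (norm_nonneg _) hvs 2).trans ?_
    rw [← hsD]
    nlinarith [sq_nonneg (√C * s - B * s * ‖one‖), Real.sq_sqrt hC]
  nlinarith

/-- The residual `v ↦ (T v - l v)|_s` in `L²(s)`, for a trace operator `T` and a voltage `l`. -/
def traceResidual {α X : Type*} [MeasurableSpace α] [NormedAddCommGroup X] [NormedSpace ℝ X]
    {μ : Measure α} [IsFiniteMeasure μ] (s : Set α) (T : X →L[ℝ] Lp ℝ 2 μ) (l : X →L[ℝ] ℝ) :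
    X →L[ℝ] Lp ℝ 2 (μ.restrict s) :=
  (LpToLpRestrictCLM α ℝ ℝ μ 2 s).comp T - (Lp.constL 2 (μ.restrict s) ℝ).comp l

section traceResidual

variable {α X : Type*} [MeasurableSpace α] [NormedAddCommGroup X] [NormedSpace ℝ X]
    {μ : Measure α} [IsFiniteMeasure μ] (s : Set α) (T : X →L[ℝ] Lp ℝ 2 μ) (l : X →L[ℝ] ℝ)

theorem coeFn_traceResidual (v : X) :
    traceResidual s T l v =ᵐ[μ.restrict s] fun x => T v x - l v := by
  have h0 : traceResidual s T l v = LpToLpRestrictCLM α ℝ ℝ μ 2 s (T v) -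
      Lp.constL 2 (μ.restrict s) ℝ (l v) := rfl
  rw [h0]
  filter_upwards [Lp.coeFn_sub (LpToLpRestrictCLM α ℝ ℝ μ 2 s (T v))
      (Lp.constL 2 (μ.restrict s) ℝ (l v)),
    LpToLpRestrictCLM_coeFn ℝ s (T v),
    Lp.coeFn_const (E := ℝ) 2 (μ.restrict s) (l v)] with x h1 h2 h3
  rw [h1, Pi.sub_apply, h2]
  congr 1

theorem inner_traceResidual (v w : X) :
    ⟪traceResidual s T l v, traceResidual s T l w⟫_ℝ =
      ∫ x in s, (T v x - l v) * (T w x - l w) ∂μ := by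
  rw [L2.inner_def]
  refine integral_congr_ae ?_
  filter_upwards [coeFn_traceResidual s T l v, coeFn_traceResidual s T l w] with x h1 h2
  rw [h1, h2]
  simp [mul_comm]

theorem traceResidual_eq_zero_iff (v : X) :
    traceResidual s T l v = 0 ↔ ∀ᵐ x ∂(μ.restrict s), T v x = l v := by
  rw [Lp.eq_zero_iff_ae_eq_zero]
  refine eventually_congr ?_
  filter_upwards [coeFn_traceResidual s T l v] with x hx
  rw [hx, Pi.zero_apply, sub_eq_zero]

theorem constL_eq_smul {g : Lp ℝ 2 μ} (hg : g =ᵐ[μ] fun _ => 1) (c : ℝ) :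
    Lp.constL 2 (μ.restrict s) ℝ c = c • LpToLpRestrictCLM α ℝ ℝ μ 2 s g := by
  refine Lp.ext ?_
  filter_upwards [Lp.coeFn_smul c (LpToLpRestrictCLM α ℝ ℝ μ 2 s g),
    LpToLpRestrictCLM_coeFn ℝ s g, ae_restrict_of_ae hg,
    Lp.coeFn_const (E := ℝ) 2 (μ.restrict s) c] with x h1 h2 h3 h4
  rw [h1, Pi.smul_apply, h2, h3]
  exact h4.trans (by simp)

end traceResidual

theorem restrict_one_ne_zero {α : Type*} [MeasurableSpace α] {μ : Measure α} {s : Set α}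
    {g : Lp ℝ 2 μ} (hg : g =ᵐ[μ] fun _ => 1) (hs : μ s ≠ 0) :
    LpToLpRestrictCLM α ℝ ℝ μ 2 s g ≠ 0 := by
  intro h
  rw [Lp.eq_zero_iff_ae_eq_zero] at h
  have : ∀ᵐ _ ∂(μ.restrict s), False := by
    filter_upwards [h, LpToLpRestrictCLM_coeFn ℝ s g, ae_restrict_of_ae hg] with x h1 h2 h3
    rw [h2, h3] at h1
    exact one_ne_zero h1
  rw [ae_iff] at this
  simp at this
  exact hs this

/-- The voltage `V_m` as a continuous functional on `ℍ¹`. -/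
def voltL (Ω : Set (EuclideanSpace ℝ (Fin n))) (m : Fin M) : HH Ω M →L[ℝ] ℝ :=
  (EuclideanSpace.proj m).comp ((RDiamond M).subtypeL.comp (WithLp.sndL 2 ℝ _ _))

theorem voltL_apply (m : Fin M) (V : HH Ω M) : voltL Ω m V = volt V m := rfl

/-! ### The conductivity form -/

/-- By symmetry and positivity, the bound on the quadratic form polarises to the bilinear form. -/
theorem IsConductivity.abs_form_le {σ : EuclideanSpace ℝ (Fin n) → Matrix (Fin n) (Fin n) ℝ}
    {σminus σplus : ℝ} (hσ : IsConductivity Ω σ σminus σplus) :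
    ∀ᵐ x ∂(volume.restrict Ω), ∀ ξ η : EuclideanSpace ℝ (Fin n),
      |(σ x *ᵥ ξ.ofLp) ⬝ᵥ η.ofLp| ≤ σplus / 2 * (‖ξ‖ ^ 2 + ‖η‖ ^ 2) := by
  filter_upwards [hσ.symmetric, hσ.bounds] with x hs hb ξ η
  have hn : ∀ ζ : EuclideanSpace ℝ (Fin n), ζ.ofLp ⬝ᵥ ζ.ofLp = ‖ζ‖ ^ 2 := fun ζ => by
    rw [EuclideanSpace.real_norm_sq_eq]; simp [dotProduct, sq]
  have h0 : ∀ ζ : EuclideanSpace ℝ (Fin n), 0 ≤ ζ.ofLp ⬝ᵥ (σ x *ᵥ ζ.ofLp) := fun ζ => by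
    refine le_trans ?_ (hb ζ.ofLp).1
    rw [hn]
    exact mul_nonneg hσ.minus_pos.le (sq_nonneg _)
  have hp : ∀ ζ : EuclideanSpace ℝ (Fin n), ζ.ofLp ⬝ᵥ (σ x *ᵥ ζ.ofLp) ≤ σplus * ‖ζ‖ ^ 2 :=
    fun ζ => by rw [← hn]; exact (hb ζ.ofLp).2
  have hsymm : η.ofLp ⬝ᵥ (σ x *ᵥ ξ.ofLp) = ξ.ofLp ⬝ᵥ (σ x *ᵥ η.ofLp) := by
    rw [dotProduct_mulVec, ← mulVec_transpose, hs.eq, dotProduct_comm]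
  -- polarisation
  have h1 := h0 (ξ + η)
  have h2 := h0 (ξ - η)
  have h3 := hp (ξ + η)
  have h4 := hp (ξ - η)
  have h5 := parallelogram_law_with_norm ℝ ξ η
  rw [dotProduct_comm]
  simp only [WithLp.ofLp_add, WithLp.ofLp_sub, mulVec_add, mulVec_sub, dotProduct_add,
    dotProduct_sub, add_dotProduct, sub_dotProduct, hsymm] at h1 h2 h3 h4 ⊢
  have h6 : σplus * ‖ξ + η‖ ^ 2 + σplus * ‖ξ - η‖ ^ 2 =
      2 * σplus * (‖ξ‖ ^ 2 + ‖η‖ ^ 2) := by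
    linear_combination σplus * h5
  rw [abs_le]
  constructor <;> linarith

theorem IsConductivity.integrable {σ : EuclideanSpace ℝ (Fin n) → Matrix (Fin n) (Fin n) ℝ}
    {σminus σplus : ℝ} (hσ : IsConductivity Ω σ σminus σplus)
    (g h : Lp (EuclideanSpace ℝ (Fin n)) 2 (volume.restrict Ω)) :
    Integrable (fun x => (σ x *ᵥ (g x).ofLp) ⬝ᵥ (h x).ofLp) (volume.restrict Ω) := by
  have hc : ∀ (f : Lp (EuclideanSpace ℝ (Fin n)) 2 (volume.restrict Ω)) (i : Fin n),
      AEStronglyMeasurable (fun x => (f x).ofLp i) (volume.restrict Ω) := fun f i =>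
    (EuclideanSpace.proj (𝕜 := ℝ) i).continuous.comp_aestronglyMeasurable
      (Lp.aestronglyMeasurable f)
  refine Integrable.mono' ((((Lp.memLp g).integrable_norm_pow two_ne_zero).add
    ((Lp.memLp h).integrable_norm_pow two_ne_zero)).const_mul (σplus / 2)) ?_ ?_
  · simp only [dotProduct, mulVec]
    exact Finset.aestronglyMeasurable_fun_sum _ fun i _ =>
      (Finset.aestronglyMeasurable_fun_sum _ fun j _ =>
        (hσ.measurable i j).aestronglyMeasurable.mul (hc g j)).mul (hc h i)
  · filter_upwards [hσ.abs_form_le] with x hx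
    exact hx _ _

theorem integral_norm_sq {α F : Type*} [MeasurableSpace α] [NormedAddCommGroup F]
    [InnerProductSpace ℝ F] {μ : Measure α} (f : Lp F 2 μ) : ∫ x, ‖f x‖ ^ 2 ∂μ = ‖f‖ ^ 2 := by
  rw [← real_inner_self_eq_norm_sq, L2.inner_def]
  simp_rw [real_inner_self_eq_norm_sq]

/-- Rescaling both arguments to norm one turns a bound by squares into a bound by a product. -/
theorem abs_bilin_le_of_sq {X : Type*} [NormedAddCommGroup X] [NormedSpace ℝ X]
    (B : X →ₗ[ℝ] X →ₗ[ℝ] ℝ) {K : ℝ} (hB : ∀ x y, |B x y| ≤ K * (‖x‖ ^ 2 + ‖y‖ ^ 2)) (x y : X) :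
    |B x y| ≤ 2 * K * ‖x‖ * ‖y‖ := by
  rcases eq_or_ne x 0 with rfl | hx
  · simp
  rcases eq_or_ne y 0 with rfl | hy
  · simp
  have hx' : 0 < ‖x‖ := norm_pos_iff.2 hx
  have hy' : 0 < ‖y‖ := norm_pos_iff.2 hy
  have h := hB (‖x‖⁻¹ • x) (‖y‖⁻¹ • y)
  rw [map_smul, map_smul, LinearMap.smul_apply, smul_eq_mul, smul_eq_mul, norm_smul, norm_smul,
    norm_inv, norm_inv, norm_norm, norm_norm, inv_mul_cancel₀ hx'.ne', inv_mul_cancel₀ hy'.ne',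
    abs_mul, abs_mul, abs_inv, abs_inv, abs_norm, abs_norm] at h
  have h2 : |B x y| = ‖x‖ * ‖y‖ * (‖y‖⁻¹ * (‖x‖⁻¹ * |B x y|)) := by field_simp
  have h3 := mul_le_mul_of_nonneg_left h (mul_pos hx' hy').le
  rw [h2]
  linarith

/-- The form `(g, h) ↦ ∫_Ω σ g · h dx` is bounded and bilinear on `L²(Ω)ⁿ`, and positive definite.
-/
theorem IsConductivity.exists_form {σ : EuclideanSpace ℝ (Fin n) → Matrix (Fin n) (Fin n) ℝ}
    {σminus σplus : ℝ} (hσ : IsConductivity Ω σ σminus σplus) :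
    ∃ a : Lp (EuclideanSpace ℝ (Fin n)) 2 (volume.restrict Ω) →L[ℝ]
        Lp (EuclideanSpace ℝ (Fin n)) 2 (volume.restrict Ω) →L[ℝ] ℝ,
      (∀ g h, a g h = ∫ x in Ω, (σ x *ᵥ (g x).ofLp) ⬝ᵥ (h x).ofLp) ∧
        ∀ g, σminus * ‖g‖ ^ 2 ≤ a g g := by
  let B : Lp (EuclideanSpace ℝ (Fin n)) 2 (volume.restrict Ω) →ₗ[ℝ]
      Lp (EuclideanSpace ℝ (Fin n)) 2 (volume.restrict Ω) →ₗ[ℝ] ℝ :=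
    LinearMap.mk₂ ℝ (fun g h => ∫ x in Ω, (σ x *ᵥ (g x).ofLp) ⬝ᵥ (h x).ofLp)
      (fun g g' h => by
        rw [← integral_add (hσ.integrable g h) (hσ.integrable g' h)]
        refine integral_congr_ae ?_
        filter_upwards [Lp.coeFn_add g g'] with x hx
        rw [hx, Pi.add_apply, WithLp.ofLp_add, mulVec_add, add_dotProduct])
      (fun c g h => by
        rw [smul_eq_mul, ← integral_const_mul]
        refine integral_congr_ae ?_
        filter_upwards [Lp.coeFn_smul c g] with x hx
        rw [hx, Pi.smul_apply, WithLp.ofLp_smul, mulVec_smul, smul_dotProduct, smul_eq_mul])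
      (fun g h h' => by
        rw [← integral_add (hσ.integrable g h) (hσ.integrable g h')]
        refine integral_congr_ae ?_
        filter_upwards [Lp.coeFn_add h h'] with x hx
        rw [hx, Pi.add_apply, WithLp.ofLp_add, dotProduct_add])
      (fun c g h => by
        rw [smul_eq_mul, ← integral_const_mul]
        refine integral_congr_ae ?_
        filter_upwards [Lp.coeFn_smul c h] with x hx
        rw [hx, Pi.smul_apply, WithLp.ofLp_smul, dotProduct_smul, smul_eq_mul])
  have hB : ∀ g h, |B g h| ≤ σplus / 2 * (‖g‖ ^ 2 + ‖h‖ ^ 2) := by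
    intro g h
    have hi : ∀ f : Lp (EuclideanSpace ℝ (Fin n)) 2 (volume.restrict Ω),
        Integrable (fun x => ‖f x‖ ^ 2) (volume.restrict Ω) := fun f =>
      (Lp.memLp f).integrable_norm_pow two_ne_zero
    rw [← integral_norm_sq g, ← integral_norm_sq h, ← integral_add (hi g) (hi h),
      ← integral_const_mul, ← Real.norm_eq_abs]
    change ‖∫ x in Ω, (σ x *ᵥ (g x).ofLp) ⬝ᵥ (h x).ofLp‖ ≤ _
    refine norm_integral_le_of_norm_le (((hi g).add (hi h)).const_mul _) ?_
    filter_upwards [hσ.abs_form_le] with x hx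
    exact hx _ _
  refine ⟨B.mkContinuous₂ (2 * (σplus / 2)) (abs_bilin_le_of_sq B hB), fun g h => rfl,
    fun g => ?_⟩
  change _ ≤ ∫ x in Ω, (σ x *ᵥ (g x).ofLp) ⬝ᵥ (g x).ofLp
  rw [← integral_norm_sq g, ← integral_const_mul]
  refine integral_mono_ae (((Lp.memLp g).integrable_norm_pow two_ne_zero).const_mul _)
    (hσ.integrable g g) ?_
  filter_upwards [hσ.bounds] with x hx
  have h := (hx (g x).ofLp).1
  rw [dotProduct_comm _ (σ x *ᵥ _)] at h
  refine le_trans (le_of_eq ?_) h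
  rw [EuclideanSpace.real_norm_sq_eq]
  simp [dotProduct, sq]

/-! ### The complete electrode model as a penalty problem -/

/-- The constant function `1` in `H¹(Ω)`. -/
theorem exists_h1_one (ho : IsOpen Ω) (hb : Bornology.IsBounded Ω)
    (hfin : surfaceMeasure Ω Set.univ < ⊤) {T : H1 Ω →L[ℝ] Lp ℝ 2 (surfaceMeasure Ω)}
    (hT : ∀ v g, (v, g) ∈ traceGraph Ω ↔ g = T v) :
    ∃ one : H1 Ω, h1Grad one = 0 ∧ T one =ᵐ[surfaceMeasure Ω] fun _ => 1 := by
  refine (exists_mem_smoothTraceGraph ho hb hfin (φ := fun _ => 1) contDiff_const).elim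
    fun q hq => ⟨q.1, ?_, ?_⟩
  · rw [Lp.eq_zero_iff_ae_eq_zero]
    refine hq.2.2.1.trans (Eventually.of_forall fun x => ?_)
    rw [gradient_fun_const]
    rfl
  · have h : q.2 = T q.1 := (hT q.1 q.2).1 (Submodule.le_topologicalClosure _ hq.1)
    rw [← h]
    exact hq.2.2.2

/-- The projection `ℍ¹ → H¹(Ω)` as a bounded operator. -/
def fstH (Ω : Set (EuclideanSpace ℝ (Fin n))) (M : ℕ) : HH Ω M →L[ℝ] H1 Ω :=
  WithLp.fstL 2 ℝ _ _

theorem norm_sq_HH (V : HH Ω M) : ‖V‖ ^ 2 = ‖V.fst‖ ^ 2 + ∑ m, volt V m ^ 2 := by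
  rw [WithLp.prod_norm_sq_eq_of_L2, Submodule.coe_norm V.snd, EuclideanSpace.real_norm_sq_eq]
  rfl

theorem sum_volt (V : HH Ω M) : ∑ m, volt V m = 0 := V.snd.2

/-- The residual `(v, V) ↦ (v - V_m)|_{E_m}` on the `m`-th electrode, for a trace operator `T`. -/
def electrodeResidual (E : Fin M → Set (EuclideanSpace ℝ (Fin n)))
    [IsFiniteMeasure (surfaceMeasure Ω)] (T : H1 Ω →L[ℝ] Lp ℝ 2 (surfaceMeasure Ω)) (m : Fin M) :
    HH Ω M →L[ℝ] Lp ℝ 2 ((surfaceMeasure Ω).restrict (E m)) :=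
  traceResidual (E m) (T.comp (fstH Ω M)) (voltL Ω m)

theorem electrodeResidual_apply (E : Fin M → Set (EuclideanSpace ℝ (Fin n)))
    [IsFiniteMeasure (surfaceMeasure Ω)] (T : H1 Ω →L[ℝ] Lp ℝ 2 (surfaceMeasure Ω)) (m : Fin M)
    (V : HH Ω M) : electrodeResidual E T m V =
      LpToLpRestrictCLM _ ℝ ℝ (surfaceMeasure Ω) 2 (E m) (T V.fst) -
        Lp.constL 2 ((surfaceMeasure Ω).restrict (E m)) ℝ (volt V m) := rfl

set_option maxHeartbeats 2000000 in
/-- The trace Poincaré inequality on one electrode makes the gradient together with all electrode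
residuals control the norm of `ℍ¹`. -/
theorem exists_coercive_traceResidual (hΩ : HasLipschitzBoundary Ω) (ho : IsOpen Ω)
    (hb : Bornology.IsBounded Ω) (hne : Ω.Nonempty) (hconn : IsPreconnected Ω) (hM : 0 < M)
    {E : Fin M → Set (EuclideanSpace ℝ (Fin n))} (hE : IsElectrodeConfiguration Ω E)
    [IsFiniteMeasure (surfaceMeasure Ω)] {T : H1 Ω →L[ℝ] Lp ℝ 2 (surfaceMeasure Ω)}
    (hT : ∀ v g, (v, g) ∈ traceGraph Ω ↔ g = T v) :
    ∃ K > 0, ∀ V : HH Ω M, ‖V‖ ^ 2 ≤ K * (‖h1Grad V.fst‖ ^ 2 +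
      ∑ m, ‖electrodeResidual E T m V‖ ^ 2) := by
  have hEpos : ∀ m, surfaceMeasure Ω (E m) ≠ 0 := fun m =>
    surfaceMeasure_pos hΩ ho hb hne hconn (hE.relOpen m) (hE.connected m).nonempty
  let R : ∀ m, Lp ℝ 2 (surfaceMeasure Ω) →L[ℝ] Lp ℝ 2 ((surfaceMeasure Ω).restrict (E m)) :=
    fun m => LpToLpRestrictCLM _ ℝ ℝ (surfaceMeasure Ω) 2 (E m)
  let m₀ : Fin M := ⟨0, hM⟩
  refine (exists_h1_one ho hb (measure_lt_top _ _) hT).elim fun one hone => ?_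
  refine (exists_traceGraph_poincare hΩ ho hb hconn (hE.relOpen m₀)
    (hE.connected m₀).nonempty).elim fun C hC => ?_
  have hRone : ∀ m, R m (T one) ≠ 0 := fun m => restrict_one_ne_zero hone.2 (hEpos m)
  have hP : ∀ v : H1 Ω, ‖v‖ ^ 2 ≤ (C + 1) * (‖R m₀ (T v)‖ ^ 2 + ‖h1GradL Ω v‖ ^ 2) := by
    intro v
    have h := hC.2 (v, T v) ((hT _ _).2 rfl)
    have h0 : 0 ≤ ‖R m₀ (T v)‖ ^ 2 := sq_nonneg _
    rw [norm_sq_h1, h1GradL_apply]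
    calc ‖h1Fun v‖ ^ 2 + ‖h1Grad v‖ ^ 2
        ≤ C * (‖R m₀ (T v)‖ ^ 2 + ‖h1Grad v‖ ^ 2) + ‖h1Grad v‖ ^ 2 := add_le_add h le_rfl
      _ ≤ (C + 1) * (‖R m₀ (T v)‖ ^ 2 + ‖h1Grad v‖ ^ 2) := by linarith
  refine (exists_coercive_of_poincare (h1GradL Ω) T R one hone.1 hRone m₀
    (add_nonneg hC.1 zero_le_one) hP).imp fun K hK => ⟨hK.1, fun V => ?_⟩
  refine ((norm_sq_HH V).le.trans (hK.2 V.fst (volt V) (sum_volt V))).trans (le_of_eq ?_)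
  refine congrArg (fun t => K * (‖h1Grad V.fst‖ ^ 2 + t)) (Finset.sum_congr rfl fun m _ => ?_)
  rw [electrodeResidual_apply, constL_eq_smul (E m) hone.2 (volt V m)]

/-- The form of the complete electrode model is the gradient form plus a penalty on the electrode
residuals. -/
theorem cemForm_eq (E : Fin M → Set (EuclideanSpace ℝ (Fin n)))
    (σ : EuclideanSpace ℝ (Fin n) → Matrix (Fin n) (Fin n) ℝ)
    [IsFiniteMeasure (surfaceMeasure Ω)] {T : H1 Ω →L[ℝ] Lp ℝ 2 (surfaceMeasure Ω)}
    (hT : ∀ v, trace v = T v) (z : Fin M → ℝ) (V W : HH Ω M) :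
    cemForm E σ z V W =
      (∫ x in Ω, (σ x *ᵥ (h1Grad V.fst x).ofLp) ⬝ᵥ (h1Grad W.fst x).ofLp) +
        ∑ m, 1 / z m * ⟪electrodeResidual E T m V, electrodeResidual E T m W⟫_ℝ := by
  rw [cemForm]
  congr 1
  refine Finset.sum_congr rfl fun m _ => ?_
  rw [hT, hT]
  exact congrArg _ (inner_traceResidual (E m) (T.comp (fstH Ω M)) (voltL Ω m) V W).symm

theorem mem_HH0_iff (E : Fin M → Set (EuclideanSpace ℝ (Fin n)))
    [IsFiniteMeasure (surfaceMeasure Ω)] {T : H1 Ω →L[ℝ] Lp ℝ 2 (surfaceMeasure Ω)}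
    (hT : ∀ v g, (v, g) ∈ traceGraph Ω ↔ g = T v) (V : HH Ω M) :
    V ∈ HH0 Ω E ↔
      ∀ m, electrodeResidual E T m V = 0 := by
  refine Iff.trans ⟨fun h m => ?_, fun h => ⟨T V.fst, (hT _ _).2 rfl, h⟩⟩
    (forall_congr' fun m => (traceResidual_eq_zero_iff (E m) (T.comp (fstH Ω M)) (voltL Ω m) V).symm)
  refine h.elim fun g hg => ?_
  have e := (hT _ _).1 hg.1
  have hm := hg.2 m
  rw [e] at hm
  exact hm

/-- `min a 1 / K` is a coercivity constant for a form bounded below by `a g² + s`, when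
`N ≤ K (g² + s)`. -/
theorem min_div_mul_le {a K N g s f : ℝ} (ha : 0 < a) (hK : 0 < K) (hg : 0 ≤ g) (hs : 0 ≤ s)
    (h : N ≤ K * (g + s)) (hf : a * g ≤ f) : min a 1 / K * N ≤ f + s := by
  have hmin : 0 < min a 1 := lt_min ha one_pos
  have h1 : min a 1 * g ≤ a * g := mul_le_mul_of_nonneg_right (min_le_left _ _) hg
  have h2 : min a 1 * s ≤ 1 * s := mul_le_mul_of_nonneg_right (min_le_right _ _) hs
  calc min a 1 / K * N ≤ min a 1 / K * (K * (g + s)) := by gcongr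
    _ = min a 1 * g + min a 1 * s := by field_simp
    _ ≤ f + s := by linarith

set_option maxHeartbeats 2000000 in
theorem galerkinConvergence_of_form {Y : Fin M → Type*} [∀ m, NormedAddCommGroup (Y m)]
    [∀ m, InnerProductSpace ℝ (Y m)] [∀ m, CompleteSpace (Y m)]
    {E : Fin M → Set (EuclideanSpace ℝ (Fin n))}
    {σ : EuclideanSpace ℝ (Fin n) → Matrix (Fin n) (Fin n) ℝ}
    (a : HH Ω M →L[ℝ] HH Ω M →L[ℝ] ℝ) (J : ∀ m, HH Ω M →L[ℝ] Y m)
    (hform : ∀ z V W, cemForm E σ z V W = a V W + ∑ m, 1 / z m * ⟪J m V, J m W⟫_ℝ)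
    (hker : ∀ V, V ∈ HH0 Ω E ↔ ∀ m, J m V = 0) (ha : ∀ V, 0 ≤ a V V) {c : ℝ} (hc : 0 < c)
    (hcoer : ∀ V, c * ‖V‖ ^ 2 ≤ a V V + ∑ m, ‖J m V‖ ^ 2) {V : Submodule ℝ (HH Ω M)}
    (hV : IsClosed (V : Set (HH Ω M))) (φ : V →L[ℝ] ℝ) :
    GalerkinConvergence E σ V φ.toLinearMap := by
  refine (penalty_limit_of_isClosed J a ha hc hcoer hV φ).elim fun U h => h.elim fun U₀ h => ?_
  refine ⟨U, ⟨U₀, U₀.2, (hker _).2 h.1⟩, fun z hz X => ?_, fun z hz X => ?_, h.2.2.2⟩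
  · rw [← h.2.1 z hz X]
    exact forall_congr' fun W => by rw [hform]; rfl
  · have hX := (hker _).1 X.2.2
    -- the penalty terms vanish on `ℍ¹₀`, which makes this problem independent of `z`
    have hz0 : ∀ W, cemForm E σ z X W = a X W := fun W => by
      rw [hform, Finset.sum_eq_zero fun m _ => ?_, add_zero]
      rw [hX, inner_zero_left, mul_zero]
    refine Iff.trans ⟨fun hs W hW => ?_, fun hs W => ?_⟩
      ((h.2.2.1 ⟨X, X.2.1⟩ hX).trans ⟨fun e => ?_, fun e => ?_⟩)
    · exact (hz0 W).symm.trans (hs ⟨W, W.2, (hker _).2 hW⟩)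
    · exact (hz0 W).trans (hs ⟨W, W.2.1⟩ ((hker _).1 W.2.2))
    · exact Subtype.ext (congrArg (fun t : V => (t : HH Ω M)) e)
    · exact Subtype.ext (congrArg (fun t : ↥(V ⊓ HH0 Ω E) => (t : HH Ω M)) e)

set_option maxHeartbeats 2000000 in
theorem galerkinConvergence_of_isClosed (hΩ : HasLipschitzBoundary Ω) (ho : IsOpen Ω)
    (hb : Bornology.IsBounded Ω) (hne : Ω.Nonempty) (hconn : IsPreconnected Ω) (hM : 0 < M)
    {E : Fin M → Set (EuclideanSpace ℝ (Fin n))} (hE : IsElectrodeConfiguration Ω E)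
    {σ : EuclideanSpace ℝ (Fin n) → Matrix (Fin n) (Fin n) ℝ} {σminus σplus : ℝ}
    (hσ : IsConductivity Ω σ σminus σplus) {V : Submodule ℝ (HH Ω M)}
    (hV : IsClosed (V : Set (HH Ω M))) (φ : V →L[ℝ] ℝ) :
    GalerkinConvergence E σ V φ.toLinearMap := by
  have : IsFiniteMeasure (surfaceMeasure Ω) := ⟨(exists_trace_bound hΩ ho hb).1⟩
  refine (exists_traceOp hΩ ho hb).elim fun T hT => ?_
  refine (exists_coercive_traceResidual hΩ ho hb hne hconn hM hE hT.2).elim fun K hK => ?_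
  refine hσ.exists_form.elim fun a ha => ?_
  let G : HH Ω M →L[ℝ] Lp (EuclideanSpace ℝ (Fin n)) 2 (volume.restrict Ω) :=
    (h1GradL Ω).comp (fstH Ω M)
  have ha0 : ∀ g, 0 ≤ a g g := fun g => (mul_nonneg hσ.minus_pos.le (sq_nonneg _)).trans (ha.2 g)
  refine galerkinConvergence_of_form (a.bilinearComp G G)
    (electrodeResidual E T)
    (fun z V W => ?_) (mem_HH0_iff E hT.2) (fun V => ha0 (G V))
    (div_pos (lt_min hσ.minus_pos one_pos) hK.1)
    (fun V => min_div_mul_le hσ.minus_pos hK.1 (sq_nonneg ‖h1Grad V.fst‖)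
      (Finset.sum_nonneg fun m _ => sq_nonneg _) (hK.2 V) (ha.2 (G V))) hV φ
  rw [cemForm_eq E σ hT.1]
  exact congrArg (· + _) (ha.1 (h1Grad V.fst) (h1Grad W.fst)).symm

/-- The current functional `W ↦ I · W` as a bounded functional. -/
def currentFunctionalL (Ω : Set (EuclideanSpace ℝ (Fin n))) (I : RDiamond M) : HH Ω M →L[ℝ] ℝ :=
  ∑ m, (I : EuclideanSpace ℝ (Fin M)) m • voltL Ω m

theorem currentFunctionalL_apply (I : RDiamond M) (W : HH Ω M) :
    currentFunctionalL Ω I W = currentFunctional Ω I W := by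
  simp [currentFunctionalL, currentFunctional, voltL_apply]

theorem isClosed_spatialSum (P : Submodule ℝ (H1 Ω)) [FiniteDimensional ℝ P] :
    IsClosed (spatialSum P M : Set (HH Ω M)) :=
  P.closed_of_finiteDimensional.preimage (fstH Ω M).continuous

end CEM

end

theorem mainTheorem3 {n M : ℕ} (hn : n = 2 ∨ n = 3) (hM : 2 ≤ M)
    (Ω : Set (EuclideanSpace ℝ (Fin n))) (hΩ_open : IsOpen Ω)
    (hΩ_bounded : Bornology.IsBounded Ω) (hΩ_simply : SimplyConnectedSpace Ω)
    (hΩ_lip : CEM.HasLipschitzBoundary Ω)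
    (E : Fin M → Set (EuclideanSpace ℝ (Fin n))) (hE : CEM.IsElectrodeConfiguration Ω E)
    (σ : EuclideanSpace ℝ (Fin n) → Matrix (Fin n) (Fin n) ℝ) (σminus σplus : ℝ)
    (hσ : CEM.IsConductivity Ω σ σminus σplus) :
    -- every closed subspace `V` of `ℍ¹` and every `φ ∈ V'`
    (∀ V : Submodule ℝ (CEM.HH Ω M), IsClosed (V : Set (CEM.HH Ω M)) →
      ∀ φ : V →L[ℝ] ℝ, CEM.GalerkinConvergence E σ V φ.toLinearMap) ∧
    -- `V = ℍ¹`: the complete electrode model converges to the shunt model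
    (∀ I : CEM.RDiamond M, CEM.GalerkinConvergence E σ (⊤ : Submodule ℝ (CEM.HH Ω M))
      ((CEM.currentFunctional Ω I).domRestrict ⊤)) ∧
    -- `V = P ⊕ ℝ^M_⋄` with a finite-dimensional (finite element) space `P`
    (∀ P : Submodule ℝ (CEM.H1 Ω), FiniteDimensional ℝ P → ∀ I : CEM.RDiamond M,
      CEM.GalerkinConvergence E σ (CEM.spatialSum P M)
        ((CEM.currentFunctional Ω I).domRestrict (CEM.spatialSum P M))) := by
  have hconn : IsPreconnected Ω := isPreconnected_iff_preconnectedSpace.2 inferInstance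
  have hne : Ω.Nonempty := Set.nonempty_coe_sort.1 inferInstance
  have key : ∀ V : Submodule ℝ (CEM.HH Ω M), IsClosed (V : Set (CEM.HH Ω M)) →
      ∀ φ : V →L[ℝ] ℝ, CEM.GalerkinConvergence E σ V φ.toLinearMap := fun V hV φ =>
    CEM.galerkinConvergence_of_isClosed hΩ_lip hΩ_open hΩ_bounded hne hconn
      (zero_lt_two.trans_le hM) hE hσ hV φ
  have hcur : ∀ (I : CEM.RDiamond M) (V : Submodule ℝ (CEM.HH Ω M)),
      (CEM.currentFunctional Ω I).domRestrict V =
        ((CEM.currentFunctionalL Ω I).comp V.subtypeL).toLinearMap := fun I V =>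
    LinearMap.ext fun W => (CEM.currentFunctionalL_apply I (W : CEM.HH Ω M)).symm
  refine ⟨key, fun I => ?_, fun P hP I => ?_⟩
  · rw [hcur]
    exact key _ isClosed_univ _
  · rw [hcur]
    exact key _ (CEM.isClosed_spatialSum P) _
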